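/- Let $L\ge 1$ and $R,V,T\in\mathbb C^{L\times L}$. For $N\ge1$ let $H_N\in\mathbb C^{NL\times NL}$ be the block tridiagonal matrix with all diagonal blocks equal to $V$, all blocks on the upper block diagonal equal to $T$ and all blocks on the lower block diagonal equal to $R$. Assume (A) $T$ and $R$ are invertible. For $E\in\mathbb C$ let $$\mathcal T^E=\begin{pmatrix}(E\mathbf 1-V)T^{-1}&-R\\ T^{-1}&0\end{pmatrix}$$ and let $z_1(E),\dots,z_{2L}(E)$ be its eigenvalues, listed with algebraic multiplicity so that $|z_l(E)|\le|z_{l+1}(E)|$. Let $\mathcal F$ be the set of $E\in\mathbb C$ for which $\mathcal T^E$ has an eigenvalue of algebraic multiplicity at least two, and let $\Lambda=\{E\in\mathbb C:|z_L(E)|=|z_{L+1}(E)|\}$, with boundary $\partial\Lambda$. For $I\subset\{1,\dots,2L\}$ with $|I|=L$, and $E$ such that $z_i(E)\ne z_j(E)$ for all $i\in I$, $j\notin I$, let $$\mathcal R_I^E=\oint_{\gamma_I}\frac{dz}{2\pi\imath}(z\mathbf 1-\mathcal T^E)^{-1}$$ be the Riesz projection of $\mathcal T^E$ onto the eigenvalues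 $z_i(E)$, $i\in I$ (the contour $\gamma_I$ has winding number $1$ around these eigenvalues and $0$ around the others), and let $q_I(E)=\det_L\big(\binom{0}{\mathbf 1}^*\mathcal R_I^E\binom{\mathbf 1}{0}\big)$ be the determinant of its lower left $L\times L$ block. Put $I_0=\{1,\dots,L\}$, $I_1=\{1,\dots,L-1,L+1\}$ and $$\Gamma=\{E\in\mathbb C\setminus\Lambda: q_{I_0}(E)=0\}.$$ Assume moreover (B) $\mathcal F$ is finite; (C) $|z_{L-1}(E)|<|z_L(E)|=|z_{L+1}(E)|<|z_{L+2}(E)|$ for all but finitely many $E\in\partial\Lambda$ (if $L=1$, the two strict inequalities are void); (D) for every $E_0\in\partial\Lambda\setminus\mathcal F$ the functions $q_{I_0}$ and $q_{I_1}$ do not vanish identically near $E_0$. Here some labelling $z_1(E_0),\dots,z_{2L}(E_0)$ by non-decreasing modulus is chosen at $E_0$, and the (simple) eigenvalues, with their labels, are continued analytically to a neighbourhood of $E_0$, so that $q_{I_0}$ and $q_{I_1}$ are holomorphic near $E_0$. For sets $\Sigma_N\subset\mathbb C$, $N\ge 1$, let $\operatorname{u-lim}_{N\to\infty}\Sigma_N$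 be the set of all $E\in\mathbb C$ for which there are $E_N\in\Sigma_N$ $(N\ge1)$ with $E_N\to E$, and let $\operatorname{p-lim}_{N\to\infty}\Sigma_N$ be the set of all $E\in\mathbb C$ for which there are $N_n\ge1$ with $N_n\to\infty$ and $E_{N_n}\in\Sigma_{N_n}$ with $E_{N_n}\to E$ as $n\to\infty$. Then $$\partial\Lambda\cup\Gamma=\overline{\operatorname{u-lim}_{N\to\infty}\operatorname{spec}(H_N)}=\operatorname{p-lim}_{N\to\infty}\operatorname{spec}(H_N).$$ Moreover, for all but finitely many $E\in\partial\Lambda\cup\Gamma$ there exist $E_N\in\operatorname{spec}(H_N)$ with $\lim_{N\to\infty}E_N=E$. -/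

import Mathlib

open Filter Topology

noncomputable section

namespace BlockToeplitz

/-- The finite-volume Hamiltonian `H_N`: the block tridiagonal `NL × NL` matrix with `N` diagonal
blocks `V`, blocks `T` on the upper and blocks `R` on the lower block diagonal. -/
def finiteHam {L : ℕ} (R V T : Matrix (Fin L) (Fin L) ℂ) (N : ℕ) :
    Matrix (Fin N × Fin L) (Fin N × Fin L) ℂ :=
  fun p q =>
    if (p.1 : ℕ) = q.1 then V p.2 q.2
    else if (p.1 : ℕ) + 1 = q.1 then T p.2 q.2
    else if (p.1 : ℕ) = q.1 + 1 then R p.2 q.2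
    else 0

/-- The `2L × 2L` transfer matrix at energy `E`. -/
def transfer {L : ℕ} (R V T : Matrix (Fin L) (Fin L) ℂ) (E : ℂ) :
    Matrix (Fin L ⊕ Fin L) (Fin L ⊕ Fin L) ℂ :=
  Matrix.fromBlocks ((E • (1 : Matrix (Fin L) (Fin L) ℂ) - V) * T⁻¹) (-R) T⁻¹ 0

/-- The family `z` lists the eigenvalues of `A` with their algebraic multiplicities. -/
def ListsEigenvalues {L : ℕ} (A : Matrix (Fin L ⊕ Fin L) (Fin L ⊕ Fin L) ℂ)
    (z : Fin (2 * L) → ℂ) : Prop :=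
  Finset.univ.val.map z = A.charpoly.roots

/-- The family `z` lists the eigenvalues of `A` with their algebraic multiplicities, ordered by
non-decreasing modulus. -/
def IsOrderedListing {L : ℕ} (A : Matrix (Fin L ⊕ Fin L) (Fin L ⊕ Fin L) ℂ)
    (z : Fin (2 * L) → ℂ) : Prop :=
  ListsEigenvalues A z ∧ Monotone fun i => ‖z i‖

theorem exists_isOrderedListing {L : ℕ} (A : Matrix (Fin L ⊕ Fin L) (Fin L ⊕ Fin L) ℂ) :
    ∃ z, IsOrderedListing A z := by
  have hcard : A.charpoly.roots.toList.length = 2 * L := by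
    rw [Multiset.length_toList, IsAlgClosed.card_roots_eq_natDegree,
      Matrix.charpoly_natDegree_eq_dim]
    simp [two_mul]
  let f : Fin (2 * L) → ℂ := fun i => A.charpoly.roots.toList.get (Fin.cast hcard.symm i)
  have hf : Finset.univ.val.map f = A.charpoly.roots := by
    have h1 : Finset.univ.val.map f = (List.ofFn f : Multiset ℂ) := by
      simp [Fin.univ_val_map]
    rw [h1]
    have h2 : List.ofFn f = A.charpoly.roots.toList := by
      apply List.ext_get
      · simp [hcard]
      · intro n h h'
        simp [f]
    rw [h2, Multiset.coe_toList]
  refine ⟨f ∘ Tuple.sort (fun i => ‖f i‖), ?_, Tuple.monotone_sort (fun i => ‖f i‖)⟩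
  have h3 : Finset.univ.val.map (Tuple.sort (fun i => ‖f i‖)) =
      (Finset.univ : Finset (Fin (2 * L))).val := by
    simp
  unfold ListsEigenvalues
  rw [← Multiset.map_map, h3, hf]

/-- The eigenvalues `z_1(E), …, z_{2L}(E)` of the transfer matrix, ordered by non-decreasing modulus
(the index is shifted by one: `eig R V T E i` is `z_{i+1}(E)`). -/
def eig {L : ℕ} (R V T : Matrix (Fin L) (Fin L) ℂ) (E : ℂ) : Fin (2 * L) → ℂ :=
  (exists_isOrderedListing (transfer R V T E)).choose

theorem eig_spec {L : ℕ} (R V T : Matrix (Fin L) (Fin L) ℂ) (E : ℂ) :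
    IsOrderedListing (transfer R V T E) (eig R V T E) :=
  (exists_isOrderedListing (transfer R V T E)).choose_spec

/-- The position of `z_L` in the list `z_1, …, z_{2L}`. -/
def midLow (L : ℕ) [NeZero L] : Fin (2 * L) :=
  ⟨L - 1, by have := NeZero.pos L; omega⟩

/-- The position of `z_{L+1}` in the list `z_1, …, z_{2L}`. -/
def midHigh (L : ℕ) [NeZero L] : Fin (2 * L) :=
  ⟨L, by have := NeZero.pos L; omega⟩

/-- The positions belonging to `I_0 = {1, …, L}`. -/
def indexZero (L : ℕ) : Finset (Fin (2 * L)) :=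
  Finset.univ.filter fun i => (i : ℕ) < L

/-- The positions belonging to `I_1 = {1, …, L-1, L+1}`. -/
def indexOne (L : ℕ) : Finset (Fin (2 * L)) :=
  Finset.univ.filter fun i => (i : ℕ) + 1 < L ∨ (i : ℕ) = L

/-- The set `𝓕` of energies at which the transfer matrix has a degenerate eigenvalue. -/
def degenerateSet {L : ℕ} (R V T : Matrix (Fin L) (Fin L) ℂ) : Set ℂ :=
  {E | ∃ z : ℂ, 2 ≤ (transfer R V T E).charpoly.rootMultiplicity z}

/-- The set `Λ` of energies at which the two middle eigenvalues have the same modulus. -/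
def lambdaSet {L : ℕ} [NeZero L] (R V T : Matrix (Fin L) (Fin L) ℂ) : Set ℂ :=
  {E | ‖eig R V T E (midLow L)‖ = ‖eig R V T E (midHigh L)‖}

/-- A positive radius smaller than the distance of any two distinct eigenvalues of `A`. -/
def sepRadius {n : Type*} [Fintype n] [DecidableEq n] (A : Matrix n n ℂ) : ℝ :=
  (insert (1 : ℝ) (A.charpoly.roots.toFinset.offDiag.image fun p => dist p.1 p.2)).min'
    ⟨1, Finset.mem_insert_self _ _⟩ / 2

/-- The Riesz projection `∮_γ (z - A)⁻¹ dz / (2πi)` of `A` onto its eigenvalues lying in `S`. The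
contour `γ` is the union of positively oriented circles around the eigenvalues in `S`, so small that
they have winding number one around the eigenvalues in `S` and zero around all the others. -/
def rieszProjection {n : Type*} [Fintype n] [DecidableEq n] (A : Matrix n n ℂ) (S : Finset ℂ) :
    Matrix n n ℂ :=
  Matrix.of fun i j =>
    ∑ μ ∈ A.charpoly.roots.toFinset ∩ S,
      (2 * Real.pi * Complex.I)⁻¹ *
        ∮ z in C(μ, sepRadius A), (z • (1 : Matrix n n ℂ) - A)⁻¹ i j

/-- `q_I(E)` with respect to a given list `z` of the eigenvalues of the transfer matrix at `E`: the
determinant of the lower left `L × L` block of the Riesz projection onto the eigenvalues `z i`,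
`i ∈ I`. -/
def qFun {L : ℕ} (R V T : Matrix (Fin L) (Fin L) ℂ) (I : Finset (Fin (2 * L)))
    (E : ℂ) (z : Fin (2 * L) → ℂ) : ℂ :=
  (rieszProjection (transfer R V T E) (I.image z)).toBlocks₂₁.det

/-- The set `Γ` of spectral outliers. -/
def gammaSet {L : ℕ} [NeZero L] (R V T : Matrix (Fin L) (Fin L) ℂ) : Set ℂ :=
  {E | E ∉ lambdaSet R V T ∧ qFun R V T (indexZero L) E (eig R V T E) = 0}

/-- The chain `|z_{L-1}(E)| < |z_L(E)| = |z_{L+1}(E)| < |z_{L+2}(E)|`, where the first and the last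
inequality are void if `L = 1`. -/
def OnlyMiddleEqual {L : ℕ} [NeZero L] (R V T : Matrix (Fin L) (Fin L) ℂ) (E : ℂ) : Prop :=
  (∀ i : Fin (2 * L), (i : ℕ) + 2 = L → ‖eig R V T E i‖ < ‖eig R V T E (midLow L)‖) ∧
  ‖eig R V T E (midLow L)‖ = ‖eig R V T E (midHigh L)‖ ∧
  (∀ i : Fin (2 * L), (i : ℕ) = L + 1 → ‖eig R V T E (midHigh L)‖ < ‖eig R V T E i‖)

/-- `ζ` is a listing of the eigenvalues of the transfer matrix near `E₀` by functions that are
analytic at `E₀`. -/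
def IsAnalyticListing {L : ℕ} (R V T : Matrix (Fin L) (Fin L) ℂ) (E₀ : ℂ)
    (ζ : Fin (2 * L) → ℂ → ℂ) : Prop :=
  (∀ i, AnalyticAt ℂ (ζ i) E₀) ∧
  ∀ᶠ E in 𝓝 E₀, ListsEigenvalues (transfer R V T E) fun i => ζ i E

/-- The functions `q_{I_0}` and `q_{I_1}` do not vanish identically near `E₀`. Here an ordered
labelling `z` of the eigenvalues is fixed at `E₀` and is continued analytically to nearby energies;
for `E₀ ∉ 𝓕` the continuation exists and its germ at `E₀` is unique. -/
def QNotLocallyZero {L : ℕ} (R V T : Matrix (Fin L) (Fin L) ℂ) (E₀ : ℂ) : Prop :=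
  ∃ z : Fin (2 * L) → ℂ, IsOrderedListing (transfer R V T E₀) z ∧
    ∀ ζ : Fin (2 * L) → ℂ → ℂ, IsAnalyticListing R V T E₀ ζ → (∀ i, ζ i E₀ = z i) →
      (∃ᶠ E in 𝓝 E₀, qFun R V T (indexZero L) E (fun i => ζ i E) ≠ 0) ∧
      (∃ᶠ E in 𝓝 E₀, qFun R V T (indexOne L) E (fun i => ζ i E) ≠ 0)

/-- The uniform limit set of the sequence `(S N)_{N ≥ 1}`. -/
def uniformLimitSet (S : ℕ → Set ℂ) : Set ℂ :=
  {E | ∃ e : ℕ → ℂ, (∀ N, 1 ≤ N → e N ∈ S N) ∧ Tendsto e atTop (𝓝 E)}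

/-- The partial limit set of the sequence `(S N)_{N ≥ 1}`. -/
def partialLimitSet (S : ℕ → Set ℂ) : Set ℂ :=
  {E | ∃ (k : ℕ → ℕ) (e : ℕ → ℂ), (∀ n, 1 ≤ k n ∧ e n ∈ S (k n)) ∧
    Tendsto k atTop atTop ∧ Tendsto e atTop (𝓝 E)}

end BlockToeplitz

end

/-!
Let `M` be the transfer matrix at the energy `E`. Solving `R φ_{k-1} + V φ_k + T φ_{k+1} = E φ_k`
from `φ_0 = 0` shows that `E` is an eigenvalue of `H_N` exactly if the lower left block of
`M ^ (N + 1)` is singular (`mem_spectrum_finiteHam_iff`). If the eigenvalues `z_i` of `M` are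
simple, the Cauchy–Binet formula in an eigenbasis expands the determinant of that block of `M ^ N`
as `(-1) ^ L ∑_I (∏_{i ∉ I} z_i) ^ N q_I(E)` over the sets `I` of `L` indices
(`IsEigenbasis.det_pow`, `powerDet_eq_sum`).

*Off `Λ`* the set `I₀` of the `L` smallest eigenvalues dominates strictly. Divided by
`(∏_{i > L} z_i) ^ N`, the determinants converge to `± q_{I₀}`, locally uniformly; the finitely many
degenerate energies are covered by the maximum principle (`exists_tendstoUniformlyOn_scaledDet`).
Hence the partial limit set is contained in `Λ ∪ Γ`, and by Hurwitz's theorem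
(`eventually_exists_zero`) a point of `Γ` is a limit of eigenvalues, unless `q_{I₀}` vanishes
identically near it.

*Exclusion of degenerate behaviour.* An open set with finite frontier is empty or cofinite. The
interior of `Λ` and the set of energies near which `q_{I₀}` vanishes identically have finite
frontier: near all but finitely many points of `∂Λ` the eigenvalues are simple and only the two
middle moduli agree, so that `Λ` is the level set `|z_L / z_{L+1}| = 1` of a holomorphic function,
and beside `Λ` the function `q_{I₀}` is the germ of `q_{I₀}` or of `q_{I₁}` at the point, neither of
which is zero by the hypothesis `hD`
(`frontier_interior_lambdaSet_subset`, `frontier_vanishingSet_subset`). As `E → ∞`, there are `L`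
eigenvalues of order `E` and `L` of order `E⁻¹`, and `q_{I₀} ≠ 0`
(`eventually_cobounded_notMem_and_qLow_ne_zero`), so that both sets are empty. In particular
`∂Λ = Λ` (`frontier_lambdaSet_eq`, `vanishingSet_eq_empty`).

*On `Λ`*: `Λ` has no isolated points, since around such a point symmetric functions of the two
groups of eigenvalues would extend holomorphically and violate the maximum principle
(`frequently_mem_lambdaSet`). So the points where the eigenvalues are simple, only the two middle
moduli agree, `q_{I₀}` and `q_{I₁}` do not vanish and `z_L / z_{L+1}` has nonzero derivative are
dense in `Λ`. At such a point exactly two terms of the expansion dominate; rescaled to `E + t / N`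
they converge to a function `a + b e^{ct}` with zeros, and Hurwitz's theorem provides eigenvalues
(`eventually_exists_zero_of_two_terms`). Since the uniform limit set is closed, it contains all of
`Λ`, and no exceptional points remain.
-/

namespace BlockToeplitz

open Matrix Finset

/-! ### Expansion of block determinants over an eigenbasis -/

/-- The indicator vector of a finite index set. -/
def ind {ι : Type*} [DecidableEq ι] (I : Finset ι) : ι → ℂ := fun i => if i ∈ I then 1 else 0

/-- Expansion of the determinant along all choices of a column index in each column. -/
theorem det_mul_diagonal_mul_eq_sum_fun {m ι : Type*} [Fintype m] [DecidableEq m] [Fintype ι]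
    [DecidableEq ι] (X : Matrix m ι ℂ) (t : ι → ℂ) (Y : Matrix ι m ℂ) :
    (X * diagonal t * Y).det =
      ∑ f : m → ι, (∏ c, t (f c)) * ((∏ c, Y (f c) c) * (X.submatrix id f).det) := by
  have h : ∀ r c, (X * diagonal t * Y) r c = ∑ j, X r j * t j * Y j c := by
    intro r c
    rw [Matrix.mul_apply]
    simp [Matrix.mul_diagonal]
  rw [det_apply']
  simp_rw [h, Finset.prod_univ_sum, Fintype.piFinset_univ, Finset.mul_sum]
  rw [Finset.sum_comm]
  refine Finset.sum_congr rfl fun f _ => ?_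
  rw [det_apply', Finset.mul_sum, Finset.mul_sum]
  refine Finset.sum_congr rfl fun σ _ => ?_
  simp only [Finset.prod_mul_distrib, submatrix_apply, id]
  ring

/-- Cauchy–Binet expansion, grouped by the set of columns that is used. -/
theorem det_mul_diagonal_mul {m ι : Type*} [Fintype m] [DecidableEq m] [Fintype ι]
    [DecidableEq ι] (X : Matrix m ι ℂ) (t : ι → ℂ) (Y : Matrix ι m ℂ) :
    (X * diagonal t * Y).det =
      ∑ I ∈ Finset.powersetCard (Fintype.card m) (Finset.univ : Finset ι),
        (∏ i ∈ I, t i) * (X * diagonal (ind I) * Y).det := by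
  -- On the right only `I = f(m)` contributes to the term of an injective `f`; the others are zero.
  simp_rw [det_mul_diagonal_mul_eq_sum_fun, Finset.mul_sum]
  rw [Finset.sum_comm]
  refine Finset.sum_congr rfl fun f _ => ?_
  by_cases hf : Function.Injective f
  · rw [Finset.sum_eq_single (Finset.univ.image f)]
    · rw [Finset.prod_image fun a _ b _ h => hf h]
      simp [ind]
    · intro I hI hne
      have : ∃ c, f c ∉ I := by
        by_contra! hc
        apply hne
        symm
        apply Finset.eq_of_subset_of_card_le
        · intro x hx
          obtain ⟨c, -, rfl⟩ := Finset.mem_image.1 hx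
          exact hc c
        · rw [Finset.card_image_of_injective _ hf, (Finset.mem_powersetCard.1 hI).2,
            Finset.card_univ]
      obtain ⟨c, hc⟩ := this
      rw [Finset.prod_eq_zero (Finset.mem_univ c) (by simp [ind, hc])]
      ring
    · intro h
      exact absurd (Finset.mem_powersetCard.2 ⟨Finset.subset_univ _, by
        rw [Finset.card_image_of_injective _ hf, Finset.card_univ]⟩) h
  · obtain ⟨a, b, hab, hne⟩ : ∃ a b, f a = f b ∧ a ≠ b := by
      simpa [Function.Injective] using hf
    have : (X.submatrix id f).det = 0 :=
      det_zero_of_column_eq hne fun k => by simp [hab]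
    simp [this]

/-- `A = U diag(z) W` with mutually inverse `U` and `W`: an eigenbasis of `A` and its dual basis. -/
structure IsEigenbasis {n ι : Type*} [Fintype n] [DecidableEq n] [Fintype ι] [DecidableEq ι]
    (A : Matrix n n ℂ) (z : ι → ℂ) (U : Matrix n ι ℂ) (W : Matrix ι n ℂ) : Prop where
  mul_eq_one : U * W = 1
  mul_eq_one' : W * U = 1
  eq : A = U * diagonal z * W

section Eigenbasis

variable {n ι : Type*} [Fintype n] [DecidableEq n] [Fintype ι] [DecidableEq ι]
  {A : Matrix n n ℂ} {z : ι → ℂ} {U : Matrix n ι ℂ} {W : Matrix ι n ℂ}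

theorem IsEigenbasis.conj_mul_conj (h : IsEigenbasis A z U W) (s t : ι → ℂ) :
    (U * diagonal s * W) * (U * diagonal t * W) = U * diagonal (fun i => s i * t i) * W := by
  calc (U * diagonal s * W) * (U * diagonal t * W) = U * diagonal s * (W * U) * diagonal t * W := by
        simp only [Matrix.mul_assoc]
    _ = _ := by rw [h.mul_eq_one', Matrix.mul_one, Matrix.mul_assoc U, diagonal_mul_diagonal]

theorem IsEigenbasis.pow_eq (h : IsEigenbasis A z U W) (N : ℕ) :
    A ^ N = U * diagonal (fun i => z i ^ N) * W := by
  induction N with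
  | zero => simp [h.mul_eq_one]
  | succ k ih =>
    rw [pow_succ, ih]
    conv_lhs => rw [h.eq]
    rw [h.conj_mul_conj]
    simp [pow_succ]

theorem IsEigenbasis.mul_conj (h : IsEigenbasis A z U W) (s : ι → ℂ) :
    A * (U * diagonal s * W) = U * diagonal (fun i => z i * s i) * W := by
  conv_lhs => rw [h.eq]
  rw [h.conj_mul_conj]

theorem exists_isEigenbasis {L : ℕ} {A : Matrix (Fin L ⊕ Fin L) (Fin L ⊕ Fin L) ℂ}
    {z : Fin (2 * L) → ℂ} (hz : ListsEigenvalues A z) (hinj : Function.Injective z) :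
    ∃ U W, IsEigenbasis A z U W := by
  have hroot : ∀ i, A.charpoly.IsRoot (z i) := by
    intro i
    have : z i ∈ A.charpoly.roots := by
      rw [← hz]; exact Multiset.mem_map_of_mem _ (Finset.mem_univ i)
    exact Polynomial.isRoot_of_mem_roots this
  have hv : ∀ i, ∃ v, Module.End.HasEigenvector (Matrix.toLin' A) (z i) v := by
    intro i
    have : Module.End.HasEigenvalue (Matrix.toLin' A) (z i) := by
      rw [Module.End.hasEigenvalue_iff_isRoot_charpoly, Matrix.charpoly_toLin']
      exact hroot i
    exact this.exists_hasEigenvector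
  choose v hv using hv
  have hli := Module.End.eigenvectors_linearIndependent' (Matrix.toLin' A) z hinj v hv
  have hcard : Fintype.card (Fin (2 * L)) = Module.finrank ℂ (Fin L ⊕ Fin L → ℂ) := by
    simp [two_mul]
  let b : Module.Basis (Fin (2 * L)) ℂ (Fin L ⊕ Fin L → ℂ) :=
    basisOfLinearIndependentOfCardEqFinrank' v hli hcard
  have hb : ∀ i, b i = v i := by
    intro i; simp [b]
  let e := Pi.basisFun ℂ (Fin L ⊕ Fin L)
  refine ⟨e.toMatrix b, b.toMatrix e, e.toMatrix_mul_toMatrix_flip b,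
    b.toMatrix_mul_toMatrix_flip e, ?_⟩
  have h1 : A * e.toMatrix b = e.toMatrix b * diagonal z := by
    ext r i
    rw [Matrix.mul_diagonal, Matrix.mul_apply]
    have := congrFun (hv i).apply_eq_smul r
    simp only [Matrix.toLin'_apply, Matrix.mulVec, dotProduct, Pi.smul_apply, smul_eq_mul] at this
    simp only [Module.Basis.toMatrix_apply, e, Pi.basisFun_repr, hb]
    rw [this]; ring
  rw [← h1, Matrix.mul_assoc, e.toMatrix_mul_toMatrix_flip b, Matrix.mul_one]

end Eigenbasis

theorem conj_ind_compl {L : ℕ} {U : Matrix (Fin L ⊕ Fin L) (Fin (2 * L)) ℂ}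
    {W : Matrix (Fin (2 * L)) (Fin L ⊕ Fin L) ℂ} (h : U * W = 1) (I : Finset (Fin (2 * L))) :
    U * diagonal (ind Iᶜ) * W = 1 - U * diagonal (ind I) * W := by
  have : diagonal (ind Iᶜ) = 1 - diagonal (ind I) := by
    rw [← diagonal_one, diagonal_sub]
    congr 1
    ext i
    by_cases hi : i ∈ I <;> simp [ind, hi]
  rw [this, Matrix.mul_sub, Matrix.sub_mul, Matrix.mul_one, h]

theorem toBlocks₂₁_conj {m ι : Type*} [Fintype m] [Fintype ι] [DecidableEq ι]
    (U : Matrix (m ⊕ m) ι ℂ) (W : Matrix ι (m ⊕ m) ℂ) (t : ι → ℂ) :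
    (U * diagonal t * W).toBlocks₂₁ =
      (U.submatrix Sum.inr id) * diagonal t * (W.submatrix id Sum.inl) := by
  ext i j
  simp [toBlocks₂₁, Matrix.mul_apply]

theorem det_toBlocks₂₁_conj {m ι : Type*} [Fintype m] [DecidableEq m] [Fintype ι] [DecidableEq ι]
    (U : Matrix (m ⊕ m) ι ℂ) (W : Matrix ι (m ⊕ m) ℂ) (t : ι → ℂ) :
    (U * diagonal t * W).toBlocks₂₁.det =
      ∑ I ∈ Finset.powersetCard (Fintype.card m) (Finset.univ : Finset ι),
        (∏ i ∈ I, t i) * (U * diagonal (ind I) * W).toBlocks₂₁.det := by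
  simp_rw [toBlocks₂₁_conj]
  exact det_mul_diagonal_mul _ _ _

theorem det_toBlocks₂₁_conj_compl {L : ℕ} {U : Matrix (Fin L ⊕ Fin L) (Fin (2 * L)) ℂ}
    {W : Matrix (Fin (2 * L)) (Fin L ⊕ Fin L) ℂ} (h : U * W = 1) (I : Finset (Fin (2 * L))) :
    (U * diagonal (ind Iᶜ) * W).toBlocks₂₁.det =
      (-1) ^ L * (U * diagonal (ind I) * W).toBlocks₂₁.det := by
  rw [conj_ind_compl h]
  have : (1 - U * diagonal (ind I) * W).toBlocks₂₁ = -(U * diagonal (ind I) * W).toBlocks₂₁ := by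
    ext i j
    simp [toBlocks₂₁]
  rw [this, det_neg, Fintype.card_fin]

/-- The subsets of `{1, …, 2L}` with `L` elements. -/
abbrev halfSets (L : ℕ) : Finset (Finset (Fin (2 * L))) := Finset.powersetCard L Finset.univ

theorem mem_halfSets_compl {L : ℕ} {I : Finset (Fin (2 * L))} (hI : I ∈ halfSets L) :
    Iᶜ ∈ halfSets L := by
  rw [Finset.mem_powersetCard] at *
  refine ⟨Finset.subset_univ _, ?_⟩
  rw [Finset.card_compl, hI.2, Fintype.card_fin]; omega

/-- The determinant of the lower left block of a power, expanded in products of eigenvalues; the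
sum is indexed by the complement of the set of eigenvalues in the product. -/
theorem IsEigenbasis.det_pow {L : ℕ} {A : Matrix (Fin L ⊕ Fin L) (Fin L ⊕ Fin L) ℂ}
    {z : Fin (2 * L) → ℂ} {U : Matrix (Fin L ⊕ Fin L) (Fin (2 * L)) ℂ}
    {W : Matrix (Fin (2 * L)) (Fin L ⊕ Fin L) ℂ} (h : IsEigenbasis A z U W) (N : ℕ) :
    (A ^ N).toBlocks₂₁.det = (-1) ^ L * ∑ I ∈ halfSets L,
      (∏ i ∈ Iᶜ, z i) ^ N * (U * diagonal (ind I) * W).toBlocks₂₁.det := by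
  rw [h.pow_eq, det_toBlocks₂₁_conj, Fintype.card_fin, Finset.mul_sum]
  refine Finset.sum_nbij' (fun I => Iᶜ) (fun I => Iᶜ) (fun I hI => mem_halfSets_compl hI)
    (fun I hI => mem_halfSets_compl hI) (fun I _ => compl_compl I) (fun I _ => compl_compl I) ?_
  intro I _
  rw [det_toBlocks₂₁_conj_compl h.mul_eq_one, compl_compl, Finset.prod_pow]
  have : ((-1 : ℂ) ^ L) * (-1) ^ L = 1 := by rw [← mul_pow]; simp
  linear_combination (-(∏ i ∈ I, z i) ^ N * (U * diagonal (ind I) * W).toBlocks₂₁.det) * this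

/-! ### The spectrum of `H_N` and powers of the transfer matrix -/

/-- The lower block of the transfer matrix reproduces the upper component of a state. -/
theorem transfer_mulVec_elim {L : ℕ} (R V T : Matrix (Fin L) (Fin L) ℂ) (E : ℂ)
    (u v : Fin L → ℂ) :
    transfer R V T E *ᵥ Sum.elim u v =
      Sum.elim (E • (T⁻¹ *ᵥ u) - V *ᵥ (T⁻¹ *ᵥ u) - R *ᵥ v) (T⁻¹ *ᵥ u) := by
  rw [transfer, Matrix.fromBlocks_mulVec]
  congr 1
  · simp only [Sum.elim_comp_inl, Sum.elim_comp_inr, Matrix.sub_mul, Matrix.smul_mul,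
      Matrix.one_mul, Matrix.sub_mulVec, Matrix.smul_mulVec, Matrix.neg_mulVec,
      ← Matrix.mulVec_mulVec]
    abel
  · simp

/-- A vector on the `N` sites is a sequence `φ_1, …, φ_N`, here extended by `φ_0 = φ_{N+1} = 0`. -/
theorem finiteHam_mulVec {L : ℕ} (R V T : Matrix (Fin L) (Fin L) ℂ) {N : ℕ}
    (φ : ℕ → Fin L → ℂ) (h0 : φ 0 = 0) (hN : φ (N + 1) = 0) (p : Fin N) (a : Fin L) :
    (finiteHam R V T N *ᵥ fun q => φ (q.1 + 1) q.2) (p, a) =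
      (R *ᵥ φ p) a + (V *ᵥ φ (p + 1)) a + (T *ᵥ φ (p + 2)) a := by
  have hsplit : ∀ q : Fin N, ∑ b, finiteHam R V T N (p, a) (q, b) * φ (q + 1) b =
      (if (p : ℕ) = q + 1 then (R *ᵥ φ (q + 1)) a else 0) +
      (if (p : ℕ) = q then (V *ᵥ φ (q + 1)) a else 0) +
      (if (p : ℕ) + 1 = q then (T *ᵥ φ (q + 1)) a else 0) := by
    intro q
    simp only [finiteHam, Matrix.mulVec, dotProduct]
    by_cases h1 : (p : ℕ) = q
    · simp [h1]
    · by_cases h2 : (p : ℕ) + 1 = q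
      · have : (p : ℕ) ≠ q + 1 := by omega
        simp [h1, h2, this]
      · by_cases h3 : (p : ℕ) = q + 1
        · have : (q : ℕ) + 1 + 1 ≠ q := by omega
          simp [h3, this]
        · simp [h1, h2, h3]
  have hsum : (finiteHam R V T N *ᵥ fun q => φ (q.1 + 1) q.2) (p, a) =
      ∑ q : Fin N, ∑ b, finiteHam R V T N (p, a) (q, b) * φ (q + 1) b := by
    rw [Matrix.mulVec, dotProduct, Fintype.sum_prod_type]
  rw [hsum]
  simp_rw [hsplit]
  rw [Finset.sum_add_distrib, Finset.sum_add_distrib]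
  congr 1
  · congr 1
    · rcases Nat.eq_zero_or_pos (p : ℕ) with hp | hp
      · rw [hp, h0]
        simp
      · rw [Finset.sum_eq_single ⟨(p : ℕ) - 1, by omega⟩]
        · have : (p : ℕ) = p - 1 + 1 := by omega
          simp [← this]
        · intro q _ hq
          rw [if_neg]
          intro h
          exact hq (Fin.ext (by simp only; omega))
        · simp
    · rw [Finset.sum_eq_single p]
      · simp
      · intro q _ hq
        rw [if_neg]
        intro h
        exact hq (Fin.ext h.symm)
      · simp
  · by_cases hp : (p : ℕ) + 1 < N
    · rw [Finset.sum_eq_single ⟨(p : ℕ) + 1, hp⟩]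
      · simp
      · intro q _ hq
        rw [if_neg]
        intro h
        exact hq (Fin.ext h.symm)
      · simp
    · have : (p : ℕ) + 2 = N + 1 := by omega
      rw [this, hN]
      simp only [Matrix.mulVec_zero, Pi.zero_apply]
      apply Finset.sum_eq_zero
      intro q _
      rw [if_neg]
      omega

theorem mem_spectrum_iff_exists_mulVec {n : Type*} [Fintype n] [DecidableEq n]
    (H : Matrix n n ℂ) (E : ℂ) : E ∈ spectrum ℂ H ↔ ∃ v ≠ 0, H *ᵥ v = E • v := by
  rw [spectrum.mem_iff, Matrix.isUnit_iff_isUnit_det, isUnit_iff_ne_zero, not_not,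
    ← Matrix.exists_mulVec_eq_zero_iff]
  have : ∀ v, (algebraMap ℂ (Matrix n n ℂ) E - H) *ᵥ v = 0 ↔ H *ᵥ v = E • v := by
    intro v
    rw [Matrix.sub_mulVec, Algebra.algebraMap_eq_smul_one, Matrix.smul_mulVec, Matrix.one_mulVec,
      sub_eq_zero, eq_comm]
  simp_rw [this]

/-- The powers of the transfer matrix propagate the solutions of `R φ_{k-1} + V φ_k + T φ_{k+1} =
E φ_k`, and `E` is an eigenvalue of `H_N` iff there is a nonzero solution with Dirichlet conditions
`φ_0 = φ_{N+1} = 0`. -/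
theorem mem_spectrum_finiteHam_iff {L : ℕ} {R V T : Matrix (Fin L) (Fin L) ℂ} (hT : IsUnit T)
    {N : ℕ} (hN : 1 ≤ N) (E : ℂ) :
    E ∈ spectrum ℂ (finiteHam R V T N) ↔
      (transfer R V T E ^ (N + 1)).toBlocks₂₁.det = 0 := by
  have hdet : IsUnit T.det := (Matrix.isUnit_iff_isUnit_det _).1 hT
  have hTi : ∀ u, T⁻¹ *ᵥ (T *ᵥ u) = u := by
    intro u; rw [Matrix.mulVec_mulVec, Matrix.nonsing_inv_mul _ hdet, Matrix.one_mulVec]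
  have hTi' : ∀ u, T *ᵥ (T⁻¹ *ᵥ u) = u := by
    intro u; rw [Matrix.mulVec_mulVec, Matrix.mul_nonsing_inv _ hdet, Matrix.one_mulVec]
  have hblock : ∀ (M : Matrix (Fin L ⊕ Fin L) (Fin L ⊕ Fin L) ℂ) (u : Fin L → ℂ) (a : Fin L),
      (M *ᵥ Sum.elim u 0) (Sum.inr a) = (M.toBlocks₂₁ *ᵥ u) a := by
    intro M u a
    simp [Matrix.mulVec, dotProduct, Matrix.toBlocks₂₁]
  rw [mem_spectrum_iff_exists_mulVec, ← Matrix.exists_mulVec_eq_zero_iff]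
  constructor
  · rintro ⟨v, hv0, hv⟩
    -- An eigenvector, extended by zero, is propagated by the transfer matrix.
    let φ : ℕ → Fin L → ℂ := fun k a => if h : 1 ≤ k ∧ k ≤ N then v (⟨k - 1, by omega⟩, a) else 0
    have h0 : φ 0 = 0 := by ext a; simp [φ]
    have hN1 : φ (N + 1) = 0 := by ext a; simp [φ]
    have hφv : (fun q : Fin N × Fin L => φ (q.1 + 1) q.2) = v := by
      ext ⟨q, b⟩
      have : (q : ℕ) + 1 ≤ N := q.2
      simp [φ, this]
    have hrec : ∀ k, k < N → R *ᵥ φ k + V *ᵥ φ (k + 1) + T *ᵥ φ (k + 2) = E • φ (k + 1) := by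
      intro k hk
      ext a
      have h1 := finiteHam_mulVec R V T φ h0 hN1 ⟨k, hk⟩ a
      rw [hφv, hv] at h1
      have h2 : v (⟨k, hk⟩, a) = φ (k + 1) a := by rw [← hφv]
      simp only [Pi.smul_apply, smul_eq_mul, h2] at h1
      simp only [Pi.add_apply, Pi.smul_apply, smul_eq_mul]
      exact h1.symm
    have hpow : ∀ k, k ≤ N → transfer R V T E ^ k *ᵥ Sum.elim (T *ᵥ φ 1) 0 =
        Sum.elim (T *ᵥ φ (k + 1)) (φ k) := by
      intro k
      induction k with
      | zero => intro _; simp [h0]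
      | succ k ih =>
        intro hk
        rw [pow_succ', ← Matrix.mulVec_mulVec, ih (by omega), transfer_mulVec_elim, hTi]
        congr 1
        rw [← hrec k (by omega)]
        abel
    refine ⟨T *ᵥ φ 1, ?_, ?_⟩
    · intro h
      have hφ1 : φ 1 = 0 := by rw [← hTi (φ 1), h, Matrix.mulVec_zero]
      apply hv0
      have hz : ∀ k, k ≤ N → φ k = 0 := by
        intro k hk
        have := hpow k hk
        rw [hφ1, Matrix.mulVec_zero] at this
        have he : (Sum.elim 0 0 : Fin L ⊕ Fin L → ℂ) = 0 := by ext (a | a) <;> rfl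
        rw [he, Matrix.mulVec_zero] at this
        ext a
        exact (congrFun this (Sum.inr a)).symm
      rw [← hφv]
      ext ⟨q, b⟩
      rw [hz _ (by have := q.2; omega)]
      rfl
    · have h1 := hpow N le_rfl
      ext a
      rw [← hblock, pow_succ', ← Matrix.mulVec_mulVec, h1, hN1, transfer_mulVec_elim]
      simp
  · rintro ⟨u, hu0, hu⟩
    -- Conversely, propagate a kernel vector `u`; the lower components are an eigenvector.
    let ψ : ℕ → Fin L ⊕ Fin L → ℂ := fun k => transfer R V T E ^ k *ᵥ Sum.elim u 0
    let φ : ℕ → Fin L → ℂ := fun k a => ψ k (Sum.inr a)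
    let χ : ℕ → Fin L → ℂ := fun k a => ψ k (Sum.inl a)
    have hψ : ∀ k, ψ k = Sum.elim (χ k) (φ k) := by
      intro k; ext (a | a) <;> rfl
    have hstep : ∀ k, ψ (k + 1) =
        Sum.elim (E • (T⁻¹ *ᵥ χ k) - V *ᵥ (T⁻¹ *ᵥ χ k) - R *ᵥ φ k) (T⁻¹ *ᵥ χ k) := by
      intro k
      rw [← transfer_mulVec_elim, ← hψ]
      simp only [ψ, pow_succ', Matrix.mulVec_mulVec]
    have hφs : ∀ k, φ (k + 1) = T⁻¹ *ᵥ χ k := by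
      intro k; ext a; simp only [φ]; rw [hstep]; rfl
    have hχs : ∀ k, χ (k + 1) = E • (T⁻¹ *ᵥ χ k) - V *ᵥ (T⁻¹ *ᵥ χ k) - R *ᵥ φ k := by
      intro k; ext a; simp only [χ]; rw [hstep]; rfl
    have h0 : φ 0 = 0 := by ext a; simp [φ, ψ]
    have hN1 : φ (N + 1) = 0 := by
      ext a
      simp only [φ, ψ, hblock, hu]
    have hφ1 : φ 1 = T⁻¹ *ᵥ u := by
      rw [hφs 0]
      congr 1
      ext a; simp [χ, ψ]
    refine ⟨fun q => φ (q.1 + 1) q.2, ?_, ?_⟩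
    · intro h
      apply hu0
      rw [← hTi' u, ← hφ1]
      have : φ 1 = 0 := by
        ext a
        exact congrFun h (⟨0, hN⟩, a)
      rw [this, Matrix.mulVec_zero]
    · ext ⟨p, a⟩
      rw [finiteHam_mulVec R V T φ h0 hN1]
      have h2 : T *ᵥ φ (p + 2) = E • φ (p + 1) - V *ᵥ φ (p + 1) - R *ᵥ φ p := by
        rw [hφs (p + 1), hTi', hχs, hφs]
      rw [h2]
      simp only [Pi.sub_apply, Pi.smul_apply, smul_eq_mul]
      ring

theorem spectrum_finiteHam_nonempty {L : ℕ} [NeZero L] (R V T : Matrix (Fin L) (Fin L) ℂ) {N : ℕ}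
    (hN : 1 ≤ N) : (spectrum ℂ (finiteHam R V T N)).Nonempty := by
  have : Nonempty (Fin N × Fin L) := ⟨⟨⟨0, hN⟩, ⟨0, NeZero.pos L⟩⟩⟩
  exact spectrum.nonempty_of_isAlgClosed_of_finiteDimensional ℂ _

/-! ### Listings of eigenvalues and their continuity -/

theorem exists_perm_of_map_eq {ι α : Type*} [Fintype ι] [DecidableEq α] {z w : ι → α}
    (h : Finset.univ.val.map z = Finset.univ.val.map w) : ∃ σ : Equiv.Perm ι, w = z ∘ σ := by
  have hc : ∀ c, Nonempty ({i // w i = c} ≃ {i // z i = c}) := by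
    intro c
    rw [← Fintype.card_eq]
    have h1 := congrArg (Multiset.count c) h
    rw [Multiset.count_map, Multiset.count_map] at h1
    rw [Fintype.card_subtype, Fintype.card_subtype]
    simp only [Finset.card, Finset.filter_val]
    simpa [eq_comm] using h1.symm
  let e := fun c => (hc c).some
  refine ⟨(Equiv.sigmaFiberEquiv w).symm.trans
    ((Equiv.sigmaCongrRight e).trans (Equiv.sigmaFiberEquiv z)), ?_⟩
  ext i
  exact ((e (w i)) ⟨i, rfl⟩).2.symm

section Listing

variable {L : ℕ} {A : Matrix (Fin L ⊕ Fin L) (Fin L ⊕ Fin L) ℂ} {z w : Fin (2 * L) → ℂ}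

theorem ListsEigenvalues.charpoly_eq (h : ListsEigenvalues A z) :
    A.charpoly = ∏ i, (Polynomial.X - Polynomial.C (z i)) := by
  have h1 := (IsAlgClosed.splits A.charpoly).eq_prod_roots_of_monic A.charpoly_monic
  rw [← h, Multiset.map_map] at h1
  exact h1

/-- Listing the eigenvalues is a closed condition on the matrix and the list. -/
theorem listsEigenvalues_iff :
    ListsEigenvalues A z ↔ ∀ x, (scalar _ x - A).det = ∏ i, (x - z i) := by
  simp_rw [← Matrix.eval_charpoly]
  constructor
  · intro h x
    rw [h.charpoly_eq, Polynomial.eval_prod]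
    simp
  · intro h
    have : A.charpoly = ∏ i, (Polynomial.X - Polynomial.C (z i)) := by
      apply Polynomial.funext
      intro x
      rw [h, Polynomial.eval_prod]
      simp
    have h2 := Polynomial.roots_multiset_prod_X_sub_C (Finset.univ.val.map z)
    rw [Multiset.map_map] at h2
    rw [ListsEigenvalues, this]
    exact h2.symm

theorem ListsEigenvalues.isRoot (h : ListsEigenvalues A z) (i : Fin (2 * L)) :
    A.charpoly.IsRoot (z i) := by
  have : z i ∈ A.charpoly.roots := by
    rw [← h]; exact Multiset.mem_map_of_mem _ (Finset.mem_univ i)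
  exact Polynomial.isRoot_of_mem_roots this

theorem ListsEigenvalues.mem_roots_iff (h : ListsEigenvalues A z) (μ : ℂ) :
    μ ∈ A.charpoly.roots ↔ ∃ i, z i = μ := by
  rw [← h]; simp

theorem ListsEigenvalues.exists_perm (h : ListsEigenvalues A z) (h' : ListsEigenvalues A w) :
    ∃ σ : Equiv.Perm (Fin (2 * L)), w = z ∘ σ :=
  exists_perm_of_map_eq (h.trans h'.symm)

theorem ListsEigenvalues.injective (h : ListsEigenvalues A z)
    (hA : ∀ μ, A.charpoly.rootMultiplicity μ < 2) : Function.Injective z := by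
  have hnd : A.charpoly.roots.Nodup := by
    rw [Multiset.nodup_iff_count_le_one]
    intro μ
    rw [Polynomial.count_roots]
    have := hA μ
    omega
  rw [← h] at hnd
  intro i j hij
  exact Multiset.inj_on_of_nodup_map hnd i (Finset.mem_univ_val i) j (Finset.mem_univ_val j) hij

theorem listsEigenvalues_of_injective (hinj : Function.Injective z)
    (hz : ∀ i, A.charpoly.IsRoot (z i)) : ListsEigenvalues A z := by
  apply Multiset.eq_of_le_of_card_le
  · rw [Multiset.le_iff_subset (Multiset.Nodup.map hinj Finset.univ.nodup)]
    intro μ hμ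
    obtain ⟨i, -, rfl⟩ := Multiset.mem_map.1 hμ
    exact (Polynomial.mem_roots A.charpoly_monic.ne_zero).2 (hz i)
  · rw [IsAlgClosed.card_roots_eq_natDegree, Matrix.charpoly_natDegree_eq_dim]
    simp [two_mul]

/-- The moduli of an ordered listing do not depend on how ties are broken. -/
theorem IsOrderedListing.norm_eq (h : IsOrderedListing A z) (h' : IsOrderedListing A w) :
    (fun i => ‖z i‖) = fun i => ‖w i‖ := by
  obtain ⟨σ, rfl⟩ := h.1.exists_perm h'.1
  exact Tuple.unique_monotone (f := fun i => ‖z i‖) (σ := Equiv.refl _) (τ := σ) h.2 h'.2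

theorem norm_le_sum_of_isRoot {n : Type*} [Fintype n] [DecidableEq n] {A : Matrix n n ℂ} {μ : ℂ}
    (h : A.charpoly.IsRoot μ) : ‖μ‖ ≤ ∑ i, ∑ j, ‖A i j‖ := by
  have : Module.End.HasEigenvalue (Matrix.toLin' A) μ := by
    rw [Module.End.hasEigenvalue_iff_isRoot_charpoly, Matrix.charpoly_toLin']
    exact h
  obtain ⟨v, hv⟩ := this.exists_hasEigenvector
  have hv' := hv.apply_eq_smul
  rw [Matrix.toLin'_apply] at hv'
  have hpos : 0 < ‖v‖ := norm_pos_iff.2 hv.2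
  have hB : 0 ≤ ∑ i, ∑ j, ‖A i j‖ := by positivity
  have : ‖μ • v‖ ≤ (∑ i, ∑ j, ‖A i j‖) * ‖v‖ := by
    rw [pi_norm_le_iff_of_nonneg (by positivity)]
    intro i
    rw [← hv', Matrix.mulVec, dotProduct]
    calc ‖∑ j, A i j * v j‖ ≤ ∑ j, ‖A i j‖ * ‖v‖ := by
          refine norm_sum_le_of_le _ fun j _ => ?_
          rw [norm_mul]
          gcongr
          exact norm_le_pi_norm v j
      _ = (∑ j, ‖A i j‖) * ‖v‖ := by rw [Finset.sum_mul]
      _ ≤ _ := by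
          refine mul_le_mul_of_nonneg_right ?_ hpos.le
          exact Finset.single_le_sum (f := fun i => ∑ j, ‖A i j‖) (fun _ _ => by positivity)
            (Finset.mem_univ i)
  rw [norm_smul] at this
  exact le_of_mul_le_mul_right this hpos

/-- Eigenvalues depend continuously on the matrix, in the form of a compactness statement: along an
ultrafilter ordered listings converge, and the limit is an ordered listing of the limit matrix. -/
theorem exists_tendsto_isOrderedListing {α : Type*} (l : Ultrafilter α)
    {B : α → Matrix (Fin L ⊕ Fin L) (Fin L ⊕ Fin L) ℂ} (hB : Tendsto B l (𝓝 A))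
    {y : α → Fin (2 * L) → ℂ} (hy : ∀ᶠ a in (l : Filter α), IsOrderedListing (B a) (y a)) :
    ∃ y₀, IsOrderedListing A y₀ ∧ Tendsto y l (𝓝 y₀) := by
  have hcont : Continuous fun M : Matrix (Fin L ⊕ Fin L) (Fin L ⊕ Fin L) ℂ =>
      ∑ i, ∑ j, ‖M i j‖ := by fun_prop
  set b := ∑ i, ∑ j, ‖A i j‖
  have hbound : ∀ᶠ a in (l : Filter α), ∑ i, ∑ j, ‖B a i j‖ < b + 1 :=
    ((hcont.tendsto A).comp hB).eventually_lt_const (by simp [b])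
  have hK : (l.map y : Filter (Fin (2 * L) → ℂ)) ≤ 𝓟 (Metric.closedBall 0 (b + 1)) := by
    rw [le_principal_iff]
    change ∀ᶠ a in (l : Filter α), y a ∈ _
    filter_upwards [hbound, hy] with a ha hya
    have hb0 : 0 ≤ ∑ i, ∑ j, ‖B a i j‖ := by positivity
    rw [mem_closedBall_zero_iff, pi_norm_le_iff_of_nonneg (by linarith)]
    intro i
    exact (norm_le_sum_of_isRoot (hya.1.isRoot i)).trans ha.le
  obtain ⟨y₀, -, hy₀⟩ := (isCompact_closedBall (0 : Fin (2 * L) → ℂ) (b + 1)).ultrafilter_le_nhds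
    (l.map y) hK
  have ht : Tendsto y l (𝓝 y₀) := hy₀
  have hti : ∀ i, Tendsto (fun a => y a i) l (𝓝 (y₀ i)) := fun i => tendsto_pi_nhds.1 ht i
  refine ⟨y₀, ⟨?_, ?_⟩, ht⟩
  · rw [listsEigenvalues_iff]
    intro x
    have h1 : Tendsto (fun a => (scalar (Fin L ⊕ Fin L) x - B a).det) l
        (𝓝 (scalar (Fin L ⊕ Fin L) x - A).det) := by
      have : Continuous fun M : Matrix (Fin L ⊕ Fin L) (Fin L ⊕ Fin L) ℂ =>
        (scalar (Fin L ⊕ Fin L) x - M).det := by fun_prop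
      exact (this.tendsto A).comp hB
    have h2 : Tendsto (fun a => ∏ i, (x - y a i)) l (𝓝 (∏ i, (x - y₀ i))) :=
      tendsto_finsetProd _ fun i _ => (tendsto_const_nhds (x := x)).sub (hti i)
    refine tendsto_nhds_unique_of_eventuallyEq h1 h2 ?_
    filter_upwards [hy] with a ha
    exact listsEigenvalues_iff.1 ha.1 x
  · intro i j hij
    refine le_of_tendsto_of_tendsto (hti i).norm (hti j).norm ?_
    filter_upwards [hy] with a ha
    exact ha.2 hij

/-- An ordered listing need not be continuous, but a quantity converges if it is continuous at all
ordered listings of the limit matrix, with the same value. -/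
theorem tendsto_of_forall_isOrderedListing {α X : Type*} [TopologicalSpace X] {l : Filter α}
    {B : α → Matrix (Fin L ⊕ Fin L) (Fin L ⊕ Fin L) ℂ} (hB : Tendsto B l (𝓝 A))
    {y : α → Fin (2 * L) → ℂ} (hy : ∀ᶠ a in l, IsOrderedListing (B a) (y a))
    {G : (Fin (2 * L) → ℂ) → X} {c : X}
    (hG : ∀ y₀, IsOrderedListing A y₀ → Tendsto G (𝓝 y₀) (𝓝 c)) :
    Tendsto (fun a => G (y a)) l (𝓝 c) := by
  rw [tendsto_iff_ultrafilter]
  intro g hg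
  obtain ⟨y₀, h1, h2⟩ := exists_tendsto_isOrderedListing g (hB.mono_left hg) (hy.filter_mono hg)
  exact (hG y₀ h1).comp h2

theorem tendsto_norm_of_isOrderedListing {α : Type*} {l : Filter α}
    {B : α → Matrix (Fin L ⊕ Fin L) (Fin L ⊕ Fin L) ℂ} (hB : Tendsto B l (𝓝 A))
    {y : α → Fin (2 * L) → ℂ} (hy : ∀ᶠ a in l, IsOrderedListing (B a) (y a))
    (hz : IsOrderedListing A z) (i : Fin (2 * L)) :
    Tendsto (fun a => ‖y a i‖) l (𝓝 ‖z i‖) := by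
  refine tendsto_of_forall_isOrderedListing (G := fun y => ‖y i‖) hB hy ?_
  intro y₀ hy₀
  rw [← congrFun (hy₀.norm_eq hz) i]
  exact Continuous.tendsto (by fun_prop) _

theorem eventually_exists_isOrderedListing_near {α : Type*} {l : Filter α}
    {B : α → Matrix (Fin L ⊕ Fin L) (Fin L ⊕ Fin L) ℂ} (hB : Tendsto B l (𝓝 A))
    {y : α → Fin (2 * L) → ℂ} (hy : ∀ᶠ a in l, IsOrderedListing (B a) (y a))
    {ε : ℝ} (hε : 0 < ε) :
    ∀ᶠ a in l, ∃ y₀, IsOrderedListing A y₀ ∧ ∀ i, dist (y a i) (y₀ i) < ε := by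
  by_contra hcon
  rw [not_eventually] at hcon
  have : (l ⊓ 𝓟 {a | ¬∃ y₀, IsOrderedListing A y₀ ∧ ∀ i, dist (y a i) (y₀ i) < ε}).NeBot :=
    frequently_mem_iff_neBot.1 hcon
  set g := Ultrafilter.of (l ⊓ 𝓟 {a | ¬∃ y₀, IsOrderedListing A y₀ ∧ ∀ i, dist (y a i) (y₀ i) < ε})
  have hg := Ultrafilter.of_le
    (l ⊓ 𝓟 {a | ¬∃ y₀, IsOrderedListing A y₀ ∧ ∀ i, dist (y a i) (y₀ i) < ε})
  have hgl : (g : Filter α) ≤ l := hg.trans inf_le_left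
  have hgb : ∀ᶠ a in (g : Filter α), ¬∃ y₀, IsOrderedListing A y₀ ∧ ∀ i, dist (y a i) (y₀ i) < ε :=
    le_principal_iff.1 (hg.trans inf_le_right)
  obtain ⟨y₀, h1, h2⟩ := exists_tendsto_isOrderedListing g (hB.mono_left hgl) (hy.filter_mono hgl)
  have h3 : ∀ᶠ a in (g : Filter α), dist (y a) y₀ < ε := h2.eventually (Metric.ball_mem_nhds _ hε)
  obtain ⟨a, ha, hb⟩ := (hgb.and h3).exists
  exact ha ⟨y₀, h1, fun i => (dist_le_pi_dist _ _ i).trans_lt hb⟩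

/-- The circle of radius `r` separates the values `z i`, `i ∈ I`, from the others. -/
def Separates {ι : Type*} (r : ℝ) (I : Finset ι) (z : ι → ℂ) : Prop :=
  ∀ i, (i ∈ I → ‖z i‖ < r) ∧ (i ∉ I → r < ‖z i‖)

theorem Separates.norm_lt_iff {ι : Type*} {r : ℝ} {I : Finset ι} {z : ι → ℂ}
    (h : Separates r I z) (i : ι) : ‖z i‖ < r ↔ i ∈ I := by
  constructor
  · intro h1
    by_contra h2
    exact absurd ((h i).2 h2) (not_lt.2 h1.le)
  · exact (h i).1

theorem ListsEigenvalues.exists_perm_of_separates {r : ℝ} {I J : Finset (Fin (2 * L))}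
    (hz : ListsEigenvalues A z) (hw : ListsEigenvalues A w) (hzr : Separates r I z)
    (hwr : Separates r J w) :
    ∃ σ : Equiv.Perm (Fin (2 * L)), w = z ∘ σ ∧ ∀ i, σ i ∈ I ↔ i ∈ J := by
  obtain ⟨σ, hσ⟩ := hz.exists_perm hw
  refine ⟨σ, hσ, fun i => ?_⟩
  rw [← hzr.norm_lt_iff, ← hwr.norm_lt_iff, hσ]
  rfl

theorem ListsEigenvalues.image_eq_of_separates {r : ℝ} {I J : Finset (Fin (2 * L))}
    (hz : ListsEigenvalues A z) (hw : ListsEigenvalues A w) (hzr : Separates r I z)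
    (hwr : Separates r J w) : I.image z = J.image w := by
  obtain ⟨σ, rfl, hσ⟩ := hz.exists_perm_of_separates hw hzr hwr
  ext μ
  simp only [Finset.mem_image, Function.comp]
  constructor
  · rintro ⟨i, hi, rfl⟩
    exact ⟨σ.symm i, (hσ _).1 (by simpa using hi), by simp⟩
  · rintro ⟨i, hi, rfl⟩
    exact ⟨σ i, (hσ i).2 hi, rfl⟩

end Listing

/-! ### Riesz projections -/

theorem conj_apply {n ι : Type*} [Fintype ι] [DecidableEq ι] (U : Matrix n ι ℂ)
    (W : Matrix ι n ℂ) (t : ι → ℂ) (i j : n) :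
    (U * diagonal t * W) i j = ∑ k, U i k * W k j * t k := by
  rw [Matrix.mul_apply]
  refine Finset.sum_congr rfl fun k _ => ?_
  rw [Matrix.mul_diagonal]
  ring

section Resolvent

variable {n ι : Type*} [Fintype n] [DecidableEq n] [Fintype ι] [DecidableEq ι]
  {A : Matrix n n ℂ} {z : ι → ℂ} {U : Matrix n ι ℂ} {W : Matrix ι n ℂ}

theorem IsEigenbasis.smul_one_sub (h : IsEigenbasis A z U W) (w : ℂ) :
    w • (1 : Matrix n n ℂ) - A = U * diagonal (fun k => w - z k) * W := by
  have : diagonal (fun k => w - z k) = w • (1 : Matrix ι ι ℂ) - diagonal z := by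
    rw [smul_one_eq_diagonal, diagonal_sub]
  rw [this, Matrix.mul_sub, Matrix.sub_mul, Matrix.mul_smul, Matrix.mul_one, Matrix.smul_mul,
    h.mul_eq_one, ← h.eq]

theorem IsEigenbasis.resolvent (h : IsEigenbasis A z U W) {w : ℂ} (hw : ∀ k, w ≠ z k) :
    (w • (1 : Matrix n n ℂ) - A)⁻¹ = U * diagonal (fun k => (w - z k)⁻¹) * W := by
  apply Matrix.inv_eq_right_inv
  rw [h.smul_one_sub, h.conj_mul_conj]
  have : (fun k => (w - z k) * (w - z k)⁻¹) = fun _ => 1 := by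
    ext k
    exact mul_inv_cancel₀ (sub_ne_zero.2 (hw k))
  rw [this, diagonal_one, Matrix.mul_one, h.mul_eq_one]

theorem circleIntegral_inv_sub {c a : ℂ} {s : ℝ} (hs : 0 < s) (ha : dist a c ≠ s) :
    (2 * Real.pi * Complex.I)⁻¹ * (∮ w in C(c, s), (w - a)⁻¹) =
      if dist a c < s then 1 else 0 := by
  split_ifs with h
  · rw [circleIntegral.integral_sub_inv_of_mem_ball h]
    exact inv_mul_cancel₀ Complex.two_pi_I_ne_zero
  · have hlt : s < dist a c := lt_of_le_of_ne (not_lt.1 h) (Ne.symm ha)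
    have hd : DifferentiableOn ℂ (fun w => (w - a)⁻¹) (Metric.closedBall c s) := by
      intro w hw
      have : w ≠ a := by
        rintro rfl
        exact absurd (Metric.mem_closedBall.1 hw) (not_le.2 hlt)
      exact ((differentiableAt_id.sub_const a).inv (sub_ne_zero.2 this)).differentiableWithinAt
    rw [(hd.diffContOnCl_ball subset_rfl).circleIntegral_eq_zero hs.le, mul_zero]

/-- The resolvent integral over a circle is the spectral projection onto the eigenvalues inside. -/
theorem IsEigenbasis.circleIntegral_resolvent (h : IsEigenbasis A z U W) {c : ℂ} {s : ℝ}
    (hs : 0 < s) (hz : ∀ k, dist (z k) c ≠ s) (i j : n) :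
    (2 * Real.pi * Complex.I)⁻¹ * (∮ w in C(c, s), (w • (1 : Matrix n n ℂ) - A)⁻¹ i j) =
      (U * diagonal (fun k => if dist (z k) c < s then (1 : ℂ) else 0) * W) i j := by
  have hw : ∀ w ∈ Metric.sphere c s, ∀ k, w ≠ z k := by
    rintro w hw k rfl
    exact hz k hw
  have h1 : (∮ w in C(c, s), (w • (1 : Matrix n n ℂ) - A)⁻¹ i j) =
      ∮ w in C(c, s), ∑ k, U i k * W k j * (w - z k)⁻¹ := by
    refine circleIntegral.integral_congr hs.le fun w hws => ?_
    rw [h.resolvent (hw w hws), conj_apply]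
  have h2 : ∀ k ∈ (Finset.univ : Finset ι),
      CircleIntegrable (fun w => U i k * W k j * (w - z k)⁻¹) c s := by
    intro k _
    apply ContinuousOn.circleIntegrable hs.le
    intro w hws
    have : w - z k ≠ 0 := sub_ne_zero.2 (hw w hws k)
    exact (continuousAt_const.mul
      ((continuousAt_id.sub continuousAt_const).inv₀ this)).continuousWithinAt
  rw [h1, circleIntegral.integral_fun_sum h2, conj_apply, Finset.mul_sum]
  refine Finset.sum_congr rfl fun k _ => ?_
  rw [circleIntegral.integral_const_mul, ← circleIntegral_inv_sub hs (hz k)]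
  ring

theorem continuousAt_resolvent_apply (i j : n) {A : Matrix n n ℂ} {w : ℂ}
    (hw : (w • (1 : Matrix n n ℂ) - A).det ≠ 0) :
    ContinuousAt (fun p : Matrix n n ℂ × ℂ => (p.2 • (1 : Matrix n n ℂ) - p.1)⁻¹ i j) (A, w) := by
  have : ∀ p : Matrix n n ℂ × ℂ, (p.2 • (1 : Matrix n n ℂ) - p.1)⁻¹ i j =
      ((p.2 • (1 : Matrix n n ℂ) - p.1).det)⁻¹ * (p.2 • (1 : Matrix n n ℂ) - p.1).adjugate i j := by
    intro p
    rw [Matrix.inv_def, Ring.inverse_eq_inv', Matrix.smul_apply, smul_eq_mul]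
  simp_rw [this]
  have h1 : Continuous fun p : Matrix n n ℂ × ℂ => p.2 • (1 : Matrix n n ℂ) - p.1 := by fun_prop
  have h2 : Continuous fun p : Matrix n n ℂ × ℂ =>
      (p.2 • (1 : Matrix n n ℂ) - p.1).adjugate i j := (h1.matrix_adjugate).matrix_elem i j
  exact (h1.matrix_det.continuousAt.inv₀ hw).mul h2.continuousAt

theorem continuousAt_circleIntegral_resolvent (i j : n) {A : Matrix n n ℂ} {c : ℂ} {s : ℝ}
    (hs : 0 ≤ s) (hA : ∀ w ∈ Metric.sphere c s, (w • (1 : Matrix n n ℂ) - A).det ≠ 0) :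
    ContinuousAt (fun B : Matrix n n ℂ => ∮ w in C(c, s), (w • (1 : Matrix n n ℂ) - B)⁻¹ i j)
      A := by
  have hdet : Continuous fun p : Matrix n n ℂ × ℂ =>
      (p.2 • (1 : Matrix n n ℂ) - p.1).det := by fun_prop
  have hint : ∀ B : Matrix n n ℂ, (∀ w ∈ Metric.sphere c s, (w • (1 : Matrix n n ℂ) - B).det ≠ 0) →
      CircleIntegrable (fun w => (w • (1 : Matrix n n ℂ) - B)⁻¹ i j) c s := by
    intro B hB
    apply ContinuousOn.circleIntegrable hs
    intro w hw
    have h1 := continuousAt_resolvent_apply i j (hB w hw)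
    have h2 : ContinuousAt (fun w : ℂ => (B, w)) w := by fun_prop
    exact (ContinuousAt.comp (f := fun w : ℂ => (B, w)) h1 h2).continuousWithinAt
  have hev : ∀ᶠ B in 𝓝 A, ∀ w ∈ Metric.sphere c s, (w • (1 : Matrix n n ℂ) - B).det ≠ 0 := by
    apply (isCompact_sphere c s).eventually_forall_of_forall_eventually
    intro w hw
    exact hdet.continuousAt.eventually_ne (hA w hw)
  rw [ContinuousAt, Metric.tendsto_nhds]
  intro ε hε
  obtain ⟨δ, hδ, hδε⟩ : ∃ δ > 0, 2 * Real.pi * s * δ < ε := by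
    refine ⟨ε / (2 * Real.pi * s + 1), by positivity, ?_⟩
    rw [mul_div_assoc', div_lt_iff₀ (by positivity)]
    nlinarith [Real.pi_pos]
  have hclose : ∀ᶠ B in 𝓝 A, ∀ w ∈ Metric.sphere c s,
      ‖(w • (1 : Matrix n n ℂ) - B)⁻¹ i j - (w • (1 : Matrix n n ℂ) - A)⁻¹ i j‖ < δ := by
    apply (isCompact_sphere c s).eventually_forall_of_forall_eventually
    intro w hw
    have h1 := continuousAt_resolvent_apply i j (hA w hw)
    have h2 : ContinuousAt (fun p : Matrix n n ℂ × ℂ => (A, p.2)) (A, w) := by fun_prop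
    have h3 := ContinuousAt.comp (f := fun p : Matrix n n ℂ × ℂ => (A, p.2)) (x := (A, w)) h1 h2
    have h4 := (h1.sub h3).norm
    simp only [ContinuousAt, Pi.sub_apply, Function.comp, sub_self, norm_zero] at h4
    exact h4.eventually_lt_const hδ
  filter_upwards [hev, hclose] with B hB1 hB2
  rw [dist_eq_norm, ← circleIntegral.integral_sub (hint B hB1) (hint A hA)]
  refine (circleIntegral.norm_integral_le_of_norm_le_const hs fun w hw => ?_).trans_lt hδε
  exact (hB2 w hw).le

theorem IsEigenbasis.adjugate_eq (h : IsEigenbasis A z U W) (w : ℂ) :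
    (w • (1 : Matrix n n ℂ) - A).adjugate =
      U * diagonal (fun k => ∏ l ∈ Finset.univ.erase k, (w - z l)) * W := by
  have hc1 : Continuous fun w : ℂ => (w • (1 : Matrix n n ℂ) - A).adjugate :=
    Continuous.matrix_adjugate (by fun_prop)
  have hc2 : Continuous fun w : ℂ =>
      U * diagonal (fun k => ∏ l ∈ Finset.univ.erase k, (w - z l)) * W := by
    refine (continuous_const.matrix_mul (Continuous.matrix_diagonal ?_)).matrix_mul continuous_const
    refine continuous_pi fun k => continuous_finsetProd _ fun l _ => by fun_prop
  -- Off the spectrum the adjugate is `det` times the resolvent; both sides are continuous in `w`.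
  have hd : Dense (Set.range z)ᶜ := (Set.finite_range z).countable.dense_compl ℂ
  refine congrFun (Continuous.ext_on hd hc1 hc2 ?_) w
  intro w hw
  have hw' : ∀ k, w ≠ z k := fun k hk => hw ⟨k, hk.symm⟩
  have hdet : (w • (1 : Matrix n n ℂ) - A).det = ∏ k, (w - z k) := by
    rw [h.smul_one_sub, Matrix.det_conj_of_mul_eq_one h.mul_eq_one h.mul_eq_one', det_diagonal]
  have hne : (w • (1 : Matrix n n ℂ) - A).det ≠ 0 := by
    rw [hdet]
    exact Finset.prod_ne_zero_iff.2 fun k _ => sub_ne_zero.2 (hw' k)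
  have hinv := h.resolvent hw'
  rw [Matrix.inv_def, Ring.inverse_eq_inv'] at hinv
  have h1 : (w • (1 : Matrix n n ℂ) - A).adjugate = (w • (1 : Matrix n n ℂ) - A).det •
      (U * diagonal (fun k => (w - z k)⁻¹) * W) := by
    rw [← hinv, smul_smul, mul_inv_cancel₀ hne, one_smul]
  simp only
  rw [h1, hdet, ← Matrix.smul_mul, ← Matrix.mul_smul, ← diagonal_smul]
  congr 3
  ext k
  rw [Pi.smul_apply, smul_eq_mul, ← Finset.mul_prod_erase _ _ (Finset.mem_univ k)]
  have := sub_ne_zero.2 (hw' k)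
  field_simp

/-- The spectral projection onto simple eigenvalues, as a rational function of the matrix entries
and the eigenvalues. -/
theorem IsEigenbasis.conj_ind_eq (h : IsEigenbasis A z U W) (hinj : Function.Injective z)
    (I : Finset ι) :
    U * diagonal (ind I) * W = ∑ i ∈ I, (∏ l ∈ Finset.univ.erase i, (z i - z l))⁻¹ •
      (z i • (1 : Matrix n n ℂ) - A).adjugate := by
  have hterm : ∀ i, (∏ l ∈ Finset.univ.erase i, (z i - z l))⁻¹ •
      (z i • (1 : Matrix n n ℂ) - A).adjugate = U * diagonal (ind {i}) * W := by
    intro i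
    rw [h.adjugate_eq, ← Matrix.smul_mul, ← Matrix.mul_smul, ← diagonal_smul]
    congr 3
    ext k
    rw [Pi.smul_apply, smul_eq_mul]
    by_cases hk : k = i
    · subst hk
      rw [inv_mul_cancel₀]
      · simp [ind]
      · exact Finset.prod_ne_zero_iff.2 fun l hl =>
          sub_ne_zero.2 fun he => (Finset.ne_of_mem_erase hl) (hinj he).symm
    · rw [Finset.prod_eq_zero (Finset.mem_erase.2 ⟨Ne.symm hk, Finset.mem_univ i⟩) (sub_self _)]
      simp [ind, hk]
  simp_rw [hterm]
  ext a b
  rw [Matrix.sum_apply]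
  simp_rw [conj_apply]
  rw [Finset.sum_comm]
  refine Finset.sum_congr rfl fun k _ => ?_
  rw [← Finset.mul_sum]
  congr 1
  simp [ind]

end Resolvent

section SepRadius

variable {n : Type*} [Fintype n] [DecidableEq n] (A : Matrix n n ℂ)

theorem sepRadius_pos : 0 < sepRadius A := by
  rw [sepRadius]
  refine half_pos ((Finset.lt_min'_iff _ _).2 fun y hy => ?_)
  rcases Finset.mem_insert.1 hy with rfl | hy
  · exact one_pos
  · obtain ⟨p, hp, rfl⟩ := Finset.mem_image.1 hy
    exact dist_pos.2 (Finset.mem_offDiag.1 hp).2.2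

theorem two_mul_sepRadius_le {μ ν : ℂ} (hμ : μ ∈ A.charpoly.roots) (hν : ν ∈ A.charpoly.roots)
    (hne : μ ≠ ν) : 2 * sepRadius A ≤ dist μ ν := by
  have : 2 * sepRadius A = (insert (1 : ℝ)
      (A.charpoly.roots.toFinset.offDiag.image fun p => dist p.1 p.2)).min'
        ⟨1, Finset.mem_insert_self _ _⟩ := by
    rw [sepRadius]; ring
  rw [this]
  apply Finset.min'_le
  apply Finset.mem_insert_of_mem
  exact Finset.mem_image.2 ⟨(μ, ν), Finset.mem_offDiag.2
    ⟨Multiset.mem_toFinset.2 hμ, Multiset.mem_toFinset.2 hν, hne⟩, rfl⟩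

end SepRadius

section Riesz

variable {L : ℕ} {A B : Matrix (Fin L ⊕ Fin L) (Fin L ⊕ Fin L) ℂ} {y z : Fin (2 * L) → ℂ}
  {U : Matrix (Fin L ⊕ Fin L) (Fin (2 * L)) ℂ} {W : Matrix (Fin (2 * L)) (Fin L ⊕ Fin L) ℂ}

/-- The contour integral that defines the Riesz projection of `A`, applied to the resolvent of
another matrix `B`. -/
noncomputable def contourProjection (A : Matrix (Fin L ⊕ Fin L) (Fin L ⊕ Fin L) ℂ) (S : Finset ℂ)
    (B : Matrix (Fin L ⊕ Fin L) (Fin L ⊕ Fin L) ℂ) : Matrix (Fin L ⊕ Fin L) (Fin L ⊕ Fin L) ℂ :=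
  Matrix.of fun i j => ∑ μ ∈ A.charpoly.roots.toFinset ∩ S,
    (2 * Real.pi * Complex.I)⁻¹ *
      ∮ w in C(μ, sepRadius A), (w • (1 : Matrix (Fin L ⊕ Fin L) (Fin L ⊕ Fin L) ℂ) - B)⁻¹ i j

/-- If the eigenvalues of `B` are near those of `A`, the contours for `A` enclose the corresponding
eigenvalues of `B`. -/
theorem contourProjection_eq (hy : ListsEigenvalues A y) (hB : IsEigenbasis B z U W)
    (hclose : ∀ k, dist (z k) (y k) < sepRadius A) (S : Finset ℂ) :
    contourProjection A S B = U * diagonal (fun k => if y k ∈ S then (1 : ℂ) else 0) * W := by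
  have hroot : ∀ k, y k ∈ A.charpoly.roots := fun k => (hy.mem_roots_iff _).2 ⟨k, rfl⟩
  have hfar : ∀ μ ∈ A.charpoly.roots, ∀ k, y k ≠ μ → sepRadius A < dist (z k) μ := by
    intro μ hμ k hk
    have h1 := two_mul_sepRadius_le A (hroot k) hμ hk
    have h2 := dist_triangle (y k) (z k) μ
    have h3 := hclose k
    rw [dist_comm] at h3
    linarith
  have hiff : ∀ μ ∈ A.charpoly.roots, ∀ k, dist (z k) μ < sepRadius A ↔ y k = μ := by
    intro μ hμ k
    constructor
    · intro h
      by_contra hk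
      exact absurd h (not_lt.2 (hfar μ hμ k hk).le)
    · rintro rfl
      exact hclose k
  ext i j
  rw [contourProjection, Matrix.of_apply, conj_apply]
  have hterm : ∀ μ ∈ A.charpoly.roots.toFinset ∩ S, (2 * Real.pi * Complex.I)⁻¹ *
      (∮ w in C(μ, sepRadius A),
        (w • (1 : Matrix (Fin L ⊕ Fin L) (Fin L ⊕ Fin L) ℂ) - B)⁻¹ i j) =
      ∑ k, U i k * W k j * if y k = μ then 1 else 0 := by
    intro μ hμ
    have hμ' : μ ∈ A.charpoly.roots := Multiset.mem_toFinset.1 (Finset.mem_inter.1 hμ).1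
    rw [hB.circleIntegral_resolvent (sepRadius_pos A), conj_apply]
    · simp_rw [hiff μ hμ']
    · intro k
      by_cases hk : y k = μ
      · exact ((hiff μ hμ' k).2 hk).ne
      · exact (hfar μ hμ' k hk).ne'
  rw [Finset.sum_congr rfl hterm, Finset.sum_comm]
  refine Finset.sum_congr rfl fun k _ => ?_
  rw [← Finset.mul_sum]
  congr 1
  simp [hroot k]

theorem continuousAt_contourProjection (A : Matrix (Fin L ⊕ Fin L) (Fin L ⊕ Fin L) ℂ)
    (S : Finset ℂ) : ContinuousAt (contourProjection A S) A := by
  refine continuousAt_pi.2 fun i => continuousAt_pi.2 fun j => ?_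
  simp only [contourProjection, Matrix.of_apply]
  refine tendsto_finsetSum _ fun μ hμ => ?_
  refine continuousAt_const.mul (continuousAt_circleIntegral_resolvent i j (sepRadius_pos A).le ?_)
  intro w hw h0
  have hμ' : μ ∈ A.charpoly.roots := Multiset.mem_toFinset.1 (Finset.mem_inter.1 hμ).1
  have hw' : w ∈ A.charpoly.roots := by
    rw [Polynomial.mem_roots A.charpoly_monic.ne_zero, Polynomial.IsRoot.def,
      Matrix.eval_charpoly, ← h0, Matrix.scalar_apply, smul_one_eq_diagonal]
  rw [Metric.mem_sphere] at hw
  have h1 := sepRadius_pos A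
  by_cases hne : w = μ
  · rw [hne, dist_self] at hw; linarith
  · have := two_mul_sepRadius_le A hw' hμ' hne
    linarith

theorem rieszProjection_image_eq (h : IsEigenbasis A z U W) (hz : ListsEigenvalues A z)
    (hinj : Function.Injective z) (I : Finset (Fin (2 * L))) :
    rieszProjection A (I.image z) = U * diagonal (ind I) * W := by
  have h1 := contourProjection_eq hz h (fun k => by rw [dist_self]; exact sepRadius_pos A)
    (I.image z)
  have h2 : (fun k => if z k ∈ I.image z then (1 : ℂ) else 0) = ind I := by
    ext k
    simp [ind, hinj.eq_iff]
  rw [h2] at h1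
  exact h1

end Riesz

/-! ### Analytic dependence on the energy -/

section Analytic

theorem analyticAt_det {m : Type*} [Fintype m] [DecidableEq m] {M : ℂ → Matrix m m ℂ} {E₀ : ℂ}
    (h : ∀ i j, AnalyticAt ℂ (fun E => M E i j) E₀) : AnalyticAt ℂ (fun E => (M E).det) E₀ := by
  simp_rw [det_apply']
  exact Finset.analyticAt_fun_sum _ fun σ _ => analyticAt_const.mul
    (Finset.analyticAt_fun_prod _ fun i _ => h _ _)

theorem analyticAt_adjugate {m : Type*} [Fintype m] [DecidableEq m] {M : ℂ → Matrix m m ℂ} {E₀ : ℂ}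
    (h : ∀ i j, AnalyticAt ℂ (fun E => M E i j) E₀) (i j : m) :
    AnalyticAt ℂ (fun E => (M E).adjugate i j) E₀ := by
  simp_rw [adjugate_apply]
  refine analyticAt_det fun a b => ?_
  simp_rw [updateRow_apply]
  split_ifs
  · exact analyticAt_const
  · exact h a b

variable {L : ℕ} (R V T : Matrix (Fin L) (Fin L) ℂ)

theorem transfer_eq_add_smul (E : ℂ) :
    transfer R V T E = fromBlocks (-V * T⁻¹) (-R) T⁻¹ 0 + E • fromBlocks T⁻¹ 0 0 0 := by
  rw [transfer, fromBlocks_smul, fromBlocks_add]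
  simp only [smul_zero, add_zero, Matrix.sub_mul, Matrix.smul_mul, Matrix.one_mul, Matrix.neg_mul]
  congr 1
  abel

theorem transfer_apply_eq (E : ℂ) (i j : Fin L ⊕ Fin L) : transfer R V T E i j =
    fromBlocks (-V * T⁻¹) (-R) T⁻¹ 0 i j + E * fromBlocks T⁻¹ 0 0 0 i j := by
  rw [transfer_eq_add_smul]
  rfl

theorem continuous_transfer : Continuous (transfer R V T) := by
  have : transfer R V T =
      fun E => fromBlocks (-V * T⁻¹) (-R) T⁻¹ 0 + E • fromBlocks T⁻¹ 0 0 0 :=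
    funext (transfer_eq_add_smul R V T)
  rw [this]
  fun_prop

theorem analyticAt_transfer_apply (i j : Fin L ⊕ Fin L) (E₀ : ℂ) :
    AnalyticAt ℂ (fun E => transfer R V T E i j) E₀ := by
  simp_rw [transfer_apply_eq]
  fun_prop

open scoped ContDiff in
theorem contDiff_det_sub_transfer :
    ContDiff ℂ ω fun p : ℂ × ℂ => (scalar (Fin L ⊕ Fin L) p.2 - transfer R V T p.1).det := by
  simp_rw [det_apply']
  refine ContDiff.sum fun σ _ => contDiff_const.mul (contDiff_prod fun i _ => ?_)
  simp_rw [Matrix.sub_apply, transfer_apply_eq, scalar_apply, diagonal_apply]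
  split_ifs <;> fun_prop

open scoped ContDiff in
/-- A simple eigenvalue of the transfer matrix extends to an analytic function of the energy. -/
theorem exists_analytic_root {E₀ μ : ℂ} (hμ : (transfer R V T E₀).charpoly.IsRoot μ)
    (hs : (transfer R V T E₀).charpoly.rootMultiplicity μ < 2) :
    ∃ f : ℂ → ℂ, AnalyticAt ℂ f E₀ ∧ f E₀ = μ ∧
      ∀ᶠ E in 𝓝 E₀, (transfer R V T E).charpoly.IsRoot (f E) := by
  set F : ℂ × ℂ → ℂ := fun p => (scalar (Fin L ⊕ Fin L) p.2 - transfer R V T p.1).det with hF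
  have hFe : ∀ E x, F (E, x) = (transfer R V T E).charpoly.eval x := fun E x =>
    (Matrix.eval_charpoly _ _).symm
  have hcd : ContDiffAt ℂ ω F (E₀, μ) := (contDiff_det_sub_transfer R V T).contDiffAt
  -- The implicit function theorem applies, as the derivative at a simple root does not vanish.
  set c := (transfer R V T E₀).charpoly.derivative.eval μ with hc
  have hc0 : c ≠ 0 := by
    intro h0
    have := (Polynomial.one_lt_rootMultiplicity_iff_isRoot
      (transfer R V T E₀).charpoly_monic.ne_zero).2 ⟨hμ, h0⟩
    omega
  have hd1 : (fderiv ℂ F (E₀, μ) ∘L .inr ℂ ℂ ℂ) 1 = c := by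
    have h1 : HasFDerivAt F (fderiv ℂ F (E₀, μ)) (E₀, μ) :=
      (hcd.differentiableAt (by simp)).hasFDerivAt
    have h2 : HasFDerivAt (fun x : ℂ => ((E₀, x) : ℂ × ℂ)) (.inr ℂ ℂ ℂ) μ :=
      hasFDerivAt_prodMk_right E₀ μ
    have h3 := (h1.comp μ h2).hasDerivAt
    have h4 : HasDerivAt (F ∘ fun x => (E₀, x)) c μ := by
      have h5 := (transfer R V T E₀).charpoly.hasDerivAt μ
      have h6 : (F ∘ fun x => (E₀, x)) = fun x => (transfer R V T E₀).charpoly.eval x := by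
        ext x; exact hFe E₀ x
      rw [h6]
      exact h5
    exact h3.unique h4
  have hinv : (fderiv ℂ F (E₀, μ) ∘L .inr ℂ ℂ ℂ).IsInvertible := by
    refine ⟨ContinuousLinearEquiv.unitsEquivAut ℂ (Units.mk0 c hc0), ?_⟩
    ext
    rw [hd1]
    simp
  refine ⟨hcd.implicitFunction (by simp) hinv, ?_, ?_, ?_⟩
  · exact (hcd.contDiffAt_implicitFunction (by simp) hinv).analyticAt
  · exact hcd.implicitFunction_apply_self (by simp) hinv
  · filter_upwards [hcd.eventually_apply_implicitFunction (by simp) hinv] with E hE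
    rw [Polynomial.IsRoot.def, ← hFe, hE, hFe]
    exact hμ

variable {R V T}

theorem injective_of_notMem_degenerateSet {E : ℂ} (hE : E ∉ degenerateSet R V T)
    {z : Fin (2 * L) → ℂ} (hz : ListsEigenvalues (transfer R V T E) z) : Function.Injective z :=
  hz.injective fun μ => by
    by_contra h
    exact hE ⟨μ, not_lt.1 h⟩

theorem exists_isAnalyticListing {E₀ : ℂ} (hE₀ : E₀ ∉ degenerateSet R V T)
    {z : Fin (2 * L) → ℂ} (hz : ListsEigenvalues (transfer R V T E₀) z) :
    ∃ ζ, IsAnalyticListing R V T E₀ ζ ∧ ∀ i, ζ i E₀ = z i := by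
  have h1 : ∀ i, ∃ f : ℂ → ℂ, AnalyticAt ℂ f E₀ ∧ f E₀ = z i ∧
      ∀ᶠ E in 𝓝 E₀, (transfer R V T E).charpoly.IsRoot (f E) := fun i =>
    exists_analytic_root R V T (hz.isRoot i) (by
      by_contra h
      exact hE₀ ⟨z i, not_lt.1 h⟩)
  choose ζ h2 h3 h4 using h1
  have hinj := injective_of_notMem_degenerateSet hE₀ hz
  refine ⟨ζ, ⟨h2, ?_⟩, h3⟩
  have h5 : ∀ᶠ E in 𝓝 E₀, ∀ i j, i ≠ j → ζ i E ≠ ζ j E := by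
    rw [eventually_all]; intro i
    rw [eventually_all]; intro j
    by_cases hij : i = j
    · simp [hij]
    · have : ζ i E₀ - ζ j E₀ ≠ 0 := by
        rw [h3, h3]
        exact sub_ne_zero.2 fun h => hij (hinj h)
      filter_upwards [((h2 i).sub (h2 j)).continuousAt.eventually_ne this] with E hE _
      exact sub_ne_zero.1 hE
  filter_upwards [h5, eventually_all.2 h4] with E hE1 hE2
  refine listsEigenvalues_of_injective ?_ hE2
  intro i j hij
  by_contra h
  exact hE1 i j h hij

theorem IsAnalyticListing.lists {E₀ : ℂ} {ζ : Fin (2 * L) → ℂ → ℂ}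
    (h : IsAnalyticListing R V T E₀ ζ) :
    ListsEigenvalues (transfer R V T E₀) fun i => ζ i E₀ := h.2.self_of_nhds

theorem IsAnalyticListing.eventually {E₀ : ℂ} {ζ : Fin (2 * L) → ℂ → ℂ}
    (h : IsAnalyticListing R V T E₀ ζ) : ∀ᶠ E in 𝓝 E₀, IsAnalyticListing R V T E ζ := by
  filter_upwards [eventually_all.2 fun i => (h.1 i).eventually_analyticAt,
    h.2.eventually_nhds] with E h1 h2
  exact ⟨h1, h2⟩

theorem IsAnalyticListing.eventually_injective {E₀ : ℂ} {ζ : Fin (2 * L) → ℂ → ℂ}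
    (h : IsAnalyticListing R V T E₀ ζ) (hE₀ : E₀ ∉ degenerateSet R V T) :
    ∀ᶠ E in 𝓝 E₀, Function.Injective fun i => ζ i E := by
  have hinj := injective_of_notMem_degenerateSet hE₀ h.lists
  have h5 : ∀ᶠ E in 𝓝 E₀, ∀ i j, i ≠ j → ζ i E ≠ ζ j E := by
    rw [eventually_all]; intro i
    rw [eventually_all]; intro j
    by_cases hij : i = j
    · simp [hij]
    · have : ζ i E₀ - ζ j E₀ ≠ 0 := sub_ne_zero.2 fun h => hij (hinj h)
      filter_upwards [((h.1 i).sub (h.1 j)).continuousAt.eventually_ne this] with E hE _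
      exact sub_ne_zero.1 hE
  filter_upwards [h5] with E hE i j hij
  by_contra h
  exact hE i j h hij

theorem qFun_eq_of_isEigenbasis {E : ℂ} {z : Fin (2 * L) → ℂ}
    {U : Matrix (Fin L ⊕ Fin L) (Fin (2 * L)) ℂ} {W : Matrix (Fin (2 * L)) (Fin L ⊕ Fin L) ℂ}
    (hz : ListsEigenvalues (transfer R V T E) z) (hinj : Function.Injective z)
    (h : IsEigenbasis (transfer R V T E) z U W) (I : Finset (Fin (2 * L))) :
    qFun R V T I E z = (U * diagonal (ind I) * W).toBlocks₂₁.det := by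
  rw [qFun, rieszProjection_image_eq h hz hinj]

theorem IsAnalyticListing.analyticAt_qFun {E₀ : ℂ} {ζ : Fin (2 * L) → ℂ → ℂ}
    (h : IsAnalyticListing R V T E₀ ζ) (hE₀ : E₀ ∉ degenerateSet R V T)
    (I : Finset (Fin (2 * L))) :
    AnalyticAt ℂ (fun E => qFun R V T I E fun i => ζ i E) E₀ := by
  have heq : (fun E => qFun R V T I E fun i => ζ i E) =ᶠ[𝓝 E₀] fun E =>
      (∑ i ∈ I, (∏ l ∈ Finset.univ.erase i, (ζ i E - ζ l E))⁻¹ •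
        (ζ i E • (1 : Matrix (Fin L ⊕ Fin L) (Fin L ⊕ Fin L) ℂ)
          - transfer R V T E).adjugate).toBlocks₂₁.det := by
    filter_upwards [h.2, h.eventually_injective hE₀] with E h1 h2
    obtain ⟨U, W, hU⟩ := exists_isEigenbasis h1 h2
    rw [qFun_eq_of_isEigenbasis h1 h2 hU, hU.conj_ind_eq h2]
  rw [analyticAt_congr heq]
  refine analyticAt_det fun a b => ?_
  simp only [toBlocks₂₁, Matrix.of_apply, Matrix.sum_apply, Matrix.smul_apply, smul_eq_mul]
  have hinj := injective_of_notMem_degenerateSet hE₀ h.lists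
  refine Finset.analyticAt_fun_sum _ fun i _ => AnalyticAt.mul (AnalyticAt.inv ?_ ?_) ?_
  · exact Finset.analyticAt_fun_prod _ fun l _ => (h.1 i).sub (h.1 l)
  · refine Finset.prod_ne_zero_iff.2 fun l hl => sub_ne_zero.2 fun he => ?_
    exact Finset.ne_of_mem_erase hl (hinj he).symm
  · refine analyticAt_adjugate (fun c d => ?_) _ _
    simp only [Matrix.sub_apply, Matrix.smul_apply, smul_eq_mul]
    exact ((h.1 i).mul analyticAt_const).sub (analyticAt_transfer_apply R V T c d E₀)

variable (R V T) in
/-- The determinant of the lower left block of the `N`-th power of the transfer matrix. -/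
noncomputable def powerDet (N : ℕ) (E : ℂ) : ℂ := (transfer R V T E ^ N).toBlocks₂₁.det

theorem differentiable_powerDet (N : ℕ) : Differentiable ℂ (powerDet R V T N) := by
  intro E₀
  have : ∀ i j, AnalyticAt ℂ (fun E => (transfer R V T E ^ N) i j) E₀ := by
    induction N with
    | zero => intro i j; simp only [pow_zero]; exact analyticAt_const
    | succ k ih =>
      intro i j
      simp_rw [pow_succ, Matrix.mul_apply]
      exact Finset.analyticAt_fun_sum _ fun l _ => (ih i l).mul
        (analyticAt_transfer_apply R V T l j E₀)
  exact (analyticAt_det fun i j => this _ _).differentiableAt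

theorem powerDet_eq_sum {E : ℂ} {z : Fin (2 * L) → ℂ}
    (hz : ListsEigenvalues (transfer R V T E) z) (hinj : Function.Injective z) (N : ℕ) :
    powerDet R V T N E =
      (-1) ^ L * ∑ I ∈ halfSets L, (∏ i ∈ Iᶜ, z i) ^ N * qFun R V T I E z := by
  obtain ⟨U, W, hU⟩ := exists_isEigenbasis hz hinj
  rw [powerDet, hU.det_pow]
  simp_rw [qFun_eq_of_isEigenbasis hz hinj hU]

theorem ListsEigenvalues.ne_zero (hA : IsUnit T ∧ IsUnit R) {E : ℂ} {z : Fin (2 * L) → ℂ}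
    (hz : ListsEigenvalues (transfer R V T E) z) (i : Fin (2 * L)) : z i ≠ 0 := by
  intro h0
  have h1 := hz.isRoot i
  rw [h0, Polynomial.IsRoot.def, Matrix.eval_charpoly, map_zero, zero_sub, det_neg,
    mul_eq_zero] at h1
  have h2 : (transfer R V T E).det = 0 := h1.resolve_left (pow_ne_zero _ (by simp))
  obtain ⟨v, hv0, hv⟩ := Matrix.exists_mulVec_eq_zero_iff.2 h2
  have hve : v = Sum.elim (v ∘ Sum.inl) (v ∘ Sum.inr) := by ext (a | a) <;> rfl
  rw [hve, transfer_mulVec_elim] at hv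
  have hT : IsUnit T⁻¹ := by
    rw [Matrix.isUnit_nonsing_inv_iff]; exact hA.1
  have hl : T⁻¹ *ᵥ (v ∘ Sum.inl) = 0 := funext fun a => congrFun hv (Sum.inr a)
  have hr : -(R *ᵥ (v ∘ Sum.inr)) = 0 := by
    have : E • (T⁻¹ *ᵥ (v ∘ Sum.inl)) - V *ᵥ (T⁻¹ *ᵥ (v ∘ Sum.inl)) - R *ᵥ (v ∘ Sum.inr) = 0 :=
      funext fun a => congrFun hv (Sum.inl a)
    simpa [hl] using this
  have hl' := (Matrix.mulVec_injective_of_isUnit hT) (hl.trans (Matrix.mulVec_zero _).symm)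
  have hr' := (Matrix.mulVec_injective_of_isUnit hA.2)
    ((neg_eq_zero.1 hr).trans (Matrix.mulVec_zero _).symm)
  apply hv0
  rw [hve, hl', hr']
  ext (a | a) <;> rfl

end Analytic

/-! ### Analyticity off `Λ` -/

/-- Exchanging the elements of `B \ A` for those of `A \ B` lowers the product of `f`, if `f` is
smaller on `A \ B` than on `B \ A`, strictly at some place. -/
theorem prod_lt_prod_of_exchange {ι : Type*} [DecidableEq ι] {f : ι → ℝ} (hf : ∀ i, 0 < f i)
    {A B : Finset ι} (hcard : A.card = B.card) (hle : ∀ a ∈ A \ B, ∀ b ∈ B \ A, f a ≤ f b)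
    (hlt : (∃ a ∈ A \ B, ∀ b ∈ B \ A, f a < f b) ∨ ∃ b ∈ B \ A, ∀ a ∈ A \ B, f a < f b) :
    ∏ i ∈ A, f i < ∏ i ∈ B, f i := by
  have hc : (A \ B).card = (B \ A).card := by
    have h1 := Finset.card_sdiff_add_card_inter A B
    have h2 := Finset.card_sdiff_add_card_inter B A
    rw [Finset.inter_comm] at h2
    omega
  let e := Finset.equivOfCardEq hc
  have hX : ∏ i ∈ A \ B, f i < ∏ i ∈ B \ A, f i := by
    rw [← Finset.prod_coe_sort (A \ B), ← Finset.prod_coe_sort (B \ A),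
      ← Equiv.prod_comp e fun b : ↥(B \ A) => f b]
    apply Finset.prod_lt_prod (f := fun i : ↥(A \ B) => f i)
      (g := fun i : ↥(A \ B) => f (e i)) (fun i _ => hf i)
    · exact fun i _ => hle i i.2 (e i) (e i).2
    · rcases hlt with ⟨a, ha, hab⟩ | ⟨b, hb, hab⟩
      · exact ⟨⟨a, ha⟩, Finset.mem_univ _, hab _ (e ⟨a, ha⟩).2⟩
      · refine ⟨e.symm ⟨b, hb⟩, Finset.mem_univ _, ?_⟩
        rw [Equiv.apply_symm_apply]
        exact hab _ (e.symm ⟨b, hb⟩).2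
  have h1 := Finset.prod_inter_mul_prod_sdiff A B f
  have h2 := Finset.prod_inter_mul_prod_sdiff B A f
  rw [← h1, ← h2, Finset.inter_comm B A]
  exact mul_lt_mul_of_pos_left hX (Finset.prod_pos fun i _ => hf i)

theorem indexZero_mem_halfSets (L : ℕ) : indexZero L ∈ halfSets L := by
  rw [Finset.mem_powersetCard]
  refine ⟨Finset.subset_univ _, ?_⟩
  have : indexZero L = (Finset.univ : Finset (Fin L)).map (Fin.castLEEmb (by omega)) := by
    ext i
    simp only [indexZero, Finset.mem_filter, Finset.mem_univ, true_and, Finset.mem_map,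
      Fin.castLEEmb_apply]
    constructor
    · intro h; exact ⟨⟨i, h⟩, rfl⟩
    · rintro ⟨j, rfl⟩; exact j.2
  rw [this, Finset.card_map, Finset.card_univ, Fintype.card_fin]

variable {L : ℕ} {R V T : Matrix (Fin L) (Fin L) ℂ}

theorem mem_indexZero {i : Fin (2 * L)} : i ∈ indexZero L ↔ (i : ℕ) < L := by
  simp [indexZero]

/-- If a circle separates the `L` smallest eigenvalues, the product of the others strictly dominates
all other products of `L` eigenvalues. -/
theorem norm_prod_compl_lt {z : Fin (2 * L) → ℂ} (hz : ∀ i, z i ≠ 0) {r : ℝ}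
    (hr : Separates r (indexZero L) z) {I : Finset (Fin (2 * L))} (hI : I ∈ halfSets L)
    (hne : I ≠ indexZero L) : ‖∏ i ∈ Iᶜ, z i‖ < ‖∏ i ∈ (indexZero L)ᶜ, z i‖ := by
  rw [norm_prod, norm_prod]
  have hlt : ∀ a ∈ Iᶜ \ (indexZero L)ᶜ, ∀ b ∈ (indexZero L)ᶜ \ Iᶜ, ‖z a‖ < ‖z b‖ := by
    intro a ha b hb
    simp only [Finset.mem_sdiff, Finset.mem_compl, not_not] at ha hb
    exact ((hr a).1 ha.2).trans ((hr b).2 hb.1)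
  have hc : (Iᶜ).card = (indexZero L)ᶜ.card := by
    rw [(Finset.mem_powersetCard.1 (mem_halfSets_compl hI)).2,
      (Finset.mem_powersetCard.1 (mem_halfSets_compl (indexZero_mem_halfSets L))).2]
  refine prod_lt_prod_of_exchange (fun i => norm_pos_iff.2 (hz i)) hc
    (fun a ha b hb => (hlt a ha b hb).le) (Or.inl ?_)
  have : (Iᶜ \ (indexZero L)ᶜ).Nonempty := by
    rw [Finset.sdiff_nonempty]
    intro hsub
    apply hne
    have := Finset.eq_of_subset_of_card_le hsub hc.ge
    exact compl_injective this
  obtain ⟨a, ha⟩ := this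
  exact ⟨a, ha, hlt a ha⟩

/-- `G` is symmetric in the variables with index in `I` and in the remaining variables. -/
def SymmetricOn {ι X : Type*} (I : Finset ι) (G : (ι → ℂ) → X) : Prop :=
  ∀ z (σ : Equiv.Perm ι), (∀ i, σ i ∈ I ↔ i ∈ I) → G (z ∘ σ) = G z

theorem SymmetricOn.eq_of_separates {X : Type*} {G : (Fin (2 * L) → ℂ) → X}
    (hG : SymmetricOn (indexZero L) G) {A : Matrix (Fin L ⊕ Fin L) (Fin L ⊕ Fin L) ℂ}
    {z w : Fin (2 * L) → ℂ} {r : ℝ}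
    (hz : ListsEigenvalues A z) (hw : ListsEigenvalues A w) (hzr : Separates r (indexZero L) z)
    (hwr : Separates r (indexZero L) w) : G z = G w := by
  obtain ⟨σ, rfl, hσ⟩ := hz.exists_perm_of_separates hw hzr hwr
  exact (hG z σ hσ).symm

theorem symmetricOn_prod_compl (I : Finset (Fin (2 * L))) :
    SymmetricOn I fun z : Fin (2 * L) → ℂ => ∏ i ∈ Iᶜ, z i := by
  intro z σ hσ
  refine Finset.prod_nbij' (fun i => σ i) (fun i => σ.symm i) ?_ ?_ ?_ ?_ ?_
  · intro i hi
    rw [Finset.mem_compl] at *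
    rwa [hσ]
  · intro i hi
    rw [Finset.mem_compl] at *
    rw [← hσ]; simpa using hi
  · simp
  · simp
  · simp

theorem symmetricOn_qFun (I : Finset (Fin (2 * L))) (E : ℂ) :
    SymmetricOn I fun z : Fin (2 * L) → ℂ => qFun R V T I E z := by
  intro z σ hσ
  have : I.image (z ∘ σ) = I.image z := by
    ext μ
    simp only [Finset.mem_image, Function.comp]
    constructor
    · rintro ⟨i, hi, rfl⟩
      exact ⟨σ i, (hσ i).2 hi, rfl⟩
    · rintro ⟨i, hi, rfl⟩
      exact ⟨σ.symm i, (hσ _).1 (by simpa using hi), by simp⟩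
  simp only [qFun, this]

section Continuity

theorem continuous_norm_eig (i : Fin (2 * L)) : Continuous fun E => ‖eig R V T E i‖ := by
  rw [continuous_iff_continuousAt]
  intro E₀
  exact tendsto_norm_of_isOrderedListing ((continuous_transfer R V T).tendsto E₀)
    (Eventually.of_forall fun E => eig_spec R V T E) (eig_spec R V T E₀) i

variable [NeZero L]

theorem isClosed_lambdaSet : IsClosed (lambdaSet R V T) :=
  isClosed_eq (continuous_norm_eig _) (continuous_norm_eig _)

theorem midLow_le_midHigh : midLow L ≤ midHigh L := by
  rw [Fin.le_def]; simp [midLow, midHigh]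

theorem separates_of_lt {z : Fin (2 * L) → ℂ} (hz : Monotone fun i => ‖z i‖) {r : ℝ}
    (h1 : ‖z (midLow L)‖ < r) (h2 : r < ‖z (midHigh L)‖) : Separates r (indexZero L) z := by
  intro i
  rw [mem_indexZero]
  constructor
  · intro hi
    exact (hz (Fin.le_def.2 (by simp only [midLow]; omega))).trans_lt h1
  · intro hi
    exact h2.trans_le (hz (Fin.le_def.2 (by simp only [midHigh]; omega)))

theorem exists_separates {E₀ : ℂ} (h : E₀ ∉ lambdaSet R V T) :
    ∃ r, ∀ᶠ E in 𝓝 E₀, ∀ z, IsOrderedListing (transfer R V T E) z →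
      Separates r (indexZero L) z := by
  have hlt : ‖eig R V T E₀ (midLow L)‖ < ‖eig R V T E₀ (midHigh L)‖ :=
    lt_of_le_of_ne ((eig_spec R V T E₀).2 midLow_le_midHigh) h
  obtain ⟨r, h1, h2⟩ := exists_between hlt
  refine ⟨r, ?_⟩
  filter_upwards [(continuous_norm_eig (midLow L)).continuousAt.eventually_lt_const h1,
    (continuous_norm_eig (midHigh L)).continuousAt.eventually_const_lt h2] with E h3 h4 z hz
  have hn := hz.norm_eq (eig_spec R V T E)
  refine separates_of_lt hz.2 ?_ ?_
  · rw [congrFun hn (midLow L)]; exact h3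
  · rw [congrFun hn (midHigh L)]; exact h4

/-- Symmetric functions of the two groups of eigenvalues are continuous off `Λ`, also at degenerate
energies. -/
theorem SymmetricOn.continuousAt {X : Type*} [TopologicalSpace X] {G : (Fin (2 * L) → ℂ) → X}
    (hG : SymmetricOn (indexZero L) G) {E₀ : ℂ} (hE₀ : E₀ ∉ lambdaSet R V T)
    (hc : ∀ z, IsOrderedListing (transfer R V T E₀) z → ContinuousAt G z) :
    ContinuousAt (fun E => G (eig R V T E)) E₀ := by
  obtain ⟨r, hr⟩ := exists_separates hE₀
  have hr₀ := hr.self_of_nhds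
  refine tendsto_of_forall_isOrderedListing ((continuous_transfer R V T).tendsto E₀)
    (Eventually.of_forall fun E => eig_spec R V T E) fun z hz => ?_
  obtain ⟨σ, rfl, hσ⟩ := (eig_spec R V T E₀).1.exists_perm_of_separates hz.1
    (hr₀ _ (eig_spec R V T E₀)) (hr₀ _ hz)
  have := hc _ hz
  rw [ContinuousAt, hG _ σ hσ] at this
  exact this

/-- Near an energy off `Λ` and `𝓕`, the ordered listing may be replaced by an analytic listing in
quantities that only distinguish the `L` smaller from the `L` larger eigenvalues. -/
theorem exists_analytic_separated {E₀ : ℂ} (hE₀ : E₀ ∉ lambdaSet R V T)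
    (hF : E₀ ∉ degenerateSet R V T) :
    ∃ ζ, IsAnalyticListing R V T E₀ ζ ∧ ∃ r, ∀ᶠ E in 𝓝 E₀,
      Separates r (indexZero L) (eig R V T E) ∧ Separates r (indexZero L) (fun i => ζ i E) := by
  obtain ⟨ζ, hζ, hζ₀⟩ := exists_isAnalyticListing hF (eig_spec R V T E₀).1
  obtain ⟨r, hr⟩ := exists_separates hE₀
  have hr₀ := hr.self_of_nhds _ (eig_spec R V T E₀)
  refine ⟨ζ, hζ, r, ?_⟩
  have h1 : ∀ᶠ E in 𝓝 E₀, Separates r (indexZero L) (fun i => ζ i E) := by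
    refine Filter.eventually_all.2 fun i => ?_
    have hc : ContinuousAt (fun E => ‖ζ i E‖) E₀ := (hζ.1 i).continuousAt.norm
    by_cases hi : i ∈ indexZero L
    · have := (hr₀ i).1 hi
      rw [← hζ₀ i] at this
      filter_upwards [hc.eventually_lt_const this] with E hE
      exact ⟨fun _ => hE, fun h => absurd hi h⟩
    · have := (hr₀ i).2 hi
      rw [← hζ₀ i] at this
      filter_upwards [hc.eventually_const_lt this] with E hE
      exact ⟨fun h => absurd h hi, fun _ => hE⟩
  filter_upwards [hr, h1] with E h2 h3
  exact ⟨h2 _ (eig_spec R V T E), h3⟩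

theorem SymmetricOn.analyticAt {G : (Fin (2 * L) → ℂ) → ℂ}
    (hG : SymmetricOn (indexZero L) G) {E₀ : ℂ} (hE₀ : E₀ ∉ lambdaSet R V T)
    (hF : E₀ ∉ degenerateSet R V T)
    (hc : ∀ ζ, IsAnalyticListing R V T E₀ ζ → AnalyticAt ℂ (fun E => G fun i => ζ i E) E₀) :
    AnalyticAt ℂ (fun E => G (eig R V T E)) E₀ := by
  obtain ⟨ζ, hζ, r, hr⟩ := exists_analytic_separated hE₀ hF
  refine (hc ζ hζ).congr ?_
  filter_upwards [hr, hζ.2] with E h1 h2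
  exact hG.eq_of_separates h2 (eig_spec R V T E).1 h1.2 h1.1

theorem eventually_notMem_of_finite {F : Set ℂ} (hF : F.Finite) (E₀ : ℂ) :
    ∀ᶠ E in 𝓝[≠] E₀, E ∉ F := by
  have h1 : IsClosed (F \ {E₀}) := (hF.subset Set.sdiff_subset).isClosed
  have h2 : ∀ᶠ E in 𝓝 E₀, E ∉ F \ {E₀} := h1.isOpen_compl.mem_nhds (by simp)
  filter_upwards [h2.filter_mono nhdsWithin_le_nhds, self_mem_nhdsWithin] with E h3 h4 h5
  exact h3 ⟨h5, h4⟩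

theorem analyticAt_of_analyticAt_off_finite {F : Set ℂ} (hF : F.Finite) {f : ℂ → ℂ} {Ω : Set ℂ}
    (hΩ : IsOpen Ω) (h1 : ∀ E ∈ Ω, E ∉ F → AnalyticAt ℂ f E) (h2 : ∀ E ∈ Ω, ContinuousAt f E)
    {E₀ : ℂ} (hE₀ : E₀ ∈ Ω) : AnalyticAt ℂ f E₀ := by
  refine Complex.analyticAt_of_differentiable_on_punctured_nhds_of_continuousAt ?_ (h2 E₀ hE₀)
  filter_upwards [eventually_notMem_of_finite hF E₀,
    nhdsWithin_le_nhds (hΩ.mem_nhds hE₀)] with E h3 h4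
  exact (h1 E h4 h3).differentiableAt

variable (R V T) in
/-- The product of the `L` eigenvalues of largest modulus. -/
noncomputable def zPlus (E : ℂ) : ℂ := ∏ i ∈ (indexZero L)ᶜ, eig R V T E i

variable (R V T) in
/-- The function `q_{I₀}` with respect to the listing of the eigenvalues by modulus. -/
noncomputable def qLow (E : ℂ) : ℂ := qFun R V T (indexZero L) E (eig R V T E)

theorem analyticAt_zPlus (hB : (degenerateSet R V T).Finite) {E₀ : ℂ}
    (hE₀ : E₀ ∉ lambdaSet R V T) : AnalyticAt ℂ (zPlus R V T) E₀ := by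
  refine analyticAt_of_analyticAt_off_finite hB (Ω := (lambdaSet R V T)ᶜ)
    isClosed_lambdaSet.isOpen_compl (fun E h1 h2 => ?_) (fun E h1 => ?_) hE₀
  · exact (symmetricOn_prod_compl (indexZero L)).analyticAt h1 h2 fun ζ hζ =>
      Finset.analyticAt_fun_prod _ fun i _ => hζ.1 i
  · exact (symmetricOn_prod_compl (indexZero L)).continuousAt h1 fun z _ => by fun_prop

/-- Near `E₀` the Riesz projection is given by the contours for `E₀`, which are fixed; this covers
degenerate `E₀`. -/
theorem continuousAt_qLow (hB : (degenerateSet R V T).Finite) {E₀ : ℂ}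
    (hE₀ : E₀ ∉ lambdaSet R V T) : ContinuousAt (qLow R V T) E₀ := by
  obtain ⟨r, hr⟩ := exists_separates hE₀
  have hr₀ := hr.self_of_nhds
  set S := (indexZero L).image (eig R V T E₀) with hS
  have heq : ∀ᶠ E in 𝓝 E₀, qLow R V T E =
      (contourProjection (transfer R V T E₀) S (transfer R V T E)).toBlocks₂₁.det := by
    have h1 := eventually_exists_isOrderedListing_near ((continuous_transfer R V T).tendsto E₀)
      (Eventually.of_forall fun E => eig_spec R V T E) (sepRadius_pos (transfer R V T E₀))
    have h2 := eventually_nhdsWithin_iff.1 (eventually_notMem_of_finite hB E₀)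
    filter_upwards [h1, h2] with E h3 h4
    by_cases hE : E = E₀
    · rw [hE]; rfl
    · have hnd := h4 hE
      have hinj := injective_of_notMem_degenerateSet hnd (eig_spec R V T E).1
      obtain ⟨U, W, hU⟩ := exists_isEigenbasis (eig_spec R V T E).1 hinj
      obtain ⟨y, hy, hclose⟩ := h3
      have hSy : S = (indexZero L).image y :=
        (eig_spec R V T E₀).1.image_eq_of_separates hy.1 (hr₀ _ (eig_spec R V T E₀)) (hr₀ _ hy)
      have hmem : (fun k => if y k ∈ S then (1 : ℂ) else 0) = ind (indexZero L) := by
        ext k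
        have : y k ∈ S ↔ k ∈ indexZero L := by
          rw [hSy]
          constructor
          · intro h
            obtain ⟨i, hi, hik⟩ := Finset.mem_image.1 h
            rw [← (hr₀ y hy).norm_lt_iff, ← hik, (hr₀ y hy).norm_lt_iff]
            exact hi
          · exact fun h => Finset.mem_image_of_mem _ h
        simp [ind, this]
      rw [qLow, qFun_eq_of_isEigenbasis (eig_spec R V T E).1 hinj hU,
        contourProjection_eq hy.1 hU hclose, hmem]
  have hcont : ContinuousAt (fun E =>
      (contourProjection (transfer R V T E₀) S (transfer R V T E)).toBlocks₂₁.det) E₀ := by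
    have h1 : Continuous fun M : Matrix (Fin L ⊕ Fin L) (Fin L ⊕ Fin L) ℂ => M.toBlocks₂₁.det := by
      unfold toBlocks₂₁
      fun_prop
    have h2 : ContinuousAt
        (fun E => contourProjection (transfer R V T E₀) S (transfer R V T E)) E₀ :=
      ContinuousAt.comp (g := contourProjection (transfer R V T E₀) S)
        (continuousAt_contourProjection (transfer R V T E₀) S)
        (continuous_transfer R V T).continuousAt
    exact h1.continuousAt.comp h2
  exact hcont.congr (heq.mono fun E h => h.symm)

theorem analyticAt_qLow (hB : (degenerateSet R V T).Finite) {E₀ : ℂ}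
    (hE₀ : E₀ ∉ lambdaSet R V T) : AnalyticAt ℂ (qLow R V T) E₀ := by
  refine analyticAt_of_analyticAt_off_finite hB (Ω := (lambdaSet R V T)ᶜ)
    isClosed_lambdaSet.isOpen_compl (fun E h1 h2 => ?_) (fun E h1 => continuousAt_qLow hB h1) hE₀
  obtain ⟨ζ, hζ, r, hr⟩ := exists_analytic_separated h1 h2
  refine (hζ.analyticAt_qFun h2 (indexZero L)).congr ?_
  filter_upwards [hr, hζ.2] with E h3 h4
  exact (symmetricOn_qFun (indexZero L) E).eq_of_separates h4 (eig_spec R V T E).1 h3.2 h3.1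

end Continuity

/-! ### Limit sets, Hurwitz's theorem and the asymptotics off `Λ` -/

section LimitSets

/-- A point lies in the uniform limit set iff its distance to the sets tends to zero. -/
theorem mem_uniformLimitSet_iff {S : ℕ → Set ℂ} (hS : ∀ N, 1 ≤ N → (S N).Nonempty) {E : ℂ} :
    E ∈ uniformLimitSet S ↔ ∀ ε > 0, ∀ᶠ N in atTop, ∃ e ∈ S N, dist e E < ε := by
  constructor
  · rintro ⟨e, he, ht⟩ ε hε
    filter_upwards [eventually_ge_atTop 1, ht.eventually (Metric.ball_mem_nhds E hε)] with N h1 h2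
    exact ⟨e N, he N h1, h2⟩
  · intro h
    have hex : ∀ N, ∃ e, 1 ≤ N →
        e ∈ S N ∧ dist E e < Metric.infDist E (S N) + 1 / ((N : ℝ) + 1) := by
      intro N
      by_cases hN : 1 ≤ N
      · obtain ⟨e, he, hd⟩ := (Metric.infDist_lt_iff (hS N hN) (x := E)).1
          (lt_add_of_pos_right _ (show (0 : ℝ) < 1 / ((N : ℝ) + 1) by positivity))
        exact ⟨e, fun _ => ⟨he, hd⟩⟩
      · exact ⟨0, fun h => absurd h hN⟩
    choose e he using hex
    refine ⟨e, fun N hN => (he N hN).1, ?_⟩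
    have h0 : Tendsto (fun N => Metric.infDist E (S N)) atTop (𝓝 0) := by
      rw [Metric.tendsto_nhds]
      intro ε hε
      filter_upwards [h ε hε] with N ⟨x, hx, hd⟩
      rw [Real.dist_0_eq_abs, abs_of_nonneg Metric.infDist_nonneg]
      rw [dist_comm] at hd
      exact (Metric.infDist_le_dist_of_mem hx).trans_lt hd
    have h1 := h0.add tendsto_one_div_add_atTop_nhds_zero_nat
    rw [add_zero] at h1
    rw [tendsto_iff_dist_tendsto_zero]
    refine squeeze_zero' (Eventually.of_forall fun _ => dist_nonneg) ?_ h1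
    filter_upwards [eventually_ge_atTop 1] with N hN
    rw [dist_comm]
    exact (he N hN).2.le

theorem isClosed_uniformLimitSet {S : ℕ → Set ℂ} (hS : ∀ N, 1 ≤ N → (S N).Nonempty) :
    IsClosed (uniformLimitSet S) := by
  rw [← closure_subset_iff_isClosed]
  intro E hE
  rw [mem_uniformLimitSet_iff hS]
  intro ε hε
  obtain ⟨E', hE', hd⟩ := Metric.mem_closure_iff.1 hE (ε / 2) (half_pos hε)
  filter_upwards [(mem_uniformLimitSet_iff hS).1 hE' (ε / 2) (half_pos hε)] with N ⟨e, he, hed⟩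
  refine ⟨e, he, ?_⟩
  have := dist_triangle e E' E
  rw [dist_comm] at hd
  linarith

theorem uniformLimitSet_subset_partialLimitSet {S : ℕ → Set ℂ} :
    uniformLimitSet S ⊆ partialLimitSet S := by
  rintro E ⟨e, he, ht⟩
  exact ⟨fun n => n + 1, fun n => e (n + 1),
    fun n => ⟨Nat.le_add_left 1 n, he _ (Nat.le_add_left 1 n)⟩,
    tendsto_add_atTop_nat 1, ht.comp (tendsto_add_atTop_nat 1)⟩

end LimitSets

/-- Hurwitz's theorem: a zero of a nonconstant limit function is approached by zeros. -/
theorem eventually_exists_zero {ι : Type*} {l : Filter ι} {F : ι → ℂ → ℂ} {g : ℂ → ℂ} {t₀ : ℂ}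
    {ρ : ℝ} (hρ : 0 < ρ) (hF : ∀ᶠ n in l, DifferentiableOn ℂ (F n) (Metric.closedBall t₀ ρ))
    (hg : AnalyticAt ℂ g t₀) (hg₀ : g t₀ = 0) (hne : ∃ᶠ t in 𝓝 t₀, g t ≠ 0)
    (hu : TendstoUniformlyOn F g l (Metric.closedBall t₀ ρ)) {ε : ℝ} (hε : 0 < ε) :
    ∀ᶠ n in l, ∃ t ∈ Metric.closedBall t₀ ε, F n t = 0 := by
  have h1 : ∀ᶠ t in 𝓝[≠] t₀, g t ≠ 0 := by
    rcases hg.eventually_eq_zero_or_eventually_ne_zero with h | h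
    · exact (hne (h.mono fun t ht hn => hn ht)).elim
    · exact h
  have h2 : ∀ᶠ t in 𝓝 t₀, t ≠ t₀ → g t ≠ 0 := eventually_nhdsWithin_iff.1 h1
  obtain ⟨δ, hδ, hball⟩ := Metric.eventually_nhds_iff.1 (h2.and hg.eventually_analyticAt)
  -- On the circle of radius `r` the limit has a positive minimal modulus `m`.
  set r := min (min ε ρ) (δ / 2) with hr
  have hr0 : 0 < r := lt_min (lt_min hε hρ) (half_pos hδ)
  have hrε : r ≤ ε := (min_le_left _ _).trans (min_le_left _ _)
  have hrρ : r ≤ ρ := (min_le_left _ _).trans (min_le_right _ _)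
  have hrδ : r < δ := (min_le_right _ _).trans_lt (half_lt_self hδ)
  have hcont : ContinuousOn (fun t => ‖g t‖) (Metric.sphere t₀ r) := by
    intro t ht
    have : dist t t₀ < δ := by rw [Metric.mem_sphere.1 ht]; exact hrδ
    exact (hball this).2.continuousAt.norm.continuousWithinAt
  obtain ⟨x, hx, hmin⟩ := (isCompact_sphere t₀ r).exists_isMinOn
    (NormedSpace.sphere_nonempty.2 hr0.le) hcont
  set m := ‖g x‖ with hm
  have hm0 : 0 < m := by
    have hd : dist x t₀ = r := Metric.mem_sphere.1 hx
    refine norm_pos_iff.2 ((hball (by rw [hd]; exact hrδ)).1 ?_)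
    rintro rfl
    rw [dist_self] at hd
    exact hr0.ne hd
  rw [Metric.tendstoUniformlyOn_iff] at hu
  filter_upwards [hF, hu (m / 2) (half_pos hm0)] with n hn1 hn2
  -- Without zeros, the maximum principle for `1 / F n` bounds `‖F n‖` from below by `m / 2`.
  by_contra! hcon
  have hsub : Metric.closedBall t₀ r ⊆ Metric.closedBall t₀ ρ :=
    Metric.closedBall_subset_closedBall hrρ
  have hnz : ∀ t ∈ Metric.closedBall t₀ r, F n t ≠ 0 := fun t ht =>
    hcon t (Metric.closedBall_subset_closedBall hrε ht)
  have hd : DifferentiableOn ℂ (fun t => (F n t)⁻¹) (Metric.closedBall t₀ r) :=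
    (hn1.mono hsub).inv hnz
  have hmax := Complex.norm_le_of_forall_mem_frontier_norm_le (f := fun t => (F n t)⁻¹)
    (U := Metric.ball t₀ r) (C := 2 / m) Metric.isBounded_ball
    (hd.diffContOnCl_ball subset_rfl) (by
      intro t ht
      rw [frontier_ball t₀ hr0.ne'] at ht
      have h3 := hn2 t (hsub (Metric.sphere_subset_closedBall ht))
      have h4 : m ≤ ‖g t‖ := hmin ht
      rw [dist_eq_norm] at h3
      have h5 : m / 2 ≤ ‖F n t‖ := by
        have := norm_sub_norm_le (g t) (F n t)
        linarith
      rw [norm_inv, ← inv_div]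
      exact inv_anti₀ (half_pos hm0) h5)
    (subset_closure (Metric.mem_ball_self hr0))
  have h6 := hn2 t₀ (Metric.mem_closedBall_self hρ.le)
  rw [hg₀, dist_zero_left] at h6
  rw [norm_inv, ← inv_div] at hmax
  have h7 := (inv_le_inv₀ (norm_pos_iff.2 (hnz t₀ (Metric.mem_closedBall_self hr0.le)))
    (half_pos hm0)).1 hmax
  linarith

/-- The terms of the expansion of `powerDet` with a product of eigenvalues of smaller modulus than
the leading one are exponentially small relative to it, locally uniformly in the energy. -/
theorem IsAnalyticListing.exists_sum_bound {E₀ : ℂ} {ζ : Fin (2 * L) → ℂ → ℂ}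
    (hA : IsUnit T ∧ IsUnit R) (h : IsAnalyticListing R V T E₀ ζ) (hF : E₀ ∉ degenerateSet R V T)
    (S : Finset (Finset (Fin (2 * L))))
    (hS : ∀ I ∈ S, ‖∏ i ∈ Iᶜ, ζ i E₀‖ < ‖∏ i ∈ (indexZero L)ᶜ, ζ i E₀‖) :
    ∃ C κ : ℝ, 0 ≤ C ∧ 0 ≤ κ ∧ κ < 1 ∧ ∀ᶠ E in 𝓝 E₀, ∀ N : ℕ,
      ‖∑ I ∈ S, ((∏ i ∈ Iᶜ, ζ i E) / ∏ i ∈ (indexZero L)ᶜ, ζ i E) ^ N *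
        qFun R V T I E (fun i => ζ i E)‖ ≤ C * κ ^ N := by
  set ratio : Finset (Fin (2 * L)) → ℂ → ℂ := fun I E =>
    (∏ i ∈ Iᶜ, ζ i E) / ∏ i ∈ (indexZero L)ᶜ, ζ i E with hratio
  have hnz : ∏ i ∈ (indexZero L)ᶜ, ζ i E₀ ≠ 0 :=
    Finset.prod_ne_zero_iff.2 fun i _ => h.lists.ne_zero hA i
  have hrc : ∀ I, ContinuousAt (ratio I) E₀ := by
    intro I
    exact ((Finset.analyticAt_fun_prod _ fun i _ => h.1 i).div
      (Finset.analyticAt_fun_prod _ fun i _ => h.1 i) hnz).continuousAt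
  have hlt : ∀ I ∈ S, ‖ratio I E₀‖ < 1 := by
    intro I hI
    rw [hratio, norm_div, div_lt_one (norm_pos_iff.2 hnz)]
    exact hS I hI
  obtain ⟨κ, hκ, hκ1, hκ0⟩ : ∃ κ : ℝ, (∀ I ∈ S, ‖ratio I E₀‖ < κ) ∧ κ < 1 ∧ 0 < κ := by
    have h1 : ∀ᶠ κ : ℝ in 𝓝[<] 1, ∀ I ∈ S, ‖ratio I E₀‖ < κ := by
      rw [eventually_all_finset]
      intro I hI
      exact nhdsWithin_le_nhds (eventually_gt_nhds (hlt I hI))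
    have h2 : ∀ᶠ κ : ℝ in 𝓝[<] 1, 0 < κ := nhdsWithin_le_nhds (eventually_gt_nhds one_pos)
    exact (h1.and (eventually_mem_nhdsWithin.and h2)).exists
  refine ⟨∑ I ∈ S, (‖qFun R V T I E₀ (fun i => ζ i E₀)‖ + 1), κ, by positivity, hκ0.le, hκ1, ?_⟩
  have h1 : ∀ᶠ E in 𝓝 E₀, ∀ I ∈ S, ‖ratio I E‖ < κ := by
    rw [eventually_all_finset]
    exact fun I hI => (hrc I).norm.eventually_lt_const (hκ I hI)
  have h2 : ∀ᶠ E in 𝓝 E₀, ∀ I ∈ S, ‖qFun R V T I E (fun i => ζ i E)‖ <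
      ‖qFun R V T I E₀ (fun i => ζ i E₀)‖ + 1 := by
    rw [eventually_all_finset]
    exact fun I _ => (h.analyticAt_qFun hF I).continuousAt.norm.eventually_lt_const
      (lt_add_one _)
  filter_upwards [h1, h2] with E h3 h4 N
  rw [Finset.sum_mul]
  refine norm_sum_le_of_le _ fun I hI => ?_
  rw [norm_mul, norm_pow, mul_comm]
  exact mul_le_mul (h4 I hI).le (pow_le_pow_left₀ (norm_nonneg _) (h3 I hI).le N)
    (by positivity) (by positivity)

theorem zPlus_ne_zero (hA : IsUnit T ∧ IsUnit R) (E : ℂ) : zPlus R V T E ≠ 0 :=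
  Finset.prod_ne_zero_iff.2 fun i _ => (eig_spec R V T E).1.ne_zero hA i

section OffLambda

variable (R V T) in
/-- The determinant `powerDet`, normalized by the dominating product of eigenvalues. -/
noncomputable def scaledDet (N : ℕ) (E : ℂ) : ℂ := powerDet R V T N E / zPlus R V T E ^ N

theorem scaledDet_eq_zero_iff (hA : IsUnit T ∧ IsUnit R) (N : ℕ) (E : ℂ) :
    scaledDet R V T N E = 0 ↔ powerDet R V T N E = 0 := by
  rw [scaledDet, div_eq_zero_iff, or_iff_left (pow_ne_zero _ (zPlus_ne_zero hA E))]

variable [NeZero L]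

theorem analyticAt_scaledDet (hA : IsUnit T ∧ IsUnit R) (hB : (degenerateSet R V T).Finite)
    {E₀ : ℂ} (hE₀ : E₀ ∉ lambdaSet R V T) (N : ℕ) : AnalyticAt ℂ (scaledDet R V T N) E₀ :=
  ((differentiable_powerDet N).analyticAt E₀).div ((analyticAt_zPlus hB hE₀).pow N)
    (pow_ne_zero _ (zPlus_ne_zero hA E₀))

theorem tendstoLocallyUniformlyOn_scaledDet (hA : IsUnit T ∧ IsUnit R) :
    TendstoLocallyUniformlyOn (scaledDet R V T) (fun E => (-1) ^ L * qLow R V T E) atTop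
      ((lambdaSet R V T)ᶜ ∩ (degenerateSet R V T)ᶜ) := by
  rw [Metric.tendstoLocallyUniformlyOn_iff]
  rintro ε hε E₀ ⟨hE₀, hF⟩
  obtain ⟨ζ, hζ, r, hr⟩ := exists_analytic_separated hE₀ hF
  obtain ⟨C, κ, hC, hκ0, hκ1, hbound⟩ := hζ.exists_sum_bound hA hF
    ((halfSets L).erase (indexZero L)) (fun I hI =>
      norm_prod_compl_lt (hζ.lists.ne_zero hA) hr.self_of_nhds.2
        (Finset.mem_of_mem_erase hI) (Finset.ne_of_mem_erase hI))
  refine ⟨{E | ∀ N : ℕ, dist ((-1) ^ L * qLow R V T E) (scaledDet R V T N E) ≤ C * κ ^ N}, ?_, ?_⟩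
  · apply nhdsWithin_le_nhds
    filter_upwards [hr, hζ.2, hζ.eventually_injective hF, hbound] with E h1 h2 h3 h4
    intro N
    have hq : qLow R V T E = qFun R V T (indexZero L) E fun i => ζ i E :=
      (symmetricOn_qFun (indexZero L) E).eq_of_separates (eig_spec R V T E).1 h2 h1.1 h1.2
    have hz : zPlus R V T E = ∏ i ∈ (indexZero L)ᶜ, ζ i E :=
      (symmetricOn_prod_compl (indexZero L)).eq_of_separates (eig_spec R V T E).1 h2 h1.1 h1.2
    have hnz : ∏ i ∈ (indexZero L)ᶜ, ζ i E ≠ 0 := hz ▸ zPlus_ne_zero hA E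
    have hexp : scaledDet R V T N E = (-1) ^ L * (qFun R V T (indexZero L) E (fun i => ζ i E) +
        ∑ I ∈ (halfSets L).erase (indexZero L),
          ((∏ i ∈ Iᶜ, ζ i E) / ∏ i ∈ (indexZero L)ᶜ, ζ i E) ^ N *
            qFun R V T I E (fun i => ζ i E)) := by
      rw [scaledDet, powerDet_eq_sum h2 h3, hz,
        ← Finset.add_sum_erase _ _ (indexZero_mem_halfSets L), mul_div_assoc, add_div,
        Finset.sum_div]
      congr 2
      · rw [mul_div_assoc, mul_div_cancel₀]
        exact pow_ne_zero _ hnz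
      · refine Finset.sum_congr rfl fun I _ => ?_
        rw [div_pow]; ring
    rw [hexp, hq, dist_comm, dist_eq_norm, mul_add, add_sub_cancel_left, norm_mul, norm_pow,
      norm_neg, norm_one, one_pow, one_mul]
    exact h4 N
  · have h0 : Tendsto (fun N : ℕ => C * κ ^ N) atTop (𝓝 0) := by
      simpa using (tendsto_pow_atTop_nhds_zero_of_lt_one hκ0 hκ1).const_mul C
    filter_upwards [h0.eventually_lt_const hε] with N hN E hE
    exact (hE N).trans_lt hN

/-- Off `Λ` the scaled determinants converge locally uniformly to `± q_{I₀}`. At degenerate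
energies, where the spectral expansion is not available, this follows from the maximum principle. -/
theorem exists_tendstoUniformlyOn_scaledDet (hA : IsUnit T ∧ IsUnit R)
    (hB : (degenerateSet R V T).Finite) {E₀ : ℂ} (hE₀ : E₀ ∉ lambdaSet R V T) :
    ∃ r > 0, Metric.closedBall E₀ r ⊆ (lambdaSet R V T)ᶜ ∧
      TendstoUniformlyOn (scaledDet R V T) (fun E => (-1) ^ L * qLow R V T E) atTop
        (Metric.closedBall E₀ r) := by
  have h1 : ∀ᶠ E in 𝓝 E₀, E ≠ E₀ → E ∉ degenerateSet R V T :=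
    eventually_nhdsWithin_iff.1 (eventually_notMem_of_finite hB E₀)
  have h2 : ∀ᶠ E in 𝓝 E₀, E ∉ lambdaSet R V T := isClosed_lambdaSet.isOpen_compl.mem_nhds hE₀
  obtain ⟨δ, hδ, hball⟩ := Metric.eventually_nhds_iff.1 (h1.and h2)
  have hlt : ∀ E ∈ Metric.closedBall E₀ (δ / 2), dist E E₀ < δ := fun E hE =>
    (Metric.mem_closedBall.1 hE).trans_lt (half_lt_self hδ)
  have hsub : Metric.closedBall E₀ (δ / 2) ⊆ (lambdaSet R V T)ᶜ := fun E hE =>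
    (hball (hlt E hE)).2
  refine ⟨δ / 2, half_pos hδ, hsub, ?_⟩
  -- The circle avoids the degenerate energies.
  have hsph : TendstoUniformlyOn (scaledDet R V T) (fun E => (-1) ^ L * qLow R V T E) atTop
      (Metric.sphere E₀ (δ / 2)) := by
    rw [← tendstoLocallyUniformlyOn_iff_tendstoUniformlyOn_of_compact (isCompact_sphere _ _)]
    refine (tendstoLocallyUniformlyOn_scaledDet hA).mono fun E hE => ?_
    have hE' := Metric.sphere_subset_closedBall hE
    refine ⟨hsub hE', (hball (hlt E hE')).1 ?_⟩
    rintro rfl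
    rw [Metric.mem_sphere, dist_self] at hE
    exact (half_pos hδ).ne hE
  rw [Metric.tendstoUniformlyOn_iff] at hsph ⊢
  intro ε hε
  filter_upwards [hsph (ε / 2) (half_pos hε)] with N hN E hE
  have hd : DifferentiableOn ℂ (fun E => (-1) ^ L * qLow R V T E - scaledDet R V T N E)
      (Metric.closedBall E₀ (δ / 2)) := fun E hE =>
    ((analyticAt_const.mul (analyticAt_qLow hB (hsub hE))).sub
      (analyticAt_scaledDet hA hB (hsub hE) N)).differentiableAt.differentiableWithinAt
  rw [dist_eq_norm]
  refine lt_of_le_of_lt ?_ (half_lt_self hε)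
  refine Complex.norm_le_of_forall_mem_frontier_norm_le
    (f := fun E => (-1) ^ L * qLow R V T E - scaledDet R V T N E)
    (U := Metric.ball E₀ (δ / 2)) Metric.isBounded_ball
    (hd.diffContOnCl_ball subset_rfl) ?_ ?_
  · intro E' hE'
    rw [frontier_ball E₀ (half_pos hδ).ne'] at hE'
    rw [← dist_eq_norm]
    exact (hN E' hE').le
  · rw [closure_ball E₀ (half_pos hδ).ne']
    exact hE

end OffLambda

/-! ### The frontiers of `int Λ` and of the zero set of `q_{I₀}` -/

/-- An open subset of the plane with finite frontier is empty or has finite complement, because the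
complement of a finite set is connected. -/
theorem eq_empty_or_finite_compl_of_finite_frontier {W : Set ℂ} (hW : IsOpen W)
    (hf : (frontier W).Finite) : W = ∅ ∨ Wᶜ.Finite := by
  have hconn : IsConnected (frontier W)ᶜ :=
    hf.countable.isConnected_compl_of_one_lt_rank (by simp)
  by_cases hne : ((frontier W)ᶜ ∩ W).Nonempty
  · right
    refine hf.subset ?_
    rw [Set.compl_subset_comm]
    apply hconn.isPreconnected.subset_left_of_subset_union hW isClosed_closure.isOpen_compl
      (Set.disjoint_compl_right_iff_subset.2 subset_closure) ?_ hne
    intro x hx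
    by_cases hxW : x ∈ W
    · exact Or.inl hxW
    · refine Or.inr fun hxc => hx ?_
      rw [hW.frontier_eq]
      exact ⟨hxc, hxW⟩
  · left
    rw [Set.eq_empty_iff_forall_notMem]
    intro x hx
    refine hne ⟨x, fun hxf => ?_, hx⟩
    rw [hW.frontier_eq] at hxf
    exact hxf.2 hx

theorem card_filter_perm_mem {ι : Type*} [Fintype ι] [DecidableEq ι] (σ : Equiv.Perm ι)
    (I : Finset ι) : (Finset.univ.filter fun i => σ i ∈ I).card = I.card := by
  have : (Finset.univ.filter fun i => σ i ∈ I) = I.map σ.symm.toEmbedding := by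
    ext i
    simp
  rw [this, Finset.card_map]

/-- If a circle encloses exactly `L` eigenvalues, these come first in every ordered listing. -/
theorem Separates.indexZero_of_isOrderedListing {L : ℕ}
    {A : Matrix (Fin L ⊕ Fin L) (Fin L ⊕ Fin L) ℂ} {z w : Fin (2 * L) → ℂ} {r : ℝ}
    {I : Finset (Fin (2 * L))} (hw : Separates r I w) (hI : I.card = L)
    (hwl : ListsEigenvalues A w) (hz : IsOrderedListing A z) :
    Separates r (indexZero L) z := by
  obtain ⟨σ, rfl⟩ := hwl.exists_perm hz.1
  have hmem : ∀ i, ‖(w ∘ σ) i‖ < r ↔ σ i ∈ I := fun i => hw.norm_lt_iff (σ i)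
  set J : Finset (Fin (2 * L)) := Finset.univ.filter fun i => σ i ∈ I with hJ
  have hJcard : J.card = L := by
    rw [hJ, card_filter_perm_mem, hI]
  have hsub : J ⊆ indexZero L := by
    intro i hi
    have hi' : σ i ∈ I := by simpa [hJ] using hi
    have h1 : Finset.Iic i ⊆ J := by
      intro j hj
      have := (hz.2 (Finset.mem_Iic.1 hj)).trans_lt ((hmem i).2 hi')
      simpa [hJ] using (hmem j).1 this
    have h2 := Finset.card_le_card h1
    rw [Fin.card_Iic, hJcard] at h2
    rw [mem_indexZero]; omega
  have hJeq : J = indexZero L := Finset.eq_of_subset_of_card_le hsub (by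
    rw [(Finset.mem_powersetCard.1 (indexZero_mem_halfSets L)).2, hJcard])
  intro i
  have h1 : i ∈ indexZero L ↔ σ i ∈ I := by rw [← hJeq]; simp [hJ]
  rw [h1]
  exact hw (σ i)

theorem card_indexZero : (indexZero L).card = L :=
  (Finset.mem_powersetCard.1 (indexZero_mem_halfSets L)).2

theorem qLow_eq_of_separates {E : ℂ} {w : Fin (2 * L) → ℂ} {r : ℝ} {I : Finset (Fin (2 * L))}
    (hw : Separates r I w) (hI : I.card = L) (hwl : ListsEigenvalues (transfer R V T E) w) :
    qLow R V T E = qFun R V T I E w := by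
  have h1 := hw.indexZero_of_isOrderedListing hI hwl (eig_spec R V T E)
  rw [qLow, qFun, qFun, (eig_spec R V T E).1.image_eq_of_separates hwl h1 hw]

section Middle

variable [NeZero L]

theorem midLow_mem : midLow L ∈ indexZero L := by
  have := NeZero.pos L
  rw [mem_indexZero]; simp only [midLow]; omega

theorem midHigh_notMem : midHigh L ∉ indexZero L := by
  rw [mem_indexZero]; simp [midHigh]

theorem mem_indexOne_iff {i : Fin (2 * L)} :
    i ∈ indexOne L ↔ (i ∈ indexZero L ∧ i ≠ midLow L) ∨ i = midHigh L := by
  have := NeZero.pos L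
  simp only [indexOne, Finset.mem_filter, Finset.mem_univ, true_and, mem_indexZero, midLow, midHigh,
    Fin.ext_iff, ne_eq]
  omega

theorem indexOne_eq : indexOne L = insert (midHigh L) ((indexZero L).erase (midLow L)) := by
  ext i
  rw [mem_indexOne_iff, Finset.mem_insert, Finset.mem_erase]
  tauto

theorem indexOne_mem_halfSets : indexOne L ∈ halfSets L := by
  rw [Finset.mem_powersetCard]
  refine ⟨Finset.subset_univ _, ?_⟩
  rw [indexOne_eq, Finset.card_insert_of_notMem, Finset.card_erase_of_mem midLow_mem,
    (Finset.mem_powersetCard.1 (indexZero_mem_halfSets L)).2]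
  · have := NeZero.pos L; omega
  · intro h
    exact midHigh_notMem (Finset.mem_of_mem_erase h)

/-- Apart from the two in the middle, the moduli of the values `w i` are strictly smaller than the
two in the middle for lower indices, and strictly larger for higher indices. -/
def MiddleIsolated (w : Fin (2 * L) → ℂ) : Prop :=
  (∀ i ∈ indexZero L, i ≠ midLow L → ‖w i‖ < ‖w (midLow L)‖ ∧ ‖w i‖ < ‖w (midHigh L)‖) ∧
    ∀ i ∉ indexZero L, i ≠ midHigh L → ‖w (midLow L)‖ < ‖w i‖ ∧ ‖w (midHigh L)‖ < ‖w i‖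

theorem OnlyMiddleEqual.middleIsolated {E : ℂ} (h : OnlyMiddleEqual R V T E)
    {z : Fin (2 * L) → ℂ} (hz : IsOrderedListing (transfer R V T E) z) :
    MiddleIsolated z ∧ ‖z (midLow L)‖ = ‖z (midHigh L)‖ := by
  have hn := hz.norm_eq (eig_spec R V T E)
  have hn' : ∀ i, ‖z i‖ = ‖eig R V T E i‖ := fun i => congrFun hn i
  obtain ⟨h1, h2, h3⟩ := h
  have hmid : ‖z (midLow L)‖ = ‖z (midHigh L)‖ := by rw [hn', hn', h2]
  refine ⟨⟨?_, ?_⟩, hmid⟩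
  · intro i hi hne
    rw [← hmid, and_self]
    rw [mem_indexZero] at hi
    have hne' : (i : ℕ) ≠ L - 1 := fun h => hne (Fin.ext h)
    have hj : L - 2 < 2 * L := by omega
    have h4 : ‖z i‖ ≤ ‖z ⟨L - 2, hj⟩‖ := hz.2 (Fin.le_def.2 (by simp only; omega))
    refine h4.trans_lt ?_
    rw [hn', hn']
    exact h1 _ (by simp only; omega)
  · intro i hi hne
    rw [hmid, and_self]
    rw [mem_indexZero] at hi
    have hne' : (i : ℕ) ≠ L := fun h => hne (Fin.ext h)
    have hj : L + 1 < 2 * L := by omega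
    have h4 : ‖z ⟨L + 1, hj⟩‖ ≤ ‖z i‖ := hz.2 (Fin.le_def.2 (by simp only; omega))
    refine lt_of_lt_of_le ?_ h4
    rw [hn', hn']
    exact h3 _ rfl

theorem MiddleIsolated.eventually {X : Type*} [TopologicalSpace X] {w : Fin (2 * L) → X → ℂ} {x : X}
    (hw : ∀ i, ContinuousAt (w i) x) (h : MiddleIsolated fun i => w i x) :
    ∀ᶠ y in 𝓝 x, MiddleIsolated fun i => w i y := by
  have hlt : ∀ i j, ‖w i x‖ < ‖w j x‖ → ∀ᶠ y in 𝓝 x, ‖w i y‖ < ‖w j y‖ := fun i j hij =>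
    (hw i).norm.eventually_lt (hw j).norm hij
  refine Filter.Eventually.and (Filter.eventually_all.2 fun i => ?_)
    (Filter.eventually_all.2 fun i => ?_)
  · by_cases hi : i ∈ indexZero L ∧ i ≠ midLow L
    · have := h.1 i hi.1 hi.2
      filter_upwards [hlt _ _ this.1, hlt _ _ this.2] with y h1 h2 _ _
      exact ⟨h1, h2⟩
    · exact Eventually.of_forall fun y h1 h2 => absurd ⟨h1, h2⟩ hi
  · by_cases hi : i ∉ indexZero L ∧ i ≠ midHigh L
    · have := h.2 i hi.1 hi.2
      filter_upwards [hlt _ _ this.1, hlt _ _ this.2] with y h1 h2 _ _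
      exact ⟨h1, h2⟩
    · exact Eventually.of_forall fun y h1 h2 => absurd ⟨h1, h2⟩ hi

theorem MiddleIsolated.separates_indexZero {w : Fin (2 * L) → ℂ} (h : MiddleIsolated w)
    (hlt : ‖w (midLow L)‖ < ‖w (midHigh L)‖) : ∃ r, Separates r (indexZero L) w := by
  obtain ⟨r, h1, h2⟩ := exists_between hlt
  refine ⟨r, fun i => ⟨fun hi => ?_, fun hi => ?_⟩⟩
  · by_cases hm : i = midLow L
    · rw [hm]; exact h1
    · exact (h.1 i hi hm).1.trans h1
  · by_cases hm : i = midHigh L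
    · rw [hm]; exact h2
    · exact h2.trans (h.2 i hi hm).2

theorem MiddleIsolated.separates_indexOne {w : Fin (2 * L) → ℂ} (h : MiddleIsolated w)
    (hlt : ‖w (midHigh L)‖ < ‖w (midLow L)‖) : ∃ r, Separates r (indexOne L) w := by
  obtain ⟨r, h1, h2⟩ := exists_between hlt
  refine ⟨r, fun i => ⟨fun hi => ?_, fun hi => ?_⟩⟩
  · rcases mem_indexOne_iff.1 hi with ⟨hi, hm⟩ | rfl
    · exact (h.1 i hi hm).2.trans h1
    · exact h1
  · rw [mem_indexOne_iff, not_or, not_and, not_not] at hi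
    by_cases hm : i ∈ indexZero L
    · rw [hi.1 hm]; exact h2
    · exact h2.trans (h.2 i hm hi.2).1

theorem notMem_lambdaSet_of_separates {E : ℂ} {w : Fin (2 * L) → ℂ} {r : ℝ}
    {I : Finset (Fin (2 * L))} (hw : Separates r I w) (hI : I.card = L)
    (hwl : ListsEigenvalues (transfer R V T E) w) : E ∉ lambdaSet R V T := by
  have := hw.indexZero_of_isOrderedListing hI hwl (eig_spec R V T E)
  exact (((this _).1 midLow_mem).trans ((this _).2 midHigh_notMem)).ne

theorem card_indexOne : (indexOne L).card = L :=
  (Finset.mem_powersetCard.1 indexOne_mem_halfSets).2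

/-- Near a good point, `Λ` is the set where the continuations of `z_L` and `z_{L+1}` have equal
modulus, although they need not be ordered by modulus. -/
theorem MiddleIsolated.mem_lambdaSet_iff {E : ℂ} {w : Fin (2 * L) → ℂ} (h : MiddleIsolated w)
    (hwl : ListsEigenvalues (transfer R V T E) w) :
    E ∈ lambdaSet R V T ↔ ‖w (midLow L)‖ = ‖w (midHigh L)‖ := by
  constructor
  · intro hE
    rcases lt_trichotomy ‖w (midLow L)‖ ‖w (midHigh L)‖ with hlt | heq | hlt
    · obtain ⟨r, hr⟩ := h.separates_indexZero hlt
      exact absurd hE (notMem_lambdaSet_of_separates hr card_indexZero hwl)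
    · exact heq
    · obtain ⟨r, hr⟩ := h.separates_indexOne hlt
      exact absurd hE (notMem_lambdaSet_of_separates hr card_indexOne hwl)
  · intro heq
    by_contra hE
    obtain ⟨r, hr⟩ := exists_separates hE
    have hr' := hr.self_of_nhds _ (eig_spec R V T E)
    obtain ⟨σ, rfl⟩ := (eig_spec R V T E).1.exists_perm hwl
    set I : Finset (Fin (2 * L)) := Finset.univ.filter fun i => σ i ∈ indexZero L with hI
    have hIc : I.card = L := by
      rw [hI, card_filter_perm_mem, card_indexZero]
    have hmem : ∀ i, i ∈ I ↔ ‖(eig R V T E ∘ σ) i‖ < r := by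
      intro i
      rw [hI, Finset.mem_filter, ← hr'.norm_lt_iff]
      simp
    -- The circle of radius `r` encloses both middle values, hence more than `L` values, or neither,
    -- hence fewer than `L`.
    by_cases hm : midLow L ∈ I
    · have hsub : insert (midHigh L) (indexZero L) ⊆ I := by
        intro i hi
        rw [hmem] at hm ⊢
        rcases Finset.mem_insert.1 hi with rfl | hi
        · rw [← heq]; exact hm
        · by_cases hil : i = midLow L
          · rw [hil]; exact hm
          · exact (h.1 i hi hil).1.trans hm
      have := Finset.card_le_card hsub
      rw [Finset.card_insert_of_notMem midHigh_notMem, card_indexZero, hIc] at this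
      omega
    · have hsub : I ⊆ (indexZero L).erase (midLow L) := by
        intro i hi
        have hil : i ≠ midLow L := by rintro rfl; exact hm hi
        refine Finset.mem_erase.2 ⟨hil, ?_⟩
        rw [hmem] at hm hi
        by_contra hi0
        by_cases hih : i = midHigh L
        · rw [hih, ← heq] at hi; exact hm hi
        · exact hm ((h.2 i hi0 hih).1.trans hi)
      have := Finset.card_le_card hsub
      rw [Finset.card_erase_of_mem midLow_mem, card_indexZero, hIc] at this
      have := NeZero.pos L
      omega

/-- Simplicity of the eigenvalues and isolation of the two in the middle are open conditions. -/
theorem exists_ball_middleIsolated {E₀ : ℂ} {ζ : Fin (2 * L) → ℂ → ℂ}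
    (hζ : IsAnalyticListing R V T E₀ ζ) (hF : E₀ ∉ degenerateSet R V T)
    (hm : MiddleIsolated fun i => ζ i E₀) :
    ∃ δ > 0, ∀ E ∈ Metric.ball E₀ δ, IsAnalyticListing R V T E ζ ∧
      E ∉ degenerateSet R V T ∧ MiddleIsolated fun i => ζ i E := by
  have h1 : ∀ᶠ E in 𝓝 E₀, E ∉ degenerateSet R V T := by
    filter_upwards [hζ.2, hζ.eventually_injective hF] with E h2 h3
    rintro ⟨μ, hμ⟩
    have hnd : (transfer R V T E).charpoly.roots.Nodup := by
      rw [← h2]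
      exact Multiset.Nodup.map h3 Finset.univ.nodup
    rw [Multiset.nodup_iff_count_le_one] at hnd
    have := hnd μ
    rw [Polynomial.count_roots] at this
    omega
  obtain ⟨δ, hδ, hball⟩ := Metric.eventually_nhds_iff.1 ((hζ.eventually.and h1).and
    (MiddleIsolated.eventually (fun i => (hζ.1 i).continuousAt) hm))
  exact ⟨δ, hδ, fun E hE => ⟨(hball hE).1.1, (hball hE).1.2, (hball hE).2⟩⟩

/-- At a good point of `Λ` the interior of `Λ` cannot end, by analytic continuation. -/
theorem frontier_interior_lambdaSet_subset (hA : IsUnit T ∧ IsUnit R) :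
    frontier (interior (lambdaSet R V T)) ⊆ degenerateSet R V T ∪
      {E ∈ frontier (lambdaSet R V T) | ¬ OnlyMiddleEqual R V T E} := by
  intro E₀ hE₀
  rw [isOpen_interior.frontier_eq] at hE₀
  obtain ⟨hcl, hint⟩ := hE₀
  have hΛ : E₀ ∈ lambdaSet R V T := by
    have := closure_mono (interior_subset (s := lambdaSet R V T)) hcl
    rwa [isClosed_lambdaSet.closure_eq] at this
  by_contra hcon
  rw [Set.mem_union, not_or] at hcon
  obtain ⟨hF, hM⟩ := hcon
  have hM' : OnlyMiddleEqual R V T E₀ := by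
    by_contra h
    exact hM ⟨⟨subset_closure hΛ, hint⟩, h⟩
  obtain ⟨ζ, hζ, hζ₀⟩ := exists_isAnalyticListing hF (eig_spec R V T E₀).1
  have hmi : MiddleIsolated fun i => ζ i E₀ := by
    simp_rw [hζ₀]
    exact (hM'.middleIsolated (eig_spec R V T E₀)).1
  obtain ⟨δ, hδ, hball⟩ := exists_ball_middleIsolated hζ hF hmi
  set f : ℂ → ℂ := fun E => ζ (midLow L) E / ζ (midHigh L) E with hf
  have hnz : ∀ E ∈ Metric.ball E₀ δ, ζ (midHigh L) E ≠ 0 := fun E hE =>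
    (hball E hE).1.lists.ne_zero hA _
  have hfan : AnalyticOnNhd ℂ f (Metric.ball E₀ δ) := fun E hE =>
    ((hball E hE).1.1 _).div ((hball E hE).1.1 _) (hnz E hE)
  have hfn : ∀ E ∈ Metric.ball E₀ δ, (E ∈ lambdaSet R V T ↔ ‖f E‖ = 1) := by
    intro E hE
    rw [(hball E hE).2.2.mem_lambdaSet_iff (hball E hE).1.lists, hf, norm_div,
      div_eq_one_iff_eq (norm_ne_zero_iff.2 (hnz E hE))]
  obtain ⟨E₁, hE₁W, hE₁B⟩ : ∃ E₁ ∈ interior (lambdaSet R V T), E₁ ∈ Metric.ball E₀ δ := by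
    obtain ⟨E₁, h1, h2⟩ := Metric.mem_closure_iff.1 hcl δ hδ
    exact ⟨E₁, h1, by rwa [Metric.mem_ball, dist_comm]⟩
  have hev : ∀ᶠ E in 𝓝 E₁, ‖f E‖ = 1 := by
    filter_upwards [isOpen_interior.mem_nhds hE₁W, Metric.isOpen_ball.mem_nhds hE₁B] with E h1 h2
    exact (hfn E h2).1 (interior_subset h1)
  -- By the maximum principle a quotient of constant modulus is constant.
  have hconst : ∀ᶠ E in 𝓝 E₁, f E = f E₁ := by
    apply Complex.eventually_eq_of_isLocalMax_norm
    · filter_upwards [Metric.isOpen_ball.mem_nhds hE₁B] with E hE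
      exact (hfan E hE).differentiableAt
    · filter_upwards [hev] with E hE
      simp only [Function.comp]
      rw [hE, hev.self_of_nhds]
  have heq := hfan.eqOn_of_preconnected_of_eventuallyEq (analyticOnNhd_const (v := f E₁))
    (convex_ball E₀ δ).isPreconnected hE₁B hconst
  apply hint
  rw [mem_interior]
  refine ⟨Metric.ball E₀ δ, fun E hE => ?_, Metric.isOpen_ball, Metric.mem_ball_self hδ⟩
  rw [hfn E hE, heq hE]
  exact hev.self_of_nhds

variable (R V T) in
/-- The open set of energies off `Λ` near which `q_{I₀}` vanishes identically. -/
def vanishingSet : Set ℂ := {E | E ∉ lambdaSet R V T ∧ ∀ᶠ E' in 𝓝 E, qLow R V T E' = 0}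

theorem isOpen_vanishingSet : IsOpen (vanishingSet R V T) := by
  rw [isOpen_iff_mem_nhds]
  rintro E ⟨h1, h2⟩
  filter_upwards [isClosed_lambdaSet.isOpen_compl.mem_nhds h1, h2.eventually_nhds] with E' h3 h4
  exact ⟨h3, h4⟩

/-- At a good point of `Λ` the function `q_{I₀}` is not identically zero on any side, as it is there
one of the two germs that do not vanish by `hD`. -/
theorem frontier_vanishingSet_subset (hB : (degenerateSet R V T).Finite)
    (hfr : frontier (lambdaSet R V T) = lambdaSet R V T)
    (hD : ∀ E ∈ frontier (lambdaSet R V T) \ degenerateSet R V T, QNotLocallyZero R V T E) :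
    frontier (vanishingSet R V T) ⊆ degenerateSet R V T ∪
      {E ∈ frontier (lambdaSet R V T) | ¬ OnlyMiddleEqual R V T E} := by
  intro E₀ hE₀
  rw [isOpen_vanishingSet.frontier_eq] at hE₀
  obtain ⟨hcl, hnot⟩ := hE₀
  by_cases hΛ : E₀ ∈ lambdaSet R V T
  swap
  · -- Off `Λ` this is the identity theorem.
    exfalso
    apply hnot
    refine ⟨hΛ, ?_⟩
    by_contra hne
    have h1 : ∀ᶠ E in 𝓝[≠] E₀, qLow R V T E ≠ 0 := by
      rcases (analyticAt_qLow hB hΛ).eventually_eq_zero_or_eventually_ne_zero with h | h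
      · exact absurd h hne
      · exact h
    have h2 : ∀ᶠ E in 𝓝 E₀, E ≠ E₀ → qLow R V T E ≠ 0 := eventually_nhdsWithin_iff.1 h1
    obtain ⟨E₁, h3, h4⟩ := ((mem_closure_iff_frequently.1 hcl).and_eventually h2).exists
    have h5 : E₁ ≠ E₀ := by
      rintro rfl
      exact hnot h3
    exact h4 h5 h3.2.self_of_nhds
  by_contra hcon
  rw [Set.mem_union, not_or] at hcon
  obtain ⟨hF, hM⟩ := hcon
  have hΛf : E₀ ∈ frontier (lambdaSet R V T) := hfr.symm ▸ hΛ
  have hM' : OnlyMiddleEqual R V T E₀ := by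
    by_contra h
    exact hM ⟨hΛf, h⟩
  obtain ⟨z, hz, hq⟩ := hD E₀ ⟨hΛf, hF⟩
  obtain ⟨ζ, hζ, hζ₀⟩ := exists_isAnalyticListing hF hz.1
  obtain ⟨hq0, hq1⟩ := hq ζ hζ hζ₀
  have hmi : MiddleIsolated fun i => ζ i E₀ := by
    simp_rw [hζ₀]
    exact (hM'.middleIsolated hz).1
  obtain ⟨δ, hδ, hball⟩ := exists_ball_middleIsolated hζ hF hmi
  obtain ⟨E₁, hE₁Z, hE₁B⟩ : ∃ E₁ ∈ vanishingSet R V T, E₁ ∈ Metric.ball E₀ δ := by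
    obtain ⟨E₁, h1, h2⟩ := Metric.mem_closure_iff.1 hcl δ hδ
    exact ⟨E₁, h1, by rwa [Metric.mem_ball, dist_comm]⟩
  -- Near `E₁` the function `qLow` is `q_I` for an analytic labelling, with `I` one of `I₀`, `I₁`;
  -- so this `q_I` vanishes on the ball.
  have key : ∀ I : Finset (Fin (2 * L)),
      (∀ᶠ E in 𝓝 E₁, qLow R V T E = qFun R V T I E fun i => ζ i E) →
      ¬ ∃ᶠ E in 𝓝 E₀, qFun R V T I E (fun i => ζ i E) ≠ 0 := by
    intro I hI hfreq
    have han : AnalyticOnNhd ℂ (fun E => qFun R V T I E fun i => ζ i E) (Metric.ball E₀ δ) :=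
      fun E hE => (hball E hE).1.analyticAt_qFun (hball E hE).2.1 I
    have hzero : (fun E => qFun R V T I E fun i => ζ i E) =ᶠ[𝓝 E₁] fun _ => 0 := by
      filter_upwards [hI, hE₁Z.2] with E h1 h2
      rw [← h1, h2]
    have heq := han.eqOn_of_preconnected_of_eventuallyEq (analyticOnNhd_const (v := 0))
      (convex_ball E₀ δ).isPreconnected hE₁B hzero
    refine hfreq ?_
    filter_upwards [Metric.ball_mem_nhds E₀ hδ] with E hE
    exact not_not.2 (heq hE)
  have hmid : ‖ζ (midLow L) E₁‖ ≠ ‖ζ (midHigh L) E₁‖ := fun h =>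
    hE₁Z.1 (((hball E₁ hE₁B).2.2.mem_lambdaSet_iff (hball E₁ hE₁B).1.lists).2 h)
  have hc : ∀ i, ContinuousAt (fun E => ‖ζ i E‖) E₁ := fun i =>
    ((hball E₁ hE₁B).1.1 i).continuousAt.norm
  rcases lt_or_gt_of_ne hmid with hlt | hlt
  · refine key (indexZero L) ?_ hq0
    filter_upwards [(hc _).eventually_lt (hc _) hlt, Metric.isOpen_ball.mem_nhds hE₁B] with E h1 h2
    obtain ⟨r, hr⟩ := (hball E h2).2.2.separates_indexZero h1
    exact qLow_eq_of_separates hr card_indexZero (hball E h2).1.lists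
  · refine key (indexOne L) ?_ hq1
    filter_upwards [(hc _).eventually_lt (hc _) hlt, Metric.isOpen_ball.mem_nhds hE₁B] with E h1 h2
    obtain ⟨r, hr⟩ := (hball E h2).2.2.separates_indexOne h1
    exact qLow_eq_of_separates hr card_indexOne (hball E h2).1.lists

end Middle

/-! ### The behaviour at infinity -/

open Bornology

section Infinity

variable (T) in
/-- The limit of `E⁻¹ • transfer R V T E` as `E → ∞`. -/
noncomputable def transferLimit : Matrix (Fin L ⊕ Fin L) (Fin L ⊕ Fin L) ℂ :=
  fromBlocks T⁻¹ 0 0 0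

theorem tendsto_inv_smul_transfer :
    Tendsto (fun E => E⁻¹ • transfer R V T E) (cobounded ℂ) (𝓝 (transferLimit T)) := by
  have h1 : Tendsto (fun E : ℂ => E⁻¹ • fromBlocks (-V * T⁻¹) (-R) T⁻¹ 0 + transferLimit T)
      (cobounded ℂ) (𝓝 (transferLimit T)) := by
    have := ((tendsto_inv₀_cobounded (α := ℂ)).smul_const
      (fromBlocks (-V * T⁻¹) (-R) T⁻¹ 0)).add_const (transferLimit T)
    rwa [zero_smul, zero_add] at this
  refine h1.congr' ?_
  filter_upwards [eventually_ne_cobounded 0] with E hE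
  rw [transfer_eq_add_smul, smul_add, smul_smul, inv_mul_cancel₀ hE, one_smul, transferLimit]

theorem IsOrderedListing.smul {A : Matrix (Fin L ⊕ Fin L) (Fin L ⊕ Fin L) ℂ}
    {z : Fin (2 * L) → ℂ} (h : IsOrderedListing A z) {c : ℂ} (hc : c ≠ 0) :
    IsOrderedListing (c • A) fun i => c * z i := by
  refine ⟨?_, ?_⟩
  · rw [listsEigenvalues_iff]
    intro x
    have h1 : scalar (Fin L ⊕ Fin L) x - c • A = c • (scalar (Fin L ⊕ Fin L) (c⁻¹ * x) - A) := by
      rw [smul_sub]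
      congr 1
      ext i j
      simp only [scalar_apply, Matrix.smul_apply, diagonal_apply, smul_eq_mul]
      split_ifs
      · field_simp
      · simp
    have h2 : ∀ i, x - c * z i = c * (c⁻¹ * x - z i) := by
      intro i; field_simp
    rw [h1, det_smul, listsEigenvalues_iff.1 h.1]
    simp_rw [h2]
    rw [Finset.prod_mul_distrib, Finset.prod_const, Finset.card_univ]
    simp [two_mul]
  · intro i j hij
    simp only [norm_mul]
    exact mul_le_mul_of_nonneg_left (h.2 hij) (norm_nonneg c)

theorem IsEigenbasis.smul {n ι : Type*} [Fintype n] [DecidableEq n] [Fintype ι] [DecidableEq ι]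
    {A : Matrix n n ℂ} {z : ι → ℂ} {U : Matrix n ι ℂ} {W : Matrix ι n ℂ}
    (h : IsEigenbasis A z U W) (c : ℂ) : IsEigenbasis (c • A) (fun i => c * z i) U W := by
  refine ⟨h.mul_eq_one, h.mul_eq_one', ?_⟩
  conv_lhs => rw [h.eq]
  have : diagonal (fun i => c * z i) = c • diagonal z := by
    rw [← diagonal_smul]; rfl
  rw [this, Matrix.mul_smul, Matrix.smul_mul]

theorem charpoly_transferLimit :
    (transferLimit T).charpoly = T⁻¹.charpoly * Polynomial.X ^ L := by
  rw [transferLimit, charpoly_fromBlocks_zero₁₂, charpoly_zero, Fintype.card_fin]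

theorem eval_zero_charpoly_inv_ne_zero (hT : IsUnit T) : T⁻¹.charpoly.eval 0 ≠ 0 := by
  have h1 : IsUnit T⁻¹.det := (Matrix.isUnit_iff_isUnit_det _).1 (by
    rw [Matrix.isUnit_nonsing_inv_iff]; exact hT)
  rw [Matrix.eval_charpoly, map_zero, zero_sub, det_neg]
  exact mul_ne_zero (pow_ne_zero _ (by simp)) h1.ne_zero

theorem zero_mem_roots_transferLimit [NeZero L] : (0 : ℂ) ∈ (transferLimit T).charpoly.roots := by
  rw [Polynomial.mem_roots (charpoly_monic _).ne_zero, charpoly_transferLimit,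
    Polynomial.IsRoot.def]
  simp [NeZero.ne L]

/-- The limit matrix has the eigenvalue `0` with multiplicity `L`, and `L` nonzero eigenvalues. -/
theorem separates_transferLimit [NeZero L] (hT : IsUnit T) {z : Fin (2 * L) → ℂ}
    (hz : IsOrderedListing (transferLimit T) z) :
    Separates (sepRadius (transferLimit T)) (indexZero L) z ∧ ∀ i, z i = 0 ↔ i ∈ indexZero L := by
  set r := sepRadius (transferLimit T) with hr
  have hr0 : 0 < r := sepRadius_pos _
  set I : Finset (Fin (2 * L)) := Finset.univ.filter fun i => z i = 0 with hI
  have hsep : Separates r I z := by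
    intro i
    constructor
    · intro hi
      have : z i = 0 := by simpa [hI] using hi
      rw [this, norm_zero]; exact hr0
    · intro hi
      have : z i ≠ 0 := by simpa [hI] using hi
      have h1 := two_mul_sepRadius_le (transferLimit T) ((hz.1.mem_roots_iff _).2 ⟨i, rfl⟩)
        zero_mem_roots_transferLimit this
      rw [dist_zero_right] at h1
      linarith
  have hcard : I.card = L := by
    have h1 : (transferLimit T).charpoly.roots.count 0 = L := by
      rw [Polynomial.count_roots, charpoly_transferLimit, Polynomial.rootMultiplicity_mul]
      · have h2 : T⁻¹.charpoly.rootMultiplicity 0 = 0 :=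
          Polynomial.rootMultiplicity_eq_zero (eval_zero_charpoly_inv_ne_zero hT)
        have h3 : (Polynomial.X ^ L : Polynomial ℂ).rootMultiplicity 0 = L := by
          have := Polynomial.rootMultiplicity_X_sub_C_pow (0 : ℂ) L
          rwa [Polynomial.C_0, sub_zero] at this
        rw [h2, h3, zero_add]
      · exact mul_ne_zero (charpoly_monic _).ne_zero (pow_ne_zero _ Polynomial.X_ne_zero)
    rw [← hz.1, Multiset.count_map] at h1
    rw [hI]
    conv_rhs => rw [← h1]
    simp only [Finset.card, Finset.filter_val, eq_comm]
  have h1 := hsep.indexZero_of_isOrderedListing hcard hz.1 hz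
  refine ⟨h1, fun i => ?_⟩
  rw [← h1.norm_lt_iff, hsep.norm_lt_iff]
  simp [hI]

/-- The generalized eigenspace of the limit matrix at `0` is spanned by the lower components. -/
theorem contourProjection_transferLimit_toBlocks₁₁ [NeZero L] (hT : IsUnit T) :
    (contourProjection (transferLimit T) {0} (transferLimit T)).toBlocks₁₁ = 0 := by
  set r := sepRadius (transferLimit T) with hr
  have hr0 : 0 < r := sepRadius_pos _
  have hdet : ∀ w ∈ Metric.closedBall (0 : ℂ) r,
      (w • (1 : Matrix (Fin L) (Fin L) ℂ) - T⁻¹).det ≠ 0 := by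
    intro w hw h0
    have h1 : T⁻¹.charpoly.eval w = 0 := by
      rw [Matrix.eval_charpoly, ← h0, Matrix.scalar_apply, smul_one_eq_diagonal]
    have hw0 : w ≠ 0 := by
      rintro rfl
      exact eval_zero_charpoly_inv_ne_zero hT h1
    have h2 : w ∈ (transferLimit T).charpoly.roots := by
      rw [Polynomial.mem_roots (charpoly_monic _).ne_zero, charpoly_transferLimit,
        Polynomial.IsRoot.def, Polynomial.eval_mul, h1, zero_mul]
    have h3 := two_mul_sepRadius_le (transferLimit T) h2 zero_mem_roots_transferLimit hw0
    have h4 := Metric.mem_closedBall.1 hw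
    linarith
  have hint : ∀ i j, (∮ w in C(0, r), (w • (1 : Matrix (Fin L ⊕ Fin L) (Fin L ⊕ Fin L) ℂ) -
      transferLimit T)⁻¹ (Sum.inl i) (Sum.inl j)) = 0 := by
    intro i j
    have h1 : (∮ w in C(0, r), (w • (1 : Matrix (Fin L ⊕ Fin L) (Fin L ⊕ Fin L) ℂ) -
        transferLimit T)⁻¹ (Sum.inl i) (Sum.inl j)) =
        ∮ w in C(0, r), (w • (1 : Matrix (Fin L) (Fin L) ℂ) - T⁻¹)⁻¹ i j := by
      refine circleIntegral.integral_congr hr0.le fun w hw => ?_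
      have hw0 : w ≠ 0 := by
        rintro rfl
        rw [Metric.mem_sphere, dist_self] at hw
        exact hr0.ne hw
      have hu : IsUnit (w • (1 : Matrix (Fin L) (Fin L) ℂ) - T⁻¹).det :=
        isUnit_iff_ne_zero.2 (hdet w (Metric.sphere_subset_closedBall hw))
      have hM : w • (1 : Matrix (Fin L ⊕ Fin L) (Fin L ⊕ Fin L) ℂ) - transferLimit T =
          fromBlocks (w • 1 - T⁻¹) 0 0 (w • 1) := by
        rw [sub_eq_iff_eq_add, transferLimit, fromBlocks_add, ← fromBlocks_one, fromBlocks_smul]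
        simp
      have hinv : (w • (1 : Matrix (Fin L ⊕ Fin L) (Fin L ⊕ Fin L) ℂ) - transferLimit T)⁻¹ =
          fromBlocks (w • 1 - T⁻¹)⁻¹ 0 0 (w⁻¹ • 1) := by
        apply Matrix.inv_eq_right_inv
        rw [hM, fromBlocks_multiply, Matrix.mul_nonsing_inv _ hu]
        simp [smul_smul, inv_mul_cancel₀ hw0]
      rw [hinv]
      rfl
    rw [h1]
    have hd : DifferentiableOn ℂ (fun w : ℂ => (w • (1 : Matrix (Fin L) (Fin L) ℂ) - T⁻¹)⁻¹ i j)
        (Metric.closedBall 0 r) := by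
      intro w hw
      have h2 : ∀ a b, AnalyticAt ℂ
          (fun w : ℂ => (w • (1 : Matrix (Fin L) (Fin L) ℂ) - T⁻¹) a b) w := by
        intro a b
        simp only [Matrix.sub_apply, Matrix.smul_apply, smul_eq_mul]
        fun_prop
      have h3 : (fun w : ℂ => (w • (1 : Matrix (Fin L) (Fin L) ℂ) - T⁻¹)⁻¹ i j) = fun w =>
          (w • (1 : Matrix (Fin L) (Fin L) ℂ) - T⁻¹).det⁻¹ *
            (w • (1 : Matrix (Fin L) (Fin L) ℂ) - T⁻¹).adjugate i j := by
        funext w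
        rw [Matrix.inv_def (w • 1 - T⁻¹), Ring.inverse_eq_inv', Matrix.smul_apply, smul_eq_mul]
      rw [h3]
      exact (((analyticAt_det h2).inv (hdet w hw)).mul
        (analyticAt_adjugate h2 i j)).differentiableAt.differentiableWithinAt
    exact (hd.diffContOnCl_ball subset_rfl).circleIntegral_eq_zero hr0.le
  ext i j
  simp only [contourProjection, toBlocks₁₁, Matrix.of_apply, Matrix.zero_apply]
  refine Finset.sum_eq_zero fun μ hμ => ?_
  have : μ = 0 := Finset.mem_singleton.1 (Finset.mem_inter.1 hμ).2
  rw [this, hint, mul_zero]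

/-- The contribution of the `L` large eigenvalues to the lower left block of the transfer matrix is
governed by the upper left block of their spectral projection. -/
theorem prod_mul_qFun_eq {E : ℂ} {z : Fin (2 * L) → ℂ}
    {U : Matrix (Fin L ⊕ Fin L) (Fin (2 * L)) ℂ} {W : Matrix (Fin (2 * L)) (Fin L ⊕ Fin L) ℂ}
    (hz : ListsEigenvalues (transfer R V T E) z) (hinj : Function.Injective z)
    (hU : IsEigenbasis (transfer R V T E) z U W) {I : Finset (Fin (2 * L))}
    (hI : I ∈ halfSets L) :
    (∏ i ∈ Iᶜ, z i) * ((-1) ^ L * qFun R V T I E z) =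
      T⁻¹.det * (1 - (U * diagonal (ind I) * W).toBlocks₁₁).det := by
  have h1 : (transfer R V T E * (U * diagonal (ind Iᶜ) * W)).toBlocks₂₁ =
      T⁻¹ * (1 - (U * diagonal (ind I) * W).toBlocks₁₁) := by
    rw [conj_ind_compl hU.mul_eq_one]
    conv_lhs => rw [← fromBlocks_toBlocks (1 - U * diagonal (ind I) * W)]
    rw [transfer, fromBlocks_multiply, toBlocks_fromBlocks₂₁, Matrix.zero_mul, add_zero]
    congr 1
    ext i j
    simp [toBlocks₁₁, Matrix.one_apply]
  rw [← det_mul, ← h1, hU.mul_conj, det_toBlocks₂₁_conj, Fintype.card_fin,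
    Finset.sum_eq_single Iᶜ]
  · rw [qFun_eq_of_isEigenbasis hz hinj hU, det_toBlocks₂₁_conj_compl hU.mul_eq_one]
    congr 1
    refine Finset.prod_congr rfl fun i hi => ?_
    simp [ind, Finset.mem_compl.1 hi]
  · intro J hJ hne
    have : ∃ i ∈ J, i ∉ Iᶜ := by
      by_contra! hc
      exact hne (Finset.eq_of_subset_of_card_le hc (by
        rw [(Finset.mem_powersetCard.1 hJ).2,
          (Finset.mem_powersetCard.1 (mem_halfSets_compl hI)).2]))
    obtain ⟨i, hi, hi'⟩ := this
    rw [Finset.prod_eq_zero hi, zero_mul]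
    rw [ind, if_neg hi', mul_zero]
  · intro h
    exact absurd (mem_halfSets_compl hI) h

/-- Near infinity the transfer matrix has `L` eigenvalues of order `E` and `L` of order `E⁻¹`, and
`q_{I₀}` does not vanish. -/
theorem eventually_cobounded_notMem_and_qLow_ne_zero [NeZero L] (hT : IsUnit T) :
    ∀ᶠ E in cobounded ℂ, E ∉ lambdaSet R V T ∧ (E ∉ degenerateSet R V T → qLow R V T E ≠ 0) := by
  obtain ⟨z₀, hz₀⟩ := exists_isOrderedListing (transferLimit T)
  have hsep₀ := (separates_transferLimit hT hz₀).1
  have hlist : ∀ᶠ E in cobounded ℂ, IsOrderedListing (E⁻¹ • transfer R V T E)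
      (fun i => E⁻¹ * eig R V T E i) := by
    filter_upwards [eventually_ne_cobounded 0] with E hE
    exact (eig_spec R V T E).smul (inv_ne_zero hE)
  have hnorm := fun i => tendsto_norm_of_isOrderedListing
    (tendsto_inv_smul_transfer (R := R) (V := V) (T := T)) hlist hz₀ i
  have hnear := eventually_exists_isOrderedListing_near
    (tendsto_inv_smul_transfer (R := R) (V := V) (T := T)) hlist
    (sepRadius_pos (transferLimit T))
  have hdet : ∀ᶠ E in cobounded ℂ, (1 - (contourProjection (transferLimit T) {0}
      (E⁻¹ • transfer R V T E)).toBlocks₁₁).det ≠ 0 := by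
    have h1 : Continuous fun M : Matrix (Fin L ⊕ Fin L) (Fin L ⊕ Fin L) ℂ =>
        (1 - M.toBlocks₁₁).det := by
      unfold toBlocks₁₁
      fun_prop
    have h2 : Tendsto (fun E => (1 - (contourProjection (transferLimit T) {0}
        (E⁻¹ • transfer R V T E)).toBlocks₁₁).det) (cobounded ℂ)
        (𝓝 (1 - (contourProjection (transferLimit T) {0} (transferLimit T)).toBlocks₁₁).det) :=
      ((h1.tendsto _).comp (continuousAt_contourProjection (transferLimit T) {0})).comp
        tendsto_inv_smul_transfer
    rw [contourProjection_transferLimit_toBlocks₁₁ hT, sub_zero, det_one] at h2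
    exact h2.eventually_ne one_ne_zero
  filter_upwards [hnear, hdet, eventually_ne_cobounded 0,
    (hnorm (midLow L)).eventually_lt_const ((hsep₀ _).1 midLow_mem),
    (hnorm (midHigh L)).eventually_const_lt ((hsep₀ _).2 midHigh_notMem)] with E h1 h2 h3 h4 h5
  refine ⟨fun hE => ?_, fun hF => ?_⟩
  · have h6 : ‖eig R V T E (midLow L)‖ = ‖eig R V T E (midHigh L)‖ := hE
    rw [norm_mul] at h4 h5
    rw [h6] at h4
    exact absurd h5 (not_lt.2 h4.le)
  · have hinj := injective_of_notMem_degenerateSet hF (eig_spec R V T E).1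
    obtain ⟨U, W, hU⟩ := exists_isEigenbasis (eig_spec R V T E).1 hinj
    obtain ⟨y, hy, hclose⟩ := h1
    have h6 := contourProjection_eq hy.1 (hU.smul E⁻¹) hclose {0}
    have h7 : (fun k => if y k ∈ ({0} : Finset ℂ) then (1 : ℂ) else 0) = ind (indexZero L) := by
      ext k
      simp [ind, (separates_transferLimit hT hy).2 k]
    rw [h7] at h6
    rw [h6] at h2
    have h8 := prod_mul_qFun_eq (eig_spec R V T E).1 hinj hU (indexZero_mem_halfSets L)
    have h9 : T⁻¹.det ≠ 0 := ((Matrix.isUnit_iff_isUnit_det _).1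
      (Matrix.isUnit_nonsing_inv_iff.2 hT)).ne_zero
    intro h0
    rw [qLow] at h0
    rw [h0, mul_zero, mul_zero] at h8
    exact mul_ne_zero h9 h2 h8.symm

end Infinity

section Consequences

variable [NeZero L]

theorem not_finite_compl_of_eventually_cobounded {W F : Set ℂ} (hF : F.Finite)
    (h : ∀ᶠ E in cobounded ℂ, E ∉ F → E ∉ W) : ¬ Wᶜ.Finite := by
  intro hW
  have h1 : ∀ᶠ E in cobounded ℂ, E ∉ Wᶜ := isBounded_def.1 hW.isBounded
  have h2 : ∀ᶠ E in cobounded ℂ, E ∉ F := isBounded_def.1 hF.isBounded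
  obtain ⟨E, h3, h4, h5⟩ := (h.and (h1.and h2)).exists
  exact h4 (h3 h5)

/-- `Λ` is closed with empty interior. -/
theorem frontier_lambdaSet_eq (hA : IsUnit T ∧ IsUnit R) (hB : (degenerateSet R V T).Finite)
    (hC : {E ∈ frontier (lambdaSet R V T) | ¬ OnlyMiddleEqual R V T E}.Finite) :
    frontier (lambdaSet R V T) = lambdaSet R V T := by
  have hint : interior (lambdaSet R V T) = ∅ := by
    rcases eq_empty_or_finite_compl_of_finite_frontier isOpen_interior
      ((hB.union hC).subset (frontier_interior_lambdaSet_subset hA)) with h | h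
    · exact h
    · refine absurd h (not_finite_compl_of_eventually_cobounded hB ?_)
      filter_upwards [eventually_cobounded_notMem_and_qLow_ne_zero (R := R) (V := V) hA.1]
        with E hE _ hE'
      exact hE.1 (interior_subset hE')
  rw [frontier, hint, Set.sdiff_empty, isClosed_lambdaSet.closure_eq]

theorem vanishingSet_eq_empty (hA : IsUnit T ∧ IsUnit R) (hB : (degenerateSet R V T).Finite)
    (hC : {E ∈ frontier (lambdaSet R V T) | ¬ OnlyMiddleEqual R V T E}.Finite)
    (hD : ∀ E ∈ frontier (lambdaSet R V T) \ degenerateSet R V T, QNotLocallyZero R V T E) :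
    vanishingSet R V T = ∅ := by
  rcases eq_empty_or_finite_compl_of_finite_frontier isOpen_vanishingSet
    ((hB.union hC).subset (frontier_vanishingSet_subset hB (frontier_lambdaSet_eq hA hB hC) hD))
    with h | h
  · exact h
  · refine absurd h (not_finite_compl_of_eventually_cobounded hB ?_)
    filter_upwards [eventually_cobounded_notMem_and_qLow_ne_zero (R := R) (V := V) hA.1]
      with E hE hF hE'
    exact hE.2 hF hE'.2.self_of_nhds

end Consequences

/-! ### `Λ` has no isolated points, and zeros of a sum of two exponentials -/

section Perfect

/-- The product `∏ (1 - c (z_i / z_j)^k)` over the pairs of indices `i ≤ L` and `j > L`. -/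
noncomputable def crossProduct (L k : ℕ) (c : ℂ) (z : Fin (2 * L) → ℂ) : ℂ :=
  ∏ i ∈ indexZero L, ∏ j ∈ (indexZero L)ᶜ, (1 - c * (z i / z j) ^ k)

theorem symmetricOn_crossProduct (k : ℕ) (c : ℂ) :
    SymmetricOn (indexZero L) (crossProduct L k c) := by
  intro z σ hσ
  have hprod : ∀ (I : Finset (Fin (2 * L))) (g : Fin (2 * L) → ℂ), (∀ i, σ i ∈ I ↔ i ∈ I) →
      ∏ i ∈ I, g (σ i) = ∏ i ∈ I, g i := by
    intro I g hI
    exact Finset.prod_equiv σ (fun i => (hI i).symm) fun _ _ => rfl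
  have hσ' : ∀ i, σ i ∈ (indexZero L)ᶜ ↔ i ∈ (indexZero L)ᶜ := fun i => by
    rw [Finset.mem_compl, Finset.mem_compl, hσ]
  simp only [crossProduct, Function.comp]
  rw [hprod (indexZero L)
    (fun i => ∏ j ∈ (indexZero L)ᶜ, (1 - c * (z i / z (σ j)) ^ k)) hσ]
  exact Finset.prod_congr rfl fun i _ =>
    hprod (indexZero L)ᶜ (fun j => 1 - c * (z i / z j) ^ k) hσ'

theorem norm_crossProduct_sub_one_le {k : ℕ} {c : ℂ} (hc : ‖c‖ = 1) {z : Fin (2 * L) → ℂ} {ρ : ℝ}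
    (hz : ∀ i ∈ indexZero L, ∀ j ∈ (indexZero L)ᶜ, ‖z i / z j‖ ≤ ρ) :
    ‖crossProduct L k c z - 1‖ ≤
      Real.exp ((indexZero L ×ˢ (indexZero L)ᶜ).card * ρ ^ k) - 1 := by
  have h1 : crossProduct L k c z =
      ∏ p ∈ indexZero L ×ˢ (indexZero L)ᶜ, (1 + -(c * (z p.1 / z p.2) ^ k)) := by
    rw [crossProduct, Finset.prod_product]
    simp only [sub_eq_add_neg]
  rw [h1]
  refine (Finset.norm_prod_one_add_sub_one_le _ _).trans ?_
  gcongr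
  rw [← nsmul_eq_mul]
  refine Finset.sum_le_card_nsmul _ _ _ fun p hp => ?_
  rw [Finset.mem_product] at hp
  rw [norm_neg, norm_mul, hc, one_mul, norm_pow]
  exact pow_le_pow_left₀ (norm_nonneg _) (hz _ hp.1 _ hp.2) k

variable [NeZero L]

theorem norm_div_le_of_monotone {z : Fin (2 * L) → ℂ} (hz : Monotone fun i => ‖z i‖)
    (h0 : ∀ i, z i ≠ 0) {i j : Fin (2 * L)} (hi : i ∈ indexZero L) (hj : j ∈ (indexZero L)ᶜ) :
    ‖z i / z j‖ ≤ ‖z (midLow L)‖ / ‖z (midHigh L)‖ := by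
  rw [Finset.mem_compl, mem_indexZero] at hj
  rw [mem_indexZero] at hi
  rw [norm_div]
  have h1 : ‖z i‖ ≤ ‖z (midLow L)‖ := hz (Fin.le_def.2 (by simp only [midLow]; omega))
  have h2 : ‖z (midHigh L)‖ ≤ ‖z j‖ := hz (Fin.le_def.2 (by simp only [midHigh]; omega))
  exact div_le_div₀ (norm_nonneg _) h1 (norm_pos_iff.2 (h0 _)) h2

/-- `Λ` has no isolated points. Otherwise all products `crossProduct L k c` would be holomorphic
near the point and close to `1` on a circle around it for large `k`, hence also inside; but for a
suitable `c` of modulus one the product has the limit `0` at the centre along a sequence. -/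
theorem frequently_mem_lambdaSet (hA : IsUnit T ∧ IsUnit R) (hB : (degenerateSet R V T).Finite)
    {E₀ : ℂ} (hE₀ : E₀ ∈ lambdaSet R V T) : ∃ᶠ E in 𝓝[≠] E₀, E ∈ lambdaSet R V T := by
  intro hiso
  have hne0 : ∀ E i, eig R V T E i ≠ 0 := fun E i => (eig_spec R V T E).1.ne_zero hA i
  obtain ⟨δ, hδ, hball⟩ := Metric.eventually_nhds_iff.1
    (eventually_nhdsWithin_iff.1 (hiso.and (eventually_notMem_of_finite hB E₀)))
  set r := δ / 2 with hr
  have hr0 : 0 < r := half_pos hδ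
  have hgood : ∀ E ∈ Metric.closedBall E₀ r, E ≠ E₀ →
      E ∉ lambdaSet R V T ∧ E ∉ degenerateSet R V T := fun E hE hne =>
    hball ((Metric.mem_closedBall.1 hE).trans_lt (half_lt_self hδ)) hne
  have hsph : ∀ E ∈ Metric.sphere E₀ r, E ∈ Metric.closedBall E₀ r ∧ E ≠ E₀ := by
    intro E hE
    refine ⟨Metric.sphere_subset_closedBall hE, ?_⟩
    rintro rfl
    rw [Metric.mem_sphere, dist_self] at hE
    exact hr0.ne hE
  -- `ρ` bounds the quotients of the lower by the upper eigenvalues on the circle.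
  obtain ⟨ρ, hρ0, hρ1, hρ⟩ : ∃ ρ : ℝ, 0 ≤ ρ ∧ ρ < 1 ∧ ∀ E ∈ Metric.sphere E₀ r,
      ‖eig R V T E (midLow L)‖ / ‖eig R V T E (midHigh L)‖ ≤ ρ := by
    have hcont : ContinuousOn (fun E => ‖eig R V T E (midLow L)‖ / ‖eig R V T E (midHigh L)‖)
        (Metric.sphere E₀ r) :=
      (continuous_norm_eig _).continuousOn.div (continuous_norm_eig _).continuousOn
        fun E _ => norm_ne_zero_iff.2 (hne0 E _)
    obtain ⟨x, hx, hmax⟩ := (isCompact_sphere E₀ r).exists_isMaxOn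
      (NormedSpace.sphere_nonempty.2 hr0.le) hcont
    refine ⟨_, by positivity, ?_, fun E hE => hmax hE⟩
    rw [div_lt_one (norm_pos_iff.2 (hne0 x _))]
    exact lt_of_le_of_ne ((eig_spec R V T x).2 midLow_le_midHigh)
      (hgood x (hsph x hx).1 (hsph x hx).2).1
  obtain ⟨k, hk⟩ : ∃ k : ℕ,
      Real.exp ((indexZero L ×ˢ (indexZero L)ᶜ).card * ρ ^ k) - 1 < 1 := by
    have h1 : Tendsto (fun k : ℕ => Real.exp ((indexZero L ×ˢ (indexZero L)ᶜ).card * ρ ^ k) - 1)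
        atTop (𝓝 (Real.exp ((indexZero L ×ˢ (indexZero L)ᶜ).card * 0) - 1)) :=
      ((Real.continuous_exp.tendsto _).comp
        ((tendsto_pow_atTop_nhds_zero_of_lt_one hρ0 hρ1).const_mul _)).sub_const 1
    rw [mul_zero, Real.exp_zero, sub_self] at h1
    exact (h1.eventually_lt_const one_pos).exists
  -- Along an ultrafilter the listings converge to an ordered listing `y` at `E₀`; as `E₀ ∈ Λ`, the
  -- number `c` that cancels the middle factor has modulus one.
  set g := Ultrafilter.of (𝓝[≠] E₀)
  have hg : (g : Filter ℂ) ≤ 𝓝[≠] E₀ := Ultrafilter.of_le _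
  have hg' : (g : Filter ℂ) ≤ 𝓝 E₀ := hg.trans nhdsWithin_le_nhds
  obtain ⟨y, hy, hlim⟩ := exists_tendsto_isOrderedListing g
    (((continuous_transfer R V T).tendsto E₀).mono_left hg')
    (Eventually.of_forall fun E => eig_spec R V T E)
  have hy0 : ∀ i, y i ≠ 0 := fun i => hy.1.ne_zero hA i
  have hymid : ‖y (midLow L)‖ = ‖y (midHigh L)‖ := by
    have := hy.norm_eq (eig_spec R V T E₀)
    rw [congrFun this (midLow L), congrFun this (midHigh L)]
    exact hE₀
  set c : ℂ := ((y (midLow L) / y (midHigh L)) ^ k)⁻¹ with hc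
  have hc1 : ‖c‖ = 1 := by
    rw [hc, norm_inv, norm_pow, norm_div, hymid, div_self (norm_ne_zero_iff.2 (hy0 _)), one_pow,
      inv_one]
  set f : ℂ → ℂ := fun E => crossProduct L k c (eig R V T E) with hf
  have hflim : Tendsto f g (𝓝 0) := by
    have h1 : ContinuousAt (crossProduct L k c) y := by
      refine tendsto_finsetProd _ fun i _ => tendsto_finsetProd _ fun j _ => ?_
      have : ContinuousAt (fun z : Fin (2 * L) → ℂ => 1 - c * (z i / z j) ^ k) y :=
        continuousAt_const.sub (continuousAt_const.mul
          (((continuous_apply i).continuousAt.div (continuous_apply j).continuousAt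
            (hy0 j)).pow k))
      exact this
    have h2 : crossProduct L k c y = 0 := by
      refine Finset.prod_eq_zero midLow_mem (Finset.prod_eq_zero
        (Finset.mem_compl.2 midHigh_notMem) ?_)
      rw [hc, inv_mul_cancel₀, sub_self]
      exact pow_ne_zero _ (div_ne_zero (hy0 _) (hy0 _))
    rw [← h2]
    exact h1.tendsto.comp hlim
  have hfd : DifferentiableOn ℂ f (Metric.closedBall E₀ r \ {E₀}) := by
    intro E hE
    have h1 := hgood E hE.1 hE.2
    refine ((symmetricOn_crossProduct k c).analyticAt h1.1 h1.2
      fun ζ hζ => ?_).differentiableAt.differentiableWithinAt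
    refine Finset.analyticAt_fun_prod _ fun i _ => Finset.analyticAt_fun_prod _ fun j _ => ?_
    exact analyticAt_const.sub (analyticAt_const.mul
      (((hζ.1 i).div (hζ.1 j) (hζ.lists.ne_zero hA j)).pow k))
  -- The crude bound `1` on the quotients makes `f` bounded, so that the singularity is removable.
  have hfb : BddAbove (norm ∘ f '' (Metric.closedBall E₀ r \ {E₀})) := by
    refine ⟨1 + (Real.exp ((indexZero L ×ˢ (indexZero L)ᶜ).card * 1 ^ k) - 1), ?_⟩
    rintro _ ⟨E, -, rfl⟩
    have h1 := norm_crossProduct_sub_one_le (k := k) hc1 (z := eig R V T E) (ρ := 1)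
      fun i hi j hj => (norm_div_le_of_monotone (eig_spec R V T E).2 (hne0 E) hi hj).trans
        (div_le_one_of_le₀ ((eig_spec R V T E).2 midLow_le_midHigh) (norm_nonneg _))
    have h2 := norm_le_norm_add_norm_sub' (f E) 1
    rw [norm_one] at h2
    exact h2.trans (by gcongr)
  have hext := Complex.differentiableOn_update_limUnder_of_bddAbove
    (Metric.closedBall_mem_nhds E₀ hr0) hfd hfb
  set F := Function.update f E₀ (limUnder (𝓝[≠] E₀) f) with hF
  have hFf : ∀ E, E ≠ E₀ → F E = f E := fun E hE => Function.update_of_ne hE _ _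
  set b := Real.exp ((indexZero L ×ˢ (indexZero L)ᶜ).card * ρ ^ k) - 1 with hb
  have hmax : ∀ E ∈ Metric.closedBall E₀ r, ‖F E - 1‖ ≤ b := by
    intro E hE
    refine Complex.norm_le_of_forall_mem_frontier_norm_le (f := fun E => F E - 1)
      (U := Metric.ball E₀ r) Metric.isBounded_ball
      ((hext.sub_const 1).diffContOnCl_ball subset_rfl) ?_ ?_
    · intro E' hE'
      rw [frontier_ball E₀ hr0.ne'] at hE'
      rw [hFf E' (hsph E' hE').2]
      exact norm_crossProduct_sub_one_le hc1 fun i hi j hj =>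
        (norm_div_le_of_monotone (eig_spec R V T E').2 (hne0 E') hi hj).trans (hρ E' hE')
    · rw [closure_ball E₀ hr0.ne']
      exact hE
  have hle : ∀ᶠ E in (g : Filter ℂ), ‖f E - 1‖ ≤ b := by
    filter_upwards [hg' (Metric.closedBall_mem_nhds E₀ hr0), hg self_mem_nhdsWithin] with E h1 h2
    rw [← hFf E h2]
    exact hmax E h1
  have h1 := le_of_tendsto ((hflim.sub_const 1).norm) hle
  rw [zero_sub, norm_neg, norm_one] at h1
  linarith

end Perfect

section Rescaling

/-- If `H N` is exponentially close to `a + f ^ N b` near a point with `‖f‖ = 1`, `f' ≠ 0`, `a ≠ 0`,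
`b ≠ 0`, then the zeros of `H N` accumulate at that point: rescaled by `N`, the functions `H N`
converge to `a + ω b exp (c t)` along ultrafilters. -/
theorem eventually_exists_zero_of_two_terms {E₁ : ℂ} {f a b : ℂ → ℂ} {H : ℕ → ℂ → ℂ} {C κ : ℝ}
    (hf : AnalyticAt ℂ f E₁) (ha : ContinuousAt a E₁) (hb : ContinuousAt b E₁)
    (hf1 : ‖f E₁‖ = 1) (hf' : deriv f E₁ ≠ 0) (ha0 : a E₁ ≠ 0) (hb0 : b E₁ ≠ 0)
    (hκ0 : 0 ≤ κ) (hκ1 : κ < 1)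
    (hH : ∀ᶠ E in 𝓝 E₁, ∀ N, ‖H N E - (a E + f E ^ N * b E)‖ ≤ C * κ ^ N)
    (hd : ∀ᶠ E in 𝓝 E₁, ∀ N, DifferentiableAt ℂ (H N) E) {ε : ℝ} (hε : 0 < ε) :
    ∀ᶠ N in atTop, ∃ E, dist E E₁ < ε ∧ H N E = 0 := by
  by_contra hcon
  rw [not_eventually] at hcon
  have hNB : (atTop ⊓ 𝓟 {N : ℕ | ¬∃ E, dist E E₁ < ε ∧ H N E = 0}).NeBot :=
    frequently_mem_iff_neBot.1 hcon
  set g := Ultrafilter.of (atTop ⊓ 𝓟 {N : ℕ | ¬∃ E, dist E E₁ < ε ∧ H N E = 0})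
  have hg := Ultrafilter.of_le (atTop ⊓ 𝓟 {N : ℕ | ¬∃ E, dist E E₁ < ε ∧ H N E = 0})
  have hgt : (g : Filter ℕ) ≤ atTop := hg.trans inf_le_left
  have hgb : ∀ᶠ N in (g : Filter ℕ), ¬∃ E, dist E E₁ < ε ∧ H N E = 0 :=
    le_principal_iff.1 (hg.trans inf_le_right)
  have hf0 : f E₁ ≠ 0 := norm_ne_zero_iff.1 (by rw [hf1]; exact one_ne_zero)
  obtain ⟨ω, hω1, hω⟩ : ∃ ω : ℂ, ‖ω‖ = 1 ∧ Tendsto (fun N => f E₁ ^ N) g (𝓝 ω) := by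
    obtain ⟨ω, h1, h2⟩ := (isCompact_sphere (0 : ℂ) 1).ultrafilter_le_nhds
      (g.map fun N => f E₁ ^ N) (by
        rw [le_principal_iff]
        change ∀ᶠ N in (g : Filter ℕ), f E₁ ^ N ∈ Metric.sphere (0 : ℂ) 1
        refine Eventually.of_forall fun N => ?_
        rw [mem_sphere_zero_iff_norm, norm_pow, hf1, one_pow])
    exact ⟨ω, mem_sphere_zero_iff_norm.1 h1, h2⟩
  have hω0 : ω ≠ 0 := norm_ne_zero_iff.1 (by rw [hω1]; exact one_ne_zero)
  set c := deriv f E₁ / f E₁ with hc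
  have hc0 : c ≠ 0 := div_ne_zero hf' hf0
  set G : ℂ → ℂ := fun t => a E₁ + ω * Complex.exp (c * t) * b E₁ with hG
  -- `t₀` is a zero of the limit function `G`.
  set t₀ := Complex.log (-(a E₁) / (ω * b E₁)) / c with ht₀
  have hexp : Complex.exp (c * t₀) = -(a E₁) / (ω * b E₁) := by
    rw [ht₀, mul_div_cancel₀ _ hc0, Complex.exp_log]
    exact div_ne_zero (neg_ne_zero.2 ha0) (mul_ne_zero hω0 hb0)
  have hG0 : G t₀ = 0 := by
    simp only [hG]
    rw [hexp]
    field_simp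
    ring
  have hGan : AnalyticAt ℂ G t₀ := by
    simp only [hG]
    fun_prop
  have hGne : ∃ᶠ t in 𝓝 t₀, G t ≠ 0 := by
    have h1 : HasDerivAt G (ω * (Complex.exp (c * t₀) * c) * b E₁) t₀ := by
      have h2 : HasDerivAt (fun t : ℂ => c * t) c t₀ := by
        simpa using (hasDerivAt_id t₀).const_mul c
      exact ((h2.cexp.const_mul ω).mul_const (b E₁)).const_add (a E₁)
    have h2 := h1.eventually_ne (c := 0) (mul_ne_zero (mul_ne_zero hω0
      (mul_ne_zero (Complex.exp_ne_zero _) hc0)) hb0)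
    exact h2.frequently.filter_mono nhdsWithin_le_nhds
  -- `lam` is a logarithm of `f / f E₁` near `E₁`, with derivative `c` there.
  set lam : ℂ → ℂ := fun E => Complex.log (f E / f E₁) with hlam
  have hlam0 : lam E₁ = 0 := by simp [hlam]
  have hlamd : HasDerivAt lam c E₁ := by
    have h1 : HasDerivAt (fun E => f E / f E₁) (deriv f E₁ / f E₁) E₁ :=
      hf.differentiableAt.hasDerivAt.div_const _
    have h2 := h1.clog (by rw [div_self hf0]; exact Complex.one_mem_slitPlane)
    rwa [div_self hf0, div_one] at h2
  have hexplam : ∀ᶠ E in 𝓝 E₁, f E = f E₁ * Complex.exp (lam E) := by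
    filter_upwards [hf.continuousAt.eventually_ne hf0] with E hE
    rw [hlam, Complex.exp_log (div_ne_zero hE hf0), mul_div_cancel₀ _ hf0]
  set shift : ℕ × ℂ → ℂ := fun p => E₁ + p.2 / p.1 with hshift
  have hinv : Tendsto (fun N : ℕ => ((N : ℂ))⁻¹) g (𝓝 0) :=
    (tendsto_inv_atTop_nhds_zero_nat (𝕜 := ℂ)).mono_left hgt
  have hdiff : ∀ t, Tendsto (fun p : ℕ × ℂ => p.2 / (p.1 : ℂ)) (g ×ˢ 𝓝 t) (𝓝 0) := by
    intro t
    have h1 := (tendsto_snd (f := (g : Filter ℕ)) (g := 𝓝 t)).mul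
      (hinv.comp (tendsto_fst (f := (g : Filter ℕ)) (g := 𝓝 t)))
    rw [mul_zero] at h1
    exact h1
  have hshiftlim : ∀ t, Tendsto shift (g ×ˢ 𝓝 t) (𝓝 E₁) := by
    intro t
    have := (hdiff t).const_add E₁
    rwa [add_zero] at this
  have hpos : ∀ᶠ N in (g : Filter ℕ), N ≠ 0 := hgt (eventually_ne_atTop 0)
  -- Joint convergence in `(N, t)` amounts to locally uniform convergence in `t`.
  have hFlim : ∀ t, Tendsto (fun p : ℕ × ℂ => H p.1 (shift p)) (g ×ˢ 𝓝 t) (𝓝 (G t)) := by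
    intro t
    have h1 : Tendsto (fun p : ℕ × ℂ => (p.1 : ℂ) * lam (shift p)) (g ×ˢ 𝓝 t) (𝓝 (c * t)) := by
      have h2 : Tendsto (fun p : ℕ × ℂ => (p.1 : ℂ) • (p.2 / (p.1 : ℂ))) (g ×ˢ 𝓝 t) (𝓝 t) := by
        refine (tendsto_snd (f := (g : Filter ℕ)) (g := 𝓝 t)).congr' ?_
        filter_upwards [hpos.prod_inl (𝓝 t)] with p hp
        rw [smul_eq_mul, mul_div_cancel₀]
        exact_mod_cast hp
      have h3 := hlamd.hasFDerivAt.hasFDerivWithinAt.lim (s := Set.univ) (hdiff t)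
        (Eventually.of_forall fun _ => Set.mem_univ _) h2
      simp only [hlam0, sub_zero, smul_eq_mul, ContinuousLinearMap.toSpanSingleton_apply] at h3
      rw [mul_comm c t]
      exact h3
    have h2 : Tendsto (fun p : ℕ × ℂ => f (shift p) ^ p.1) (g ×ˢ 𝓝 t)
        (𝓝 (ω * Complex.exp (c * t))) := by
      have h3 := (hω.comp (tendsto_fst (f := (g : Filter ℕ)) (g := 𝓝 t))).mul
        ((Complex.continuous_exp.tendsto _).comp h1)
      refine h3.congr' ?_
      filter_upwards [(hshiftlim t).eventually hexplam] with p hp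
      simp only [Function.comp]
      rw [hp, mul_pow, ← Complex.exp_nat_mul]
    have h3 : Tendsto (fun p : ℕ × ℂ => a (shift p) + f (shift p) ^ p.1 * b (shift p)) (g ×ˢ 𝓝 t)
        (𝓝 (G t)) := (ha.tendsto.comp (hshiftlim t)).add (h2.mul (hb.tendsto.comp (hshiftlim t)))
    have h4 : Tendsto (fun p : ℕ × ℂ => H p.1 (shift p) -
        (a (shift p) + f (shift p) ^ p.1 * b (shift p))) (g ×ˢ 𝓝 t) (𝓝 0) := by
      have h5 : Tendsto (fun N : ℕ => C * κ ^ N) g (𝓝 0) := by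
        have := ((tendsto_pow_atTop_nhds_zero_of_lt_one hκ0 hκ1).const_mul C).mono_left hgt
        rwa [mul_zero] at this
      refine squeeze_zero_norm' ?_ (h5.comp (tendsto_fst (f := (g : Filter ℕ)) (g := 𝓝 t)))
      filter_upwards [(hshiftlim t).eventually hH] with p hp
      exact hp p.1
    have h5 := h4.add h3
    rw [zero_add] at h5
    exact h5.congr fun p => sub_add_cancel _ _
  have hcompact := isCompact_closedBall t₀ (1 : ℝ)
  have hunif : TendstoUniformlyOn (fun N t => H N (shift (N, t))) G g (Metric.closedBall t₀ 1) := by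
    rw [← tendstoLocallyUniformlyOn_iff_tendstoUniformlyOn_of_compact hcompact,
      tendstoLocallyUniformlyOn_iff_forall_tendsto]
    intro t _
    have hle : (g : Filter ℕ) ×ˢ 𝓝[Metric.closedBall t₀ 1] t ≤ g ×ˢ 𝓝 t :=
      Filter.prod_mono le_rfl nhdsWithin_le_nhds
    have h1 : Tendsto (fun p : ℕ × ℂ => G p.2) (g ×ˢ 𝓝 t) (𝓝 (G t)) := by
      have : Continuous G := by
        simp only [hG]
        fun_prop
      exact (this.tendsto t).comp tendsto_snd
    have h2 := (h1.prodMk_nhds (hFlim t)).mono_left hle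
    exact h2.trans (nhds_le_uniformity _)
  have hsmall : ∀ {p : ℂ → Prop}, (∀ᶠ E in 𝓝 E₁, p E) →
      ∀ᶠ N in (g : Filter ℕ), ∀ t ∈ Metric.closedBall t₀ 1, p (shift (N, t)) := by
    intro p hp
    obtain ⟨δ, hδ, hball⟩ := Metric.eventually_nhds_iff.1 hp
    have h1 : Tendsto (fun N : ℕ => (‖t₀‖ + 1) * ‖((N : ℂ))⁻¹‖) g (𝓝 0) := by
      have := hinv.norm.const_mul (‖t₀‖ + 1)
      rwa [norm_zero, mul_zero] at this
    filter_upwards [h1.eventually_lt_const hδ] with N hN t ht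
    refine hball ?_
    rw [hshift, dist_eq_norm, add_sub_cancel_left, div_eq_mul_inv, norm_mul]
    refine lt_of_le_of_lt (mul_le_mul_of_nonneg_right ?_ (norm_nonneg _)) hN
    have h2 := norm_le_norm_add_norm_sub' t t₀
    rw [← dist_eq_norm] at h2
    have h3 := Metric.mem_closedBall.1 ht
    linarith
  have hFd : ∀ᶠ N in (g : Filter ℕ),
      DifferentiableOn ℂ (fun t => H N (shift (N, t))) (Metric.closedBall t₀ 1) := by
    filter_upwards [hsmall hd] with N hN t ht
    have h1 : DifferentiableAt ℂ (fun t : ℂ => shift (N, t)) t := by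
      simp only [hshift]
      fun_prop
    exact (DifferentiableAt.comp (g := H N) t (hN t ht N) h1).differentiableWithinAt
  have hzero := eventually_exists_zero one_pos hFd hGan hG0 hGne hunif one_pos
  obtain ⟨N, ⟨t, ht, h0⟩, hbad, hcl⟩ :=
    (hzero.and (hgb.and (hsmall (Metric.ball_mem_nhds E₁ hε)))).exists
  exact hbad ⟨shift (N, t), hcl t ht, h0⟩

end Rescaling

/-! ### The limits of the spectra -/

section Critical

variable [NeZero L]

theorem prod_compl_indexOne (z : Fin (2 * L) → ℂ) :
    (∏ i ∈ (indexOne L)ᶜ, z i) * z (midHigh L) = z (midLow L) * ∏ i ∈ (indexZero L)ᶜ, z i := by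
  have hlh : midLow L ≠ midHigh L := fun h => midHigh_notMem (h ▸ midLow_mem)
  have h1 : (indexOne L)ᶜ = insert (midLow L) ((indexZero L)ᶜ.erase (midHigh L)) := by
    ext i
    rw [Finset.mem_compl, mem_indexOne_iff, Finset.mem_insert, Finset.mem_erase, Finset.mem_compl]
    by_cases h : i = midLow L
    · subst h
      simp [hlh]
    · simp only [h, not_false_eq_true, ne_eq, and_true, not_or, false_or]
      tauto
  rw [h1, Finset.prod_insert, mul_assoc, Finset.prod_erase_mul]
  · exact Finset.mem_compl.2 midHigh_notMem
  · intro h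
    exact (Finset.mem_compl.1 (Finset.mem_of_mem_erase h)) midLow_mem

/-- If only the two middle moduli coincide, then the two leading products of `L` eigenvalues are
those over the complements of `I₀` and `I₁`. -/
theorem MiddleIsolated.norm_prod_compl_lt {z : Fin (2 * L) → ℂ} (h : MiddleIsolated z)
    (hmid : ‖z (midLow L)‖ = ‖z (midHigh L)‖) (hz : ∀ i, z i ≠ 0) {I : Finset (Fin (2 * L))}
    (hI : I ∈ halfSets L) (h0 : I ≠ indexZero L) (h1 : I ≠ indexOne L) :
    ‖∏ i ∈ Iᶜ, z i‖ < ‖∏ i ∈ (indexZero L)ᶜ, z i‖ := by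
  rw [norm_prod, norm_prod]
  have hIc : I.card = L := (Finset.mem_powersetCard.1 hI).2
  have hlow : ∀ i ∈ indexZero L, ‖z i‖ ≤ ‖z (midLow L)‖ := by
    intro i hi
    by_cases hm : i = midLow L
    · rw [hm]
    · exact (h.1 i hi hm).1.le
  have hhigh : ∀ i ∉ indexZero L, ‖z (midLow L)‖ ≤ ‖z i‖ := by
    intro i hi
    by_cases hm : i = midHigh L
    · rw [hm, hmid]
    · exact (h.2 i hi hm).1.le
  refine prod_lt_prod_of_exchange (fun i => norm_pos_iff.2 (hz i)) ?_ ?_ ?_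
  · rw [(Finset.mem_powersetCard.1 (mem_halfSets_compl hI)).2,
      (Finset.mem_powersetCard.1 (mem_halfSets_compl (indexZero_mem_halfSets L))).2]
  · intro a ha b hb
    simp only [Finset.mem_sdiff, Finset.mem_compl, not_not] at ha hb
    exact (hlow a ha.2).trans (hhigh b hb.1)
  by_contra hcon
  rw [not_or] at hcon
  obtain ⟨hc1, hc2⟩ := hcon
  have ha : (indexZero L).erase (midLow L) ⊆ I := by
    intro a ha
    by_contra haI
    have ha' := Finset.mem_erase.1 ha
    refine hc1 ⟨a, by simp [haI, ha'.2], fun b hb => ?_⟩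
    simp only [Finset.mem_sdiff, Finset.mem_compl, not_not] at hb
    exact (h.1 a ha'.2 ha'.1).1.trans_le (hhigh b hb.1)
  have hb : I ⊆ insert (midHigh L) (indexZero L) := by
    intro b hbI
    by_contra hb
    rw [Finset.mem_insert, not_or] at hb
    refine hc2 ⟨b, by simp [hbI, hb.2], fun a ha => ?_⟩
    simp only [Finset.mem_sdiff, Finset.mem_compl, not_not] at ha
    exact (hlow a ha.2).trans_lt (h.2 b hb.2 hb.1).1
  by_cases hm : midHigh L ∈ I
  · apply h1
    symm
    refine Finset.eq_of_subset_of_card_le ?_ (by rw [hIc, card_indexOne])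
    rw [indexOne_eq, Finset.insert_subset_iff]
    exact ⟨hm, ha⟩
  · apply h0
    refine Finset.eq_of_subset_of_card_le (fun b hbI => ?_) (by rw [hIc, card_indexZero])
    rcases Finset.mem_insert.1 (hb hbI) with rfl | hb
    · exact absurd hbI hm
    · exact hb

/-- The quotient of the two leading products of eigenvalues at an energy of `Λ`. -/
theorem ratio_eq {z : Fin (2 * L) → ℂ} (hz : ∀ i, z i ≠ 0) :
    (∏ i ∈ (indexOne L)ᶜ, z i) / ∏ i ∈ (indexZero L)ᶜ, z i = z (midLow L) / z (midHigh L) := by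
  rw [div_eq_div_iff (Finset.prod_ne_zero_iff.2 fun i _ => hz i) (hz _)]
  exact prod_compl_indexOne z

/-- Zeros of the determinants accumulate at the energies of `Λ` at which two terms of comparable
size dominate the expansion with nonvanishing coefficients. -/
theorem eventually_exists_powerDet_eq_zero (hA : IsUnit T ∧ IsUnit R) {E₁ : ℂ}
    {ζ : Fin (2 * L) → ℂ → ℂ} (hζ : IsAnalyticListing R V T E₁ ζ)
    (hF : E₁ ∉ degenerateSet R V T) (hm : MiddleIsolated fun i => ζ i E₁)
    (hmid : ‖ζ (midLow L) E₁‖ = ‖ζ (midHigh L) E₁‖)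
    (hq0 : qFun R V T (indexZero L) E₁ (fun i => ζ i E₁) ≠ 0)
    (hq1 : qFun R V T (indexOne L) E₁ (fun i => ζ i E₁) ≠ 0)
    (hder : deriv (fun E => ζ (midLow L) E / ζ (midHigh L) E) E₁ ≠ 0) {ε : ℝ} (hε : 0 < ε) :
    ∀ᶠ N in atTop, ∃ E, dist E E₁ < ε ∧ powerDet R V T N E = 0 := by
  have hnz₁ : ∀ i, ζ i E₁ ≠ 0 := hζ.lists.ne_zero hA
  obtain ⟨C, κ, -, hκ0, hκ1, hbound⟩ := hζ.exists_sum_bound hA hF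
    (((halfSets L).erase (indexZero L)).erase (indexOne L)) (fun I hI => by
      have h1 := Finset.mem_of_mem_erase hI
      exact hm.norm_prod_compl_lt hmid hnz₁ (Finset.mem_of_mem_erase h1)
        (Finset.ne_of_mem_erase h1) (Finset.ne_of_mem_erase hI))
  have hloc := (hζ.eventually.and (hζ.eventually_injective hF))
  have h01 : indexOne L ≠ indexZero L := by
    intro h
    apply midHigh_notMem (L := L)
    rw [← h, indexOne_eq]
    exact Finset.mem_insert_self _ _
  have hev : ∀ᶠ E in 𝓝 E₁, ∏ i ∈ (indexZero L)ᶜ, ζ i E ≠ 0 := by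
    filter_upwards [hζ.eventually] with E h1
    exact Finset.prod_ne_zero_iff.2 fun i _ => h1.lists.ne_zero hA i
  obtain ⟨δ, hδ, hball⟩ := Metric.eventually_nhds_iff.1 hev
  have key := eventually_exists_zero_of_two_terms (E₁ := E₁)
    (f := fun E => ζ (midLow L) E / ζ (midHigh L) E)
    (a := fun E => qFun R V T (indexZero L) E fun i => ζ i E)
    (b := fun E => qFun R V T (indexOne L) E fun i => ζ i E)
    (H := fun N E => (-1) ^ L * powerDet R V T N E / (∏ i ∈ (indexZero L)ᶜ, ζ i E) ^ N)
    (C := C) (κ := κ) ((hζ.1 _).div (hζ.1 _) (hnz₁ _))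
    (hζ.analyticAt_qFun hF _).continuousAt (hζ.analyticAt_qFun hF _).continuousAt
    (by rw [norm_div, hmid, div_self (norm_ne_zero_iff.2 (hnz₁ _))]) hder hq0 hq1 hκ0 hκ1
    (by
      filter_upwards [hloc, hbound] with E ⟨h1, h2⟩ h3 N
      have hnz : ∀ i, ζ i E ≠ 0 := h1.lists.ne_zero hA
      have hpz : ∏ i ∈ (indexZero L)ᶜ, ζ i E ≠ 0 := Finset.prod_ne_zero_iff.2 fun i _ => hnz i
      have hsign : ((-1 : ℂ) ^ L) * (-1) ^ L = 1 := by rw [← mul_pow]; simp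
      have hexp : (-1) ^ L * powerDet R V T N E / (∏ i ∈ (indexZero L)ᶜ, ζ i E) ^ N =
          qFun R V T (indexZero L) E (fun i => ζ i E) +
          ((ζ (midLow L) E / ζ (midHigh L) E) ^ N * qFun R V T (indexOne L) E (fun i => ζ i E) +
          ∑ I ∈ ((halfSets L).erase (indexZero L)).erase (indexOne L),
            ((∏ i ∈ Iᶜ, ζ i E) / ∏ i ∈ (indexZero L)ᶜ, ζ i E) ^ N *
              qFun R V T I E (fun i => ζ i E)) := by
        rw [powerDet_eq_sum h1.lists h2, ← mul_assoc, hsign, one_mul,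
          ← Finset.add_sum_erase _ _ (indexZero_mem_halfSets L),
          ← Finset.add_sum_erase _ _ (Finset.mem_erase.2 ⟨h01, indexOne_mem_halfSets⟩),
          add_div, add_div, Finset.sum_div, ← ratio_eq hnz]
        congr 1
        · rw [mul_div_cancel_left₀]
          exact pow_ne_zero _ hpz
        · congr 1
          · rw [div_pow]; ring
          · refine Finset.sum_congr rfl fun I _ => ?_
            rw [div_pow]; ring
      rw [hexp, ← add_assoc, add_sub_cancel_left]
      exact h3 N)
    (by
      filter_upwards [hζ.eventually] with E h1 N
      have hpz : ∏ i ∈ (indexZero L)ᶜ, ζ i E ≠ 0 :=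
        Finset.prod_ne_zero_iff.2 fun i _ => h1.lists.ne_zero hA i
      refine (((differentiable_powerDet N) E).const_mul _).div ?_ (pow_ne_zero _ hpz)
      exact ((Finset.analyticAt_fun_prod _ fun i _ => h1.1 i).pow N).differentiableAt)
    (lt_min hε hδ)
  filter_upwards [key] with N ⟨E, hE, h0⟩
  refine ⟨E, hE.trans_le (min_le_left _ _), ?_⟩
  rcases div_eq_zero_iff.1 h0 with h | h
  · exact (mul_eq_zero.1 h).resolve_left (pow_ne_zero _ (by simp))
  · exact absurd (eq_zero_of_pow_eq_zero h) (hball (hE.trans_le (min_le_right _ _)))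

end Critical

section LimitSpectrum

variable [NeZero L]

theorem mem_uniformLimitSet_spectrum_of_powerDet (hT : IsUnit T) {E₁ : ℂ}
    (h : ∀ ε > 0, ∀ᶠ N in atTop, ∃ E, dist E E₁ < ε ∧ powerDet R V T N E = 0) :
    E₁ ∈ uniformLimitSet fun N => spectrum ℂ (finiteHam R V T N) := by
  rw [mem_uniformLimitSet_iff fun N hN => spectrum_finiteHam_nonempty R V T hN]
  intro ε hε
  filter_upwards [(tendsto_add_atTop_nat 1).eventually (h ε hε), eventually_ge_atTop 1]
    with N ⟨E, hE, h0⟩ hN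
  exact ⟨E, (mem_spectrum_finiteHam_iff hT hN E).2 h0, hE⟩

theorem gammaSet_subset_uniformLimitSet (hA : IsUnit T ∧ IsUnit R)
    (hB : (degenerateSet R V T).Finite) (hZ : vanishingSet R V T = ∅) :
    gammaSet R V T ⊆ uniformLimitSet fun N => spectrum ℂ (finiteHam R V T N) := by
  rintro E₀ ⟨hΛ, hq⟩
  refine mem_uniformLimitSet_spectrum_of_powerDet hA.1 fun ε hε => ?_
  obtain ⟨r, hr, hsub, hu⟩ := exists_tendstoUniformlyOn_scaledDet hA hB hΛ
  have hsign : ((-1 : ℂ) ^ L) ≠ 0 := pow_ne_zero _ (by simp)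
  have hne : ∃ᶠ E in 𝓝 E₀, (-1) ^ L * qLow R V T E ≠ 0 := by
    intro h
    have : E₀ ∈ vanishingSet R V T := by
      refine ⟨hΛ, ?_⟩
      filter_upwards [h] with E hE
      exact (mul_eq_zero.1 (not_not.1 hE)).resolve_left hsign
    rw [hZ] at this
    exact this
  have hzero := eventually_exists_zero hr (Eventually.of_forall fun N E hE =>
      (analyticAt_scaledDet hA hB (hsub hE) N).differentiableAt.differentiableWithinAt)
    (analyticAt_const.mul (analyticAt_qLow hB hΛ))
    (show (-1) ^ L * qLow R V T E₀ = 0 by rw [qLow, hq, mul_zero]) hne hu (half_pos hε)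
  filter_upwards [hzero] with N ⟨E, hE, h0⟩
  exact ⟨E, (Metric.mem_closedBall.1 hE).trans_lt (half_lt_self hε),
    (scaledDet_eq_zero_iff hA N E).1 h0⟩

/-- The energies of `Λ` to which the two-term asymptotics apply are dense in `Λ`, and uniform limit
sets are closed. -/
theorem lambdaSet_subset_uniformLimitSet (hA : IsUnit T ∧ IsUnit R)
    (hB : (degenerateSet R V T).Finite)
    (hC : {E ∈ frontier (lambdaSet R V T) | ¬ OnlyMiddleEqual R V T E}.Finite)
    (hD : ∀ E ∈ frontier (lambdaSet R V T) \ degenerateSet R V T, QNotLocallyZero R V T E) :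
    lambdaSet R V T ⊆ uniformLimitSet fun N => spectrum ℂ (finiteHam R V T N) := by
  intro E₀ hE₀
  have hfr := frontier_lambdaSet_eq hA hB hC
  rw [← (isClosed_uniformLimitSet fun N hN =>
    spectrum_finiteHam_nonempty R V T hN).closure_eq, Metric.mem_closure_iff]
  intro ε hε
  -- `E₁` is an energy of `Λ` outside the two finite exceptional sets.
  obtain ⟨E₁, hE₁Λ, hE₁B, hE₁d⟩ := ((frequently_mem_lambdaSet hA hB hE₀).and_eventually
    ((eventually_notMem_of_finite (hB.union hC) E₀).and
      (nhdsWithin_le_nhds (Metric.ball_mem_nhds E₀ (half_pos hε))))).exists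
  rw [Set.mem_union, not_or] at hE₁B
  obtain ⟨hF₁, hM₁⟩ := hE₁B
  have hE₁f : E₁ ∈ frontier (lambdaSet R V T) := hfr.symm ▸ hE₁Λ
  have hM : OnlyMiddleEqual R V T E₁ := by
    by_contra h
    exact hM₁ ⟨hE₁f, h⟩
  obtain ⟨z, hz, hq⟩ := hD E₁ ⟨hE₁f, hF₁⟩
  obtain ⟨ζ, hζ, hζ₁⟩ := exists_isAnalyticListing hF₁ hz.1
  obtain ⟨hq0, hq1⟩ := hq ζ hζ hζ₁
  have hmi : MiddleIsolated fun i => ζ i E₁ := by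
    simp_rw [hζ₁]
    exact (hM.middleIsolated hz).1
  obtain ⟨δ, hδ, hball⟩ := exists_ball_middleIsolated hζ hF₁ hmi
  have hne : ∀ {h : ℂ → ℂ}, AnalyticAt ℂ h E₁ → (∃ᶠ E in 𝓝 E₁, h E ≠ 0) →
      ∀ᶠ E in 𝓝[≠] E₁, h E ≠ 0 := by
    intro h hh hf
    rcases hh.eventually_eq_zero_or_eventually_ne_zero with h1 | h1
    · exact (hf (h1.mono fun t ht hn => hn ht)).elim
    · exact h1
  set f : ℂ → ℂ := fun E => ζ (midLow L) E / ζ (midHigh L) E with hf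
  have hnz : ∀ E ∈ Metric.ball E₁ δ, ζ (midHigh L) E ≠ 0 := fun E hE =>
    (hball E hE).1.lists.ne_zero hA _
  have hfan : ∀ E ∈ Metric.ball E₁ δ, AnalyticAt ℂ f E := fun E hE =>
    ((hball E hE).1.1 _).div ((hball E hE).1.1 _) (hnz E hE)
  have hfn : ∀ E ∈ Metric.ball E₁ δ, (E ∈ lambdaSet R V T ↔ ‖f E‖ = 1) := by
    intro E hE
    rw [(hball E hE).2.2.mem_lambdaSet_iff (hball E hE).1.lists, hf, norm_div,
      div_eq_one_iff_eq (norm_ne_zero_iff.2 (hnz E hE))]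
  have hE₁b : E₁ ∈ Metric.ball E₁ δ := Metric.mem_ball_self hδ
  -- Since `Λ` has empty interior, `f` is not constant near `E₁`.
  have hder : ∃ᶠ E in 𝓝 E₁, deriv f E ≠ 0 := by
    intro h
    obtain ⟨η, hη, hηball⟩ := Metric.eventually_nhds_iff.1
      (h.and (Metric.ball_mem_nhds E₁ hδ : ∀ᶠ E in 𝓝 E₁, E ∈ Metric.ball E₁ δ))
    have hint : E₁ ∈ interior (lambdaSet R V T) := by
      rw [mem_interior]
      refine ⟨Metric.ball E₁ η, fun E hE => ?_, Metric.isOpen_ball, Metric.mem_ball_self hη⟩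
      rw [hfn E (hηball hE).2, Metric.isOpen_ball.is_const_of_deriv_eq_zero
        (convex_ball E₁ η).isPreconnected
        (fun E hE => (hfan E (hηball hE).2).differentiableAt.differentiableWithinAt)
        (fun E hE => not_not.1 (hηball hE).1) hE (Metric.mem_ball_self hη)]
      exact (hfn E₁ hE₁b).1 hE₁Λ
    exact hE₁f.2 hint
  have hb1 : ∀ᶠ E in 𝓝[≠] E₁, E ∈ Metric.ball E₁ δ :=
    nhdsWithin_le_nhds (Metric.ball_mem_nhds E₁ hδ)
  have hb2 : ∀ᶠ E in 𝓝[≠] E₁, E ∈ Metric.ball E₁ (ε / 2) :=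
    nhdsWithin_le_nhds (Metric.ball_mem_nhds E₁ (half_pos hε))
  -- Near `E₁`, an energy `E₂` of `Λ` outside the isolated zeros of `q_{I₀}`, `q_{I₁}` and `f'`.
  obtain ⟨E₂, hE₂Λ, h0, h1, h2, hE₂b, hE₂d⟩ :=
    ((frequently_mem_lambdaSet hA hB hE₁Λ).and_eventually
      ((hne (hζ.analyticAt_qFun hF₁ _) hq0).and ((hne (hζ.analyticAt_qFun hF₁ _) hq1).and
        ((hne (hfan E₁ hE₁b).deriv hder).and
          (hb1.and hb2))))).exists
  obtain ⟨hζ₂, hF₂, hmi₂⟩ := hball E₂ hE₂b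
  refine ⟨E₂, mem_uniformLimitSet_spectrum_of_powerDet hA.1 fun ε' hε' =>
    eventually_exists_powerDet_eq_zero hA hζ₂ hF₂ hmi₂
      ((hmi₂.mem_lambdaSet_iff hζ₂.lists).1 hE₂Λ) h0 h1 h2 hε', ?_⟩
  have h3 := dist_triangle E₂ E₁ E₀
  rw [Metric.mem_ball] at hE₂d
  rw [dist_comm]
  linarith

/-- Off `Λ ∪ Γ` the scaled determinants have no zeros near the point for large `N`. -/
theorem partialLimitSet_subset (hA : IsUnit T ∧ IsUnit R) (hB : (degenerateSet R V T).Finite) :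
    partialLimitSet (fun N => spectrum ℂ (finiteHam R V T N)) ⊆
      lambdaSet R V T ∪ gammaSet R V T := by
  rintro E₀ ⟨k, e, hke, hk, he⟩
  by_cases hΛ : E₀ ∈ lambdaSet R V T
  · exact Or.inl hΛ
  refine Or.inr ⟨hΛ, ?_⟩
  obtain ⟨r, hr, hsub, hu⟩ := exists_tendstoUniformlyOn_scaledDet hA hB hΛ
  have h0 : ∀ n, scaledDet R V T (k n + 1) (e n) = 0 := fun n =>
    (scaledDet_eq_zero_iff hA _ _).2 ((mem_spectrum_finiteHam_iff hA.1 (hke n).1 _).1 (hke n).2)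
  have h1 : Tendsto (fun n => (-1) ^ L * qLow R V T (e n)) atTop
      (𝓝 ((-1) ^ L * qLow R V T E₀)) :=
    ((continuousAt_const.mul (continuousAt_qLow hB hΛ)).tendsto).comp he
  have h2 : Tendsto (fun n => (-1) ^ L * qLow R V T (e n)) atTop (𝓝 0) := by
    rw [Metric.tendsto_nhds]
    intro ε hε
    filter_upwards [((tendsto_add_atTop_nat 1).comp hk).eventually
      (Metric.tendstoUniformlyOn_iff.1 hu ε hε),
      he.eventually (Metric.closedBall_mem_nhds E₀ hr)] with n h3 h4
    have := h3 (e n) h4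
    simp only [Function.comp] at this
    rwa [h0] at this
  have h3 := tendsto_nhds_unique h1 h2
  exact (mul_eq_zero.1 h3).resolve_left (pow_ne_zero _ (by simp))

end LimitSpectrum

end BlockToeplitz

theorem mainTheorem1 (L : ℕ) [NeZero L] (R V T : Matrix (Fin L) (Fin L) ℂ)
    (hA : IsUnit T ∧ IsUnit R)
    (hB : (BlockToeplitz.degenerateSet R V T).Finite)
    (hC : {E ∈ frontier (BlockToeplitz.lambdaSet R V T) |
      ¬ BlockToeplitz.OnlyMiddleEqual R V T E}.Finite)
    (hD : ∀ E ∈ frontier (BlockToeplitz.lambdaSet R V T) \ BlockToeplitz.degenerateSet R V T,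
      BlockToeplitz.QNotLocallyZero R V T E) :
    frontier (BlockToeplitz.lambdaSet R V T) ∪ BlockToeplitz.gammaSet R V T =
        closure (BlockToeplitz.uniformLimitSet
          fun N => spectrum ℂ (BlockToeplitz.finiteHam R V T N)) ∧
      frontier (BlockToeplitz.lambdaSet R V T) ∪ BlockToeplitz.gammaSet R V T =
        BlockToeplitz.partialLimitSet
          (fun N => spectrum ℂ (BlockToeplitz.finiteHam R V T N)) ∧
      {E ∈ frontier (BlockToeplitz.lambdaSet R V T) ∪ BlockToeplitz.gammaSet R V T |
        ¬ ∃ e : ℕ → ℂ, (∀ N, 1 ≤ N → e N ∈ spectrum ℂ (BlockToeplitz.finiteHam R V T N)) ∧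
          Tendsto e atTop (𝓝 E)}.Finite := by
  open BlockToeplitz in
  have hup : partialLimitSet (fun N => spectrum ℂ (finiteHam R V T N)) ⊆
      lambdaSet R V T ∪ gammaSet R V T := partialLimitSet_subset hA hB
  have hlow : lambdaSet R V T ∪ gammaSet R V T ⊆
      uniformLimitSet fun N => spectrum ℂ (finiteHam R V T N) :=
    Set.union_subset (lambdaSet_subset_uniformLimitSet hA hB hC hD)
      (gammaSet_subset_uniformLimitSet hA hB (vanishingSet_eq_empty hA hB hC hD))
  have hsub : uniformLimitSet (fun N => spectrum ℂ (finiteHam R V T N)) ⊆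
      partialLimitSet (fun N => spectrum ℂ (finiteHam R V T N)) :=
    uniformLimitSet_subset_partialLimitSet
  rw [frontier_lambdaSet_eq hA hB hC]
  refine ⟨?_, (hlow.trans hsub).antisymm hup, ?_⟩
  · rw [(isClosed_uniformLimitSet fun N hN =>
      spectrum_finiteHam_nonempty R V T hN).closure_eq]
    exact hlow.antisymm (hsub.trans hup)
  -- The exceptional set is empty, because the uniform limit set is closed.
  · convert Set.finite_empty
    rw [Set.eq_empty_iff_forall_notMem]
    rintro E ⟨hE, hno⟩
    exact hno (hlow hE)
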